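/- Conventions. A \emph{topological category} $\mathcal A$ is a small category internal to topological spaces: $\mathrm{ob}(\mathcal A)$ and $\mathrm{mor}(\mathcal A)$ are spaces, and source, target, identity and composition are continuous. An \emph{internal functor} is a functor that is continuous on objects and on morphisms. A (left) \emph{$\mathcal A$-module} is a space $X$ with a continuous map $f_X:X\to\mathrm{ob}(\mathcal A)$ and a continuous, unital and associative action $\mathrm{mor}(\mathcal A)\times_{\mathrm{ob}(\mathcal A)}X\to X$; write $X(a)=f_X^{-1}(a)$. Let $B(*,\mathcal A,X)_\bullet$ be the simplicial space with $$B(*,\mathcal A,X)_n=\{(a_0\to a_1\to\cdots\to a_n,\;x)\;:\;x\in X(a_0)\},$$ topologized as the iterated fibre product $\mathrm{mor}(\mathcal A)\times_{\mathrm{ob}(\mathcal A)}\cdots\times_{\mathrm{ob}(\mathcal A)}\mathrm{mor}(\mathcal A)\times_{\mathrm{ob}(\mathcal A)}X$, in which an order-preserving map $\theta:[m]\to[n]$ acts by $(a_0\to\cdots\to a_n,x)\mapsto(a_{\theta(0)}\to\cdots\to a_{\theta(m)},X(\alpha)(x))$ with $\alpha:a_0\to a_{\theta(0)}$ the composite.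 Define $\operatorname{hocolim}_{\mathcal A}X$ to be its geometric realization $|B(*,\mathcal A,X)_\bullet|$. A small category is regarded as a topological category with discrete spaces of objects and morphisms; a functor $F$ from it to topological spaces is regarded as the module $\coprod_d F(d)$. For a small category $\mathcal C$, let $\Delta^\bullet\downarrow\mathcal C$ be the category whose objects are the pairs $([k],\sigma:[k]\to\mathcal C)$ and whose morphisms $([k_0],\sigma_0)\to([k_1],\sigma_1)$ are the order-preserving maps $\theta:[k_1]\to[k_0]$ with $\sigma_1=\sigma_0\theta$. Given a topological category $\mathcal A$, an $\mathcal A$-module $X$ and an internal functor $\rho:\mathcal A\to\mathcal C$ to a discrete category, let $\rho_*X:\Delta^\bullet\downarrow\mathcal C\to\mathrm{Top}$ be the functor whose value at $\sigma:[k]\to\mathcal C$ is the subspace of $B(*,\mathcal A,X)_k$ of those $(a_0\to\cdots\to a_k,x)$ whose chain is sent by $\rho$ to $\sigma$, and which sends $\theta$ to the restriction of the simplicial operator of $\theta$. Theorem. Let $\mathcal C$ be a discrete category, let $\mathcal A$ be a topological category, $X$ an $\mathcal A$-module and $\rho:\mathcal A\to\mathcal C$ an internal functor. There is a map $$\operatorname{hocolim}_{\Delta^\bullet\downarrow\mathcal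 C}\rho_*X\longrightarrow\operatorname{hocolim}_{\mathcal A}X,$$ natural in $(\mathcal A,X,\mathcal C,\rho)$, which is a homotopy equivalence whenever the identity map $\mathrm{ob}(\mathcal A)\to\mathrm{mor}(\mathcal A)$ is a closed cofibration over $\mathrm{ob}(\mathcal A)\times\mathrm{ob}(\mathcal A)$ (with respect to the diagonal and the source-target map), i.e. has closed image and the homotopy extension property for maps and homotopies over $\mathrm{ob}(\mathcal A)\times\mathrm{ob}(\mathcal A)$. Here a morphism $(\mathcal A,X,\mathcal C,\rho)\to(\mathcal A',X',\mathcal C',\rho')$ consists of an internal functor $F:\mathcal A\to\mathcal A'$, a functor $G:\mathcal C\to\mathcal C'$ with $G\rho=\rho'F$, and a continuous map $X\to X'$ over $F$ that respects the actions. -/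

import Mathlib

open CategoryTheory Opposite


universe v u

/-- The set of all morphisms of a category. -/
@[ext]
structure Mor (C : Type u) [Category.{v} C] : Type (max u v) where
  {source target : C}
  hom : source ⟶ target

/-- A topological category, i.e. a category internal to topological spaces: a (small) category
with topologies on the set of objects and on the set of all morphisms for which source, target,
identity and composition (on the space `mor ×_ob mor` of composable pairs) are continuous. -/
structure TopologicalCategory where
  ob : Type u
  [cat : Category.{v} ob]
  [topOb : TopologicalSpace ob]
  [topMor : TopologicalSpace (Mor ob)]
  continuous_source : Continuous fun f : Mor ob => f.source
  continuous_target : Continuous fun f : Mor ob => f.target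
  continuous_id : Continuous fun a : ob => Mor.mk (𝟙 a)
  continuous_comp : Continuous fun p : {p : Mor ob × Mor ob // p.1.target = p.2.source} =>
    Mor.mk (p.1.1.hom ≫ eqToHom p.2 ≫ p.1.2.hom)

attribute [instance] TopologicalCategory.cat TopologicalCategory.topOb TopologicalCategory.topMor

namespace TopologicalCategory

/-- The space of morphisms. -/
abbrev mor (A : TopologicalCategory.{v, u}) : Type (max u v) := Mor A.ob

/-- A small category with the discrete topology on objects and on morphisms. -/
@[reducible]
def discrete (C : Type u) [Category.{v} C] : TopologicalCategory.{v, u} where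
  ob := C
  topOb := ⊥
  topMor := ⊥
  continuous_source := continuous_bot
  continuous_target := continuous_bot
  continuous_id := continuous_bot
  continuous_comp :=
    letI : TopologicalSpace (Mor C) := ⊥
    haveI : DiscreteTopology (Mor C) := ⟨rfl⟩
    continuous_of_discreteTopology

end TopologicalCategory

/-- `i : E → Y` is a closed cofibration over `B`, where `p : Y → B` is the structure map of `Y`
(and `p ∘ i` that of `E`): its image is closed and it has the homotopy extension property for
fibrewise maps and fibrewise homotopies into arbitrary spaces `Z` over `B`. -/
structure IsClosedCofibrationOver {B E Y : Type u} [TopologicalSpace B] [TopologicalSpace E]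
    [TopologicalSpace Y] (i : E → Y) (p : Y → B) : Prop where
  continuous : Continuous i
  continuous_proj : Continuous p
  isClosed_range : IsClosed (Set.range i)
  extension : ∀ (Z : Type u) [TopologicalSpace Z] (q : C(Z, B)) (f : C(Y, Z))
    (h : C(E × unitInterval, Z)), (∀ y, q (f y) = p y) → (∀ e t, q (h (e, t)) = p (i e)) →
    (∀ e, h (e, 0) = f (i e)) →
    ∃ H : C(Y × unitInterval, Z), (∀ y t, q (H (y, t)) = p y) ∧ (∀ y, H (y, 0) = f y) ∧
      ∀ e t, H (i e, t) = h (e, t)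

/-- The condition on a topological category that the identity map `ob → mor` is a closed
cofibration over `ob × ob`, with respect to the diagonal and the source-target map. -/
def TopologicalCategory.IdentityIsCofibration (A : TopologicalCategory.{u, u}) : Prop :=
  IsClosedCofibrationOver (fun a : A.ob => Mor.mk (𝟙 a)) fun f : A.mor => (f.source, f.target)

/-- The map on morphisms given by a functor. -/
def CategoryTheory.Functor.mapMor {C D : Type u} [Category.{v} C] [Category.{v} D] (F : C ⥤ D)
    (f : Mor C) : Mor D :=
  ⟨F.map f.hom⟩

/-- An internal functor between topological categories: a functor that is continuous on objects
and on morphisms. -/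
@[ext]
structure InternalFunctor (A B : TopologicalCategory.{v, u}) where
  functor : A.ob ⥤ B.ob
  continuous_obj : Continuous functor.obj
  continuous_map : Continuous functor.mapMor

namespace InternalFunctor

def id (A : TopologicalCategory.{v, u}) : InternalFunctor A A :=
  ⟨𝟭 _, continuous_id, continuous_id⟩

def comp {A B C : TopologicalCategory.{v, u}} (F : InternalFunctor A B)
    (G : InternalFunctor B C) : InternalFunctor A C :=
  ⟨F.functor ⋙ G.functor, G.continuous_obj.comp F.continuous_obj,
    G.continuous_map.comp F.continuous_map⟩

end InternalFunctor

/-- A left module over a topological category: a space `X` with a map `proj : X → ob` and an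
action `mor ×_ob X → X` which is continuous, unital and associative. -/
structure LeftModule (A : TopologicalCategory.{v, u}) where
  space : Type u
  [top : TopologicalSpace space]
  proj : space → A.ob
  continuous_proj : Continuous proj
  act : ∀ (f : A.mor) (x : space), f.source = proj x → space
  proj_act : ∀ f x h, proj (act f x h) = f.target
  continuous_act : Continuous fun z : {z : A.mor × space // z.1.source = proj z.2} =>
    act z.1.1 z.1.2 z.2
  act_id : ∀ x, act ⟨𝟙 (proj x)⟩ x rfl = x
  act_comp : ∀ {a b c : A.ob} (f : a ⟶ b) (g : b ⟶ c) (x : space) (h : a = proj x),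
    act ⟨f ≫ g⟩ x h = act ⟨g⟩ (act ⟨f⟩ x h) (proj_act ⟨f⟩ x h).symm

attribute [instance] LeftModule.top

namespace LeftModule

variable {D : Type u} [Category.{v} D] (F : D ⥤ TopCat.{u})

theorem continuous_fst_discrete :
    @Continuous (Σ d : D, F.obj d) D _ ⊥ Sigma.fst := by
  let _ : TopologicalSpace D := ⊥
  exact continuous_sigma fun d => continuous_const

theorem continuous_act_discrete :
    let _ : TopologicalSpace (Mor D) := ⊥
    Continuous fun z : {z : Mor D × Σ d : D, F.obj d // z.1.source = z.2.1} =>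
      (⟨z.1.1.target, F.map (eqToHom z.2.symm ≫ z.1.1.hom) z.1.2.2⟩ : Σ d : D, F.obj d) := by
  intro _
  have : DiscreteTopology (Mor D) := ⟨rfl⟩
  classical
  let g : Mor D × (Σ d : D, F.obj d) → Σ d : D, F.obj d := fun z =>
    if h : z.1.source = z.2.1 then ⟨z.1.target, F.map (eqToHom h.symm ≫ z.1.hom) z.2.2⟩ else z.2
  have hg : Continuous g := by
    rw [continuous_prod_of_discrete_left]
    refine fun f => continuous_sigma fun d => ?_
    by_cases h : f.source = d
    · simp only [g, h, dite_true]
      exact (continuous_sigmaMk (σ := fun d => F.obj d)).comp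
        (F.map (eqToHom h.symm ≫ f.hom)).hom.continuous
    · simp only [g, h, dite_false]
      exact continuous_sigmaMk (σ := fun d => F.obj d)
  refine (hg.comp continuous_subtype_val).congr fun z => ?_
  simp only [g, Function.comp_apply, z.2, dite_true]

end LeftModule

/-- A functor from a small category to topological spaces, as a left module over the discrete
topological category: the total space is the disjoint union of the values. -/
@[reducible]
def LeftModule.ofFunctor {D : Type u} [Category.{v} D] (F : D ⥤ TopCat.{u}) :
    LeftModule (TopologicalCategory.discrete D) where
  space := Σ d : D, F.obj d
  proj := Sigma.fst
  continuous_proj := continuous_fst_discrete F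
  act f x h := ⟨f.target, F.map (eqToHom h.symm ≫ f.hom) x.2⟩
  proj_act _ _ _ := rfl
  continuous_act := continuous_act_discrete F
  act_id := by
    rintro ⟨d, x⟩
    simp
  act_comp := by
    rintro a b c f g ⟨d, x⟩ h
    simp

/-- A topological category together with a left module over it. -/
structure CatWithModule where
  A : TopologicalCategory.{v, u}
  X : LeftModule A

namespace CatWithModule

/-- Morphisms `(A, X) → (A', X')`: an internal functor `A → A'` and a continuous map `X → X'`
over it that respects the actions. -/
@[ext]
structure Hom (P Q : CatWithModule.{v, u}) where
  functor : InternalFunctor P.A Q.A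
  map : C(P.X.space, Q.X.space)
  proj_map : ∀ x, Q.X.proj (map x) = functor.functor.obj (P.X.proj x)
  map_act : ∀ (f : P.A.mor) (x : P.X.space) (h : f.source = P.X.proj x),
    map (P.X.act f x h) = Q.X.act (functor.functor.mapMor f) (map x)
      ((congrArg functor.functor.obj h).trans (proj_map x).symm)

instance : Category CatWithModule.{v, u} where
  Hom := Hom
  id P := ⟨.id _, .id _, fun _ => rfl, fun _ _ _ => rfl⟩
  comp f g := ⟨f.functor.comp g.functor, g.map.comp f.map,
    fun x => (g.proj_map _).trans (congrArg g.functor.functor.obj (f.proj_map x)),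
    fun a x h => (congrArg g.map (f.map_act a x h)).trans (g.map_act _ _ _)⟩

/-- The `n`-simplices of `B(*, A, X)`: a chain `a₀ → a₁ → ⋯ → aₙ` in `A` and a point of `X`
over `a₀`. -/
structure BarSimplex (P : CatWithModule.{v, u}) (n : ℕ) where
  chain : ComposableArrows P.A.ob n
  pt : P.X.space
  eq : chain.obj 0 = P.X.proj pt

namespace BarSimplex

variable {P Q : CatWithModule.{v, u}} {n : ℕ}

theorem ext' {z w : BarSimplex P n} (h₁ : z.chain = w.chain) (h₂ : z.pt = w.pt) : z = w := by
  cases z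
  cases w
  cases h₁
  cases h₂
  rfl

/-- The arrow `aᵢ → aⱼ` of the chain. -/
def arrow (z : BarSimplex P n) (i j : Fin (n + 1)) (h : i ≤ j) : P.A.mor :=
  ⟨z.chain.map (homOfLE h)⟩

/-- The inclusion of the `n`-simplices in `mor × ⋯ × mor × X`. -/
def toProd (z : BarSimplex P n) : (Fin n → P.A.mor) × P.X.space :=
  (fun i => z.arrow i.castSucc i.succ i.castSucc_le_succ, z.pt)

/-- The topology of the iterated fibre product `mor ×_ob ⋯ ×_ob mor ×_ob X`. -/
instance : TopologicalSpace (BarSimplex P n) := TopologicalSpace.induced toProd inferInstance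

theorem continuous_toProd : Continuous (toProd : BarSimplex P n → _) :=
  continuous_induced_dom

theorem continuous_pt : Continuous fun z : BarSimplex P n => z.pt :=
  (continuous_snd.comp continuous_toProd).congr fun _ => rfl

theorem continuous_spine (i : Fin n) :
    Continuous fun z : BarSimplex P n => z.arrow i.castSucc i.succ i.castSucc_le_succ :=
  ((continuous_apply i).comp (continuous_fst.comp continuous_toProd)).congr fun _ => rfl

theorem continuous_obj (i : Fin (n + 1)) :
    Continuous fun z : BarSimplex P n => z.chain.obj i := by
  induction i using Fin.cases with
  | zero => exact (P.X.continuous_proj.comp continuous_pt).congr fun z => z.eq.symm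
  | succ i => exact (P.A.continuous_target.comp (continuous_spine i)).congr fun _ => rfl

theorem continuous_arrow_self (i : Fin (n + 1)) :
    Continuous fun z : BarSimplex P n => z.arrow i i le_rfl :=
  (P.A.continuous_id.comp (continuous_obj i)).congr fun z =>
    congrArg Mor.mk (z.chain.map_id i).symm

theorem continuous_arrow (i j : Fin (n + 1)) (h : i ≤ j) :
    Continuous fun z : BarSimplex P n => z.arrow i j h := by
  induction j using Fin.induction with
  | zero =>
    obtain rfl : i = 0 := le_antisymm h (Fin.zero_le _)
    exact continuous_arrow_self 0
  | succ j ih =>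
    rcases h.eq_or_lt with rfl | hlt
    · exact continuous_arrow_self _
    · have hij : i ≤ j.castSucc := Fin.le_castSucc_iff.mpr hlt
      have key : Continuous fun z : BarSimplex P n =>
          (⟨(z.arrow i j.castSucc hij, z.arrow j.castSucc j.succ j.castSucc_le_succ), rfl⟩ :
            {p : P.A.mor × P.A.mor // p.1.target = p.2.source}) :=
        ((ih hij).prodMk (continuous_spine j)).subtype_mk _
      refine (P.A.continuous_comp.comp key).congr fun z => ?_
      refine congrArg Mor.mk ?_
      change z.chain.map _ ≫ 𝟙 _ ≫ z.chain.map _ = z.chain.map _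
      rw [Category.id_comp, ← Functor.map_comp]
      rfl

/-- The simplicial operator of an order-preserving map `θ : [m] → [n]`: it sends
`(a₀ → ⋯ → aₙ, x)` to `(a_{θ(0)} → ⋯ → a_{θ(m)}, α x)`, where `α : a₀ → a_{θ(0)}`. -/
def pull {m n : ℕ} (θ : Fin (m + 1) →o Fin (n + 1)) (z : BarSimplex P n) : BarSimplex P m where
  chain := θ.monotone.functor ⋙ z.chain
  pt := P.X.act (z.arrow 0 (θ 0) (Fin.zero_le _)) z.pt z.eq
  eq := (P.X.proj_act (z.arrow 0 (θ 0) (Fin.zero_le _)) z.pt z.eq).symm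

theorem continuous_pull {m n : ℕ} (θ : Fin (m + 1) →o Fin (n + 1)) :
    Continuous (pull (P := P) θ) := by
  refine continuous_induced_rng.2 (Continuous.prodMk (continuous_pi fun i => ?_) ?_)
  · exact (continuous_arrow (P := P) _ _ (θ.monotone i.castSucc_le_succ)).congr fun _ => rfl
  · have key : Continuous fun z : BarSimplex P n =>
        (⟨(z.arrow 0 (θ 0) (Fin.zero_le _), z.pt), z.eq⟩ :
          {w : P.A.mor × P.X.space // w.1.source = P.X.proj w.2}) :=
      ((continuous_arrow _ _ _).prodMk continuous_pt).subtype_mk _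
    exact (P.X.continuous_act.comp key).congr fun _ => rfl

theorem act_map_self (z : BarSimplex P n) (i : Fin (n + 1)) (hi : i = 0) (f : (0 : Fin (n + 1)) ⟶ i) :
    P.X.act ⟨z.chain.map f⟩ z.pt z.eq = z.pt := by
  subst hi
  obtain rfl : f = 𝟙 _ := Subsingleton.elim _ _
  obtain ⟨c, x, h⟩ := z
  have : ∀ (a : P.A.ob) (h : a = P.X.proj x), P.X.act ⟨𝟙 a⟩ x h = x := by
    rintro _ rfl
    exact P.X.act_id x
  simpa using this _ h

theorem pull_id (z : BarSimplex P n) : pull OrderHom.id z = z :=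
  ext' rfl (act_map_self z _ rfl _)

theorem pull_comp {k m n : ℕ} (η : Fin (k + 1) →o Fin (m + 1)) (θ : Fin (m + 1) →o Fin (n + 1))
    (z : BarSimplex P n) : pull (θ.comp η) z = pull η (pull θ z) := by
  refine ext' rfl ?_
  refine Eq.trans ?_ (P.X.act_comp (z.chain.map (homOfLE (Fin.zero_le (θ 0))))
    (z.chain.map (homOfLE (θ.monotone (Fin.zero_le (η 0))))) z.pt z.eq)
  simp only [pull, arrow, ← Functor.map_comp, homOfLE_comp]
  rfl

/-- The map on `n`-simplices induced by a morphism `(A, X) → (A', X')`. -/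
def push (F : P ⟶ Q) (z : BarSimplex P n) : BarSimplex Q n where
  chain := z.chain ⋙ F.functor.functor
  pt := F.map z.pt
  eq := (congrArg F.functor.functor.obj z.eq).trans (F.proj_map _).symm

theorem continuous_push (F : P ⟶ Q) : Continuous (push (n := n) F) :=
  continuous_induced_rng.2 ((continuous_pi fun i =>
    (F.functor.continuous_map.comp (continuous_spine i)).congr fun _ => rfl).prodMk
      (F.map.continuous.comp continuous_pt))

theorem push_pull (F : P ⟶ Q) {m n : ℕ} (θ : Fin (m + 1) →o Fin (n + 1)) (z : BarSimplex P n) :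
    push F (pull θ z) = pull θ (push F z) :=
  ext' rfl (F.map_act (z.arrow 0 (θ 0) (Fin.zero_le _)) z.pt z.eq)

end BarSimplex

/-- The bar construction, as a functor `(A, X) ↦ B(*, A, X)_•` to simplicial spaces. -/
def bar : CatWithModule.{v, u} ⥤ SimplicialObject TopCat.{max u v} where
  obj P :=
    { obj n := TopCat.of (BarSimplex P n.unop.len)
      map θ := TopCat.ofHom ⟨BarSimplex.pull θ.unop.toOrderHom, BarSimplex.continuous_pull _⟩
      map_id n := by
        ext z
        exact BarSimplex.pull_id z
      map_comp f g := by
        ext z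
        exact BarSimplex.pull_comp _ _ z }
  map F :=
    { app n := TopCat.ofHom ⟨BarSimplex.push F, BarSimplex.continuous_push F⟩
      naturality m n θ := by
        ext z
        exact BarSimplex.push_pull F θ.unop.toOrderHom z }

end CatWithModule

namespace SimplicialSpace

/-- The disjoint union of the spaces `Yₙ × Δⁿ`. -/
abbrev Pre (Y : SimplicialObject TopCat.{u}) : Type u :=
  Σ n : SimplexCategory, Y.obj (op n) × stdSimplex ℝ (Fin (n.len + 1))

/-- The relation `(θ^* y, t) ∼ (y, θ_* t)`, for `θ : [m] → [n]`, `y ∈ Yₙ` and `t ∈ Δᵐ`. -/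
inductive Rel (Y : SimplicialObject TopCat.{u}) : Pre Y → Pre Y → Prop
  | intro {m n : SimplexCategory} (θ : m ⟶ n) (y : Y.obj (op n))
      (t : stdSimplex ℝ (Fin (m.len + 1))) :
      Rel Y ⟨m, Y.map θ.op y, t⟩ ⟨n, y, stdSimplex.map θ.toOrderHom t⟩

/-- The map on the disjoint unions induced by a map of simplicial spaces. -/
def preMap {Y Z : SimplicialObject TopCat.{u}} (f : Y ⟶ Z) (w : Pre Y) : Pre Z :=
  ⟨w.1, f.app _ w.2.1, w.2.2⟩

theorem continuous_preMap {Y Z : SimplicialObject TopCat.{u}} (f : Y ⟶ Z) :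
    Continuous (preMap f) :=
  continuous_sigma fun n => continuous_sigmaMk.comp
    (((f.app (op n)).hom.continuous.comp continuous_fst).prodMk continuous_snd)

theorem preMap_rel {Y Z : SimplicialObject TopCat.{u}} (f : Y ⟶ Z) {a b : Pre Y}
    (h : Rel Y a b) : Rel Z (preMap f a) (preMap f b) := by
  obtain ⟨θ, y, t⟩ := h
  have : f.app _ (Y.map θ.op y) = Z.map θ.op (f.app _ y) := by
    rw [← ConcreteCategory.comp_apply, ← ConcreteCategory.comp_apply, f.naturality]
  simp only [preMap, this]
  exact Rel.intro θ _ t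

/-- The geometric realization of simplicial spaces, with the quotient topology (`Quot` divides by
the equivalence relation generated by `Rel`). -/
def realization : SimplicialObject TopCat.{u} ⥤ TopCat.{u} where
  obj Y := TopCat.of (Quot (Rel Y))
  map f := TopCat.ofHom ⟨Quot.map (preMap f) fun _ _ => preMap_rel f,
    continuous_quot_lift _ (continuous_quot_mk.comp (continuous_preMap f))⟩
  map_id Y := by
    ext ⟨w⟩
    rfl
  map_comp f g := by
    ext ⟨w⟩
    rfl

end SimplicialSpace

/-- The homotopy colimit `hocolim_A X = B(*, A, X)` of a module over a topological category,
functorially in `(A, X)`. -/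
def hocolim : CatWithModule.{v, u} ⥤ TopCat.{max u v} :=
  CatWithModule.bar ⋙ SimplicialSpace.realization

/-- A topological category `A` with a left module `X` and an internal functor `ρ : A → C` to a
small category `C`, considered as a discrete topological category. -/
structure ModuleOverDiscrete extends CatWithModule.{u, u} where
  C : Type u
  [catC : SmallCategory C]
  ρ : InternalFunctor A (TopologicalCategory.discrete C)

attribute [instance] ModuleOverDiscrete.catC

namespace ModuleOverDiscrete

/-- Morphisms `(A, X, C, ρ) → (A', X', C', ρ')`: a morphism `(A, X) → (A', X')` and a functor
`C → C'` which strictly commute with `ρ` and `ρ'`. -/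
structure Hom (D E : ModuleOverDiscrete.{u}) where
  hom : D.toCatWithModule ⟶ E.toCatWithModule
  base : D.C ⥤ E.C
  comm : D.ρ.functor ⋙ base = hom.functor.functor ⋙ E.ρ.functor

instance : Category ModuleOverDiscrete.{u} where
  Hom := Hom
  id D := ⟨𝟙 _, 𝟭 _, rfl⟩
  comp {D E G} f g := ⟨f.hom ≫ g.hom, f.base ⋙ g.base,
    (congrArg (· ⋙ g.base) f.comm).trans (congrArg (f.hom.functor.functor ⋙ ·) g.comm)⟩

/-- The forgetful functor `(A, X, C, ρ) ↦ (A, X)`. -/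
def forget : ModuleOverDiscrete.{u} ⥤ CatWithModule.{u, u} where
  obj D := D.toCatWithModule
  map f := f.hom

end ModuleOverDiscrete

/-- The category `Δ^• ↓ C`: objects are pairs `([k], σ : [k] → C)`, and morphisms
`([k₀], σ₀) → ([k₁], σ₁)` are order-preserving maps `θ : [k₁] → [k₀]` with `σ₁ = σ₀ θ`. -/
abbrev SimplexOver (C : Type u) [SmallCategory C] : Type u := (nerve C).Elements

namespace ModuleOverDiscrete

open CatWithModule

/-- The value of `ρ_* X` at `σ : [k] → C`: the preimage of `σ` under
`B(*, A, X)_k → B(*, A, *)_k → B(*, C, *)_k`, with the subspace topology. -/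
abbrev Fibre (D : ModuleOverDiscrete.{u}) (σ : SimplexOver D.C) : Type u :=
  {z : BarSimplex D.toCatWithModule σ.1.unop.len // z.chain ⋙ D.ρ.functor = σ.2}

/-- The functor `ρ_* X : Δ^• ↓ C → Top`. -/
def pushforward (D : ModuleOverDiscrete.{u}) : SimplexOver D.C ⥤ TopCat.{u} where
  obj σ := TopCat.of (D.Fibre σ)
  map {σ τ} θ := TopCat.ofHom
    ⟨fun z => ⟨BarSimplex.pull θ.1.unop.toOrderHom z.1,
      (congrArg (fun c => (nerve D.C).map θ.1 c) z.2).trans θ.2⟩,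
    ((BarSimplex.continuous_pull _).comp continuous_subtype_val).subtype_mk _⟩
  map_id σ := by
    ext z
    exact BarSimplex.pull_id z.1
  map_comp f g := by
    ext z
    exact BarSimplex.pull_comp _ _ z.1

/-- The functor `Δ^• ↓ C → Δ^• ↓ C'` given by composition with the functor `C → C'`. -/
def mapSimplexOver {D E : ModuleOverDiscrete.{u}} (f : D ⟶ E) :
    InternalFunctor (TopologicalCategory.discrete (SimplexOver D.C))
      (TopologicalCategory.discrete (SimplexOver E.C)) where
  functor :=
    { obj σ := ⟨σ.1, σ.2 ⋙ f.base⟩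
      map θ := ⟨θ.1, congrArg (· ⋙ f.base) θ.2⟩ }
  continuous_obj := continuous_bot
  continuous_map := continuous_bot

/-- The map `ρ_* X (σ) → ρ'_* X' (σ')` induced by a morphism, where `σ'` is the image of `σ`. -/
def mapFibre {D E : ModuleOverDiscrete.{u}} (f : D ⟶ E) (σ : SimplexOver D.C) (z : D.Fibre σ) :
    E.Fibre ((mapSimplexOver f).functor.obj σ) :=
  ⟨BarSimplex.push f.hom z.1,
    (congrArg (z.1.chain ⋙ ·) f.comm).symm.trans (congrArg (· ⋙ f.base) z.2)⟩

theorem continuous_mapFibre {D E : ModuleOverDiscrete.{u}} (f : D ⟶ E) (σ : SimplexOver D.C) :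
    Continuous (mapFibre f σ) :=
  ((BarSimplex.continuous_push f.hom).comp continuous_subtype_val).subtype_mk _

theorem mapFibre_pushforward {D E : ModuleOverDiscrete.{u}} (f : D ⟶ E) {σ τ : SimplexOver D.C}
    (θ : σ ⟶ τ) (z : D.Fibre σ) :
    mapFibre f τ (D.pushforward.map θ z) =
      E.pushforward.map ((mapSimplexOver f).functor.map θ) (mapFibre f σ z) :=
  Subtype.ext (BarSimplex.push_pull f.hom θ.1.unop.toOrderHom z.1)

theorem mapFibre_act {D E : ModuleOverDiscrete.{u}} (f : D ⟶ E) {σ σ' τ : SimplexOver D.C}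
    (θ : σ' ⟶ τ) (z : D.Fibre σ) (h : σ' = σ)
    (h' : (mapSimplexOver f).functor.obj σ' = (mapSimplexOver f).functor.obj σ) :
    mapFibre f τ (D.pushforward.map (eqToHom h.symm ≫ θ) z) =
      E.pushforward.map (eqToHom h'.symm ≫ (mapSimplexOver f).functor.map θ) (mapFibre f σ z) := by
  subst h
  rw [eqToHom_refl, eqToHom_refl, Category.id_comp, Category.id_comp]
  exact mapFibre_pushforward f θ z

/-- The discrete category `Δ^• ↓ C` with the module `ρ_* X`, functorially in `(A, X, C, ρ)`. -/
def simplexModule : ModuleOverDiscrete.{u} ⥤ CatWithModule.{0, u} where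
  obj D := ⟨TopologicalCategory.discrete (SimplexOver D.C), LeftModule.ofFunctor D.pushforward⟩
  map {D E} f :=
    { functor := mapSimplexOver f
      map :=
        { toFun := fun w => ⟨(mapSimplexOver f).functor.obj w.1, mapFibre f w.1 w.2⟩
          continuous_toFun := continuous_sigma fun σ =>
            continuous_sigmaMk.comp (continuous_mapFibre f σ) }
      proj_map := fun _ => rfl
      map_act := fun θ w h => Sigma.ext rfl (heq_of_eq (mapFibre_act f θ.hom w.2 h (congrArg _ h))) }
  map_id D := rfl
  map_comp f g := rfl

end ModuleOverDiscrete

/-!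
Write `Y` for the bar construction of `X`. For each `[k]` there is a simplicial set `cyl k`, natural
in `[k]`: the mapping cylinder of the map from the nerve of the category of faces `[n] → [k]` to
`Δ^k` which takes a face to its first vertex. A natural family of simplicial maps from `cyl k` to
the singular complexes `Sing (Y_k, Z)` restricts on the faces (the base) to a map out of
`hocolim_{Δ ↓ C} ρ_* X`, and on `Δ^k` (the points) to a map out of `|Y| = hocolim_A X`.

The inclusions into `cyl k` of its base and of its points remain anodyne when the part of `cyl k`
over the boundary of `Δ^k` is added to the subobject. If the identities of `A` form a closed
cofibration, the degenerate part `L` of `Y_k` is a neighbourhood deformation retract, so that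
`Sing (Y_k, Z) → Sing (L, Z)` is a Kan fibration. By induction over `k`, a natural family on the
base therefore extends to the cylinder; from the identity of `hocolim_{Δ ↓ C} ρ_* X` one gets a map
in the other direction. The same argument for `Y × I`, with values prescribed at the ends, shows
that two families which agree on the base or on the points induce homotopic maps, so this map is a
homotopy inverse.
-/

/-! ### Relative singular simplicial sets -/

theorem exists_continuousMap_of_isClosed_cover {ι T Z : Type*} [Finite ι] [TopologicalSpace T]
    [TopologicalSpace Z] (s : ι → Set T) (hs : ∀ i, IsClosed (s i)) (hc : ∀ x, ∃ i, x ∈ s i)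
    (g : ∀ i, C(s i, Z))
    (hg : ∀ i j x (hi : x ∈ s i) (hj : x ∈ s j), g i ⟨x, hi⟩ = g j ⟨x, hj⟩) :
    ∃ G : C(T, Z), ∀ i x (hx : x ∈ s i), G x = g i ⟨x, hx⟩ := by
  choose k hk using hc
  have hG : ∀ i x (hx : x ∈ s i), g (k x) ⟨x, hk x⟩ = g i ⟨x, hx⟩ := fun i x hx => hg _ _ _ _ _
  refine ⟨⟨fun x => g (k x) ⟨x, hk x⟩, ?_⟩, hG⟩
  refine (locallyFinite_of_finite s).continuous (Set.eq_univ_of_forall fun x =>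
    Set.mem_iUnion.2 ⟨k x, hk x⟩) hs fun i => ?_
  rw [continuousOn_iff_continuous_domRestrict]
  exact (g i).continuous.congr fun x => (hG i x x.2).symm

theorem exists_orderHom_retraction {α : Type*} [CompleteLinearOrder α] [Finite α] (S : Set α)
    (hS : S.Nonempty) : ∃ r : α →o α, (∀ a, r a ∈ S) ∧ ∀ a ∈ S, r a = a := by
  let below (a : α) : Set α := {s ∈ S | s ≤ max a (sInf S)}
  have hbelow (a) : sSup (below a) ∈ below a :=
    Set.Nonempty.csSup_mem ⟨sInf S, hS.csInf_mem (Set.toFinite _), le_max_right _ _⟩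
      (Set.toFinite _)
  refine ⟨⟨fun a => sSup (below a), fun a b hab => sSup_le_sSup fun s hs =>
    ⟨hs.1, hs.2.trans (max_le_max_right _ hab)⟩⟩, fun a => (hbelow a).1, fun a ha => ?_⟩
  refine le_antisymm ?_ (le_sSup ⟨ha, le_max_left _ _⟩)
  exact (hbelow a).2.trans (max_le le_rfl (sInf_le ha))

section

variable {ι κ : Type*} [Fintype ι] [Fintype κ]

theorem stdSimplex_map_congr {f g : ι → κ} {t : stdSimplex ℝ ι} (h : ∀ l, t l ≠ 0 → f l = g l) :
    stdSimplex.map f t = stdSimplex.map g t := by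
  classical
  ext k
  simp only [stdSimplex.map_coe, FunOnFinite.linearMap_apply_apply, Finset.sum_filter]
  refine Finset.sum_congr rfl fun l _ => ?_
  by_cases hl : t l = 0
  · simp [hl]
  · rw [h l hl]

theorem stdSimplex_map_eq_self {f : ι → ι} {t : stdSimplex ℝ ι} (h : ∀ l, t l ≠ 0 → f l = l) :
    stdSimplex.map f t = t :=
  (stdSimplex_map_congr h).trans (stdSimplex.map_id_apply t)

theorem stdSimplex_map_apply_eq_zero {f : ι → κ} (t : stdSimplex ℝ ι) {k : κ}
    (hk : ∀ l, f l ≠ k) : stdSimplex.map f t k = 0 := by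
  classical
  simp only [stdSimplex.map_coe, FunOnFinite.linearMap_apply_apply]
  exact Finset.sum_eq_zero fun l hl => absurd (by simpa using hl) (hk l)

theorem stdSimplex_map_apply_ne_zero (f : ι → κ) {t : stdSimplex ℝ ι} {l : ι} (hl : t l ≠ 0) :
    stdSimplex.map f t (f l) ≠ 0 := by
  classical
  simp only [stdSimplex.map_coe, FunOnFinite.linearMap_apply_apply]
  refine (lt_of_lt_of_le ((stdSimplex.zero_le t l).lt_of_ne hl.symm) ?_).ne'
  exact Finset.single_le_sum (f := fun l => t l) (fun j _ => stdSimplex.zero_le t j) (by simp)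

theorem stdSimplex_exists_apply_ne_zero (t : stdSimplex ℝ ι) : ∃ l, t l ≠ 0 := by
  by_contra! h
  simpa [h] using stdSimplex.sum_eq_one t

end

/-- The affine map `Δᵐ → Δⁿ` of topological simplices given by an order-preserving map. -/
noncomputable def affineMap {m n : SimplexCategory} (θ : m ⟶ n) :
    C(stdSimplex ℝ (Fin (m.len + 1)), stdSimplex ℝ (Fin (n.len + 1))) :=
  ⟨stdSimplex.map θ.toOrderHom, stdSimplex.continuous_map _⟩

@[simp]
theorem affineMap_id (n : SimplexCategory) : affineMap (𝟙 n) = .id _ :=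
  ContinuousMap.ext fun t => stdSimplex.map_id_apply t

@[simp]
theorem affineMap_comp {m n k : SimplexCategory} (θ : m ⟶ n) (η : n ⟶ k) :
    affineMap (θ ≫ η) = (affineMap η).comp (affineMap θ) :=
  ContinuousMap.ext fun t =>
    (stdSimplex.map_comp_apply (⇑θ.toOrderHom) (⇑η.toOrderHom) t).symm

/-- The simplicial set of maps `X × Δⁿ → Z`. It stands in for the singular set of the mapping
space `Z ^ X`, which need not exist as `X` is an arbitrary space. -/
noncomputable def Sing (X Z : Type u) [TopologicalSpace X] [TopologicalSpace Z] : SSet.{u} where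
  obj n := C(X × stdSimplex ℝ (Fin (n.unop.len + 1)), Z)
  map θ := ↾fun f => f.comp ((ContinuousMap.id X).prodMap (affineMap θ.unop))
  map_id n := by
    simp only [unop_id, affineMap_id]
    rfl
  map_comp {m n k} θ η := by
    simp only [unop_comp, affineMap_comp]
    rfl

namespace Sing

variable {X X' Z Z' : Type u} [TopologicalSpace X] [TopologicalSpace X'] [TopologicalSpace Z]
  [TopologicalSpace Z']

/-- The map underlying a simplex of `Sing X Z`. -/
def val {n : SimplexCategoryᵒᵖ} (s : (Sing X Z).obj n) :
    C(X × stdSimplex ℝ (Fin (n.unop.len + 1)), Z) := s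

/-- The simplex of `Sing X Z` given by a map. -/
def mk {n : SimplexCategoryᵒᵖ} (s : C(X × stdSimplex ℝ (Fin (n.unop.len + 1)), Z)) :
    (Sing X Z).obj n := s

theorem ext {n : SimplexCategoryᵒᵖ} {s s' : (Sing X Z).obj n}
    (h : ∀ x t, val s (x, t) = val s' (x, t)) : s = s' :=
  ContinuousMap.ext fun p => h p.1 p.2

theorem val_map {n m : SimplexCategoryᵒᵖ} (θ : n ⟶ m) (s : (Sing X Z).obj n) (x : X)
    (t : stdSimplex ℝ (Fin (m.unop.len + 1))) :
    val ((Sing X Z).map θ s) (x, t) = val s (x, affineMap θ.unop t) := rfl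

theorem val_app_map {K : SSet.{u}} (f : K ⟶ Sing X Z) {n m : SimplexCategoryᵒᵖ} (θ : n ⟶ m)
    (s : K.obj n) (x : X) (t : stdSimplex ℝ (Fin (m.unop.len + 1))) :
    val (f.app m (K.map θ s)) (x, t) = val (f.app n s) (x, affineMap θ.unop t) := by
  rw [NatTrans.naturality_apply, val_map]

/-- Restriction along `g : X' → X`. -/
noncomputable def restr (Z : Type u) [TopologicalSpace Z] (g : C(X', X)) :
    Sing X Z ⟶ Sing X' Z where
  app _ := ↾fun f => mk ((val f).comp (g.prodMap (.id _)))
  naturality _ _ _ := rfl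

/-- Composition with `g : Z → Z'`. -/
noncomputable def postcomp (X : Type u) [TopologicalSpace X] (g : C(Z, Z')) :
    Sing X Z ⟶ Sing X Z' where
  app _ := ↾fun f => mk (g.comp (val f))
  naturality _ _ _ := rfl

end Sing

/-! ### Restriction to the smaller space of an NDR pair is a Kan fibration -/

/-- `L ⊆ X` is a neighbourhood deformation retract: `u` vanishes precisely on `L`, and the
deformation `h` of `X`, fixed on `L`, has moved each point with `u < 1` into `L` by time `u`.
Functions and times are real-valued rather than `[0, 1]`-valued, as only `u < 1` matters. -/
structure NDR (X : Type u) [TopologicalSpace X] (L : Set X) where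
  u : C(X, ℝ)
  h : C(X × ℝ, X)
  u_nonneg : ∀ x, 0 ≤ u x
  mem_iff : ∀ x, x ∈ L ↔ u x = 0
  h_zero : ∀ x, h (x, 0) = x
  h_of_mem : ∀ x ∈ L, ∀ s, h (x, s) = x
  h_mem : ∀ x s, u x < 1 → u x ≤ s → h (x, s) ∈ L

theorem NDR.isClosed {X : Type u} [TopologicalSpace X] {L : Set X} (N : NDR X L) :
    IsClosed L := by
  have : L = N.u ⁻¹' {0} := Set.ext N.mem_iff
  rw [this]
  exact isClosed_singleton.preimage N.u.continuous

/-- The subset `L × Δⁿ ∪ X × Λⁿᵢ` of `X × Δⁿ`. -/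
def relativeHorn {X : Type u} (L : Set X) {n : ℕ} (i : Fin (n + 1)) :
    Set (X × stdSimplex ℝ (Fin (n + 1))) :=
  {p | p.1 ∈ L ∨ ∃ j, j ≠ i ∧ p.2 j = 0}

theorem exists_continuousMap_relativeHorn {X Z : Type*} [TopologicalSpace X] [TopologicalSpace Z]
    {L : Set X} (hL : IsClosed L) {n : ℕ} {i : Fin (n + 1)}
    (b : C(L × stdSimplex ℝ (Fin (n + 1)), Z))
    (c : {j // j ≠ i} → C(X × stdSimplex ℝ (Fin (n + 1)), Z))
    (hb : ∀ j (x : L) p, p j.1 = 0 → c j (x.1, p) = b (x, p))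
    (hc : ∀ j k x p, p j.1 = 0 → p k.1 = 0 → c j (x, p) = c k (x, p)) :
    ∃ G : C(relativeHorn L i, Z), (∀ p (hp : p.1.1 ∈ L), G p = b (⟨p.1.1, hp⟩, p.1.2)) ∧
      ∀ j p, p.1.2 j.1 = 0 → G p = c j p.1 := by
  let s : Option {j // j ≠ i} → Set (relativeHorn L i) := fun o =>
    o.elim {p | p.1.1 ∈ L} fun j => {p | p.1.2 j.1 = 0}
  have hs : ∀ o, IsClosed (s o) := by
    rintro (_ | j)
    · exact hL.preimage (continuous_fst.comp continuous_subtype_val)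
    · exact isClosed_singleton.preimage ((continuous_apply j.1).comp
        (continuous_subtype_val.comp (continuous_snd.comp continuous_subtype_val)))
  have hcov : ∀ p, ∃ o, p ∈ s o := by
    rintro ⟨p, hp | ⟨j, hj, hp⟩⟩
    · exact ⟨none, hp⟩
    · exact ⟨some ⟨j, hj⟩, hp⟩
  let g : ∀ o, C(s o, Z) := fun o => match o with
    | none => ⟨fun p => b (⟨p.1.1.1, p.2⟩, p.1.1.2), b.continuous.comp (by
        refine Continuous.prodMk (Continuous.subtype_mk ?_ _) ?_ <;> fun_prop)⟩
    | some j => ⟨fun p => c j p.1.1, (c j).continuous.comp (by fun_prop)⟩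
  obtain ⟨G, hG⟩ := exists_continuousMap_of_isClosed_cover s hs hcov g (by
    rintro (_ | j) (_ | k) ⟨⟨x, p⟩, hp⟩ h h'
    · rfl
    · exact (hb k ⟨x, h⟩ p h').symm
    · exact hb j ⟨x, h'⟩ p h
    · exact hc j k x p h h')
  exact ⟨G, fun p hp => hG none p hp, fun j p hp => hG (some j) p hp⟩

theorem shift_mem_stdSimplex {n : ℕ} (i : Fin (n + 1)) (t : stdSimplex ℝ (Fin (n + 1))) {a : ℝ}
    (ha : 0 ≤ a) (h : ∀ j, j ≠ i → a ≤ t j) :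
    (fun j => if j = i then t i + n * a else t j - a) ∈ stdSimplex ℝ (Fin (n + 1)) := by
  refine ⟨fun j => ?_, ?_⟩
  · dsimp only
    split_ifs with hj
    · have := stdSimplex.zero_le t i
      positivity
    · linarith [h j hj]
  · rw [← stdSimplex.sum_eq_one t, ← Finset.add_sum_erase _ _ (Finset.mem_univ i),
      ← Finset.add_sum_erase Finset.univ (fun j => t j) (Finset.mem_univ i)]
    have hne : ∑ j ∈ Finset.univ.erase i, (if j = i then t i + n * a else t j - a) =
        ∑ j ∈ Finset.univ.erase i, (t j - a) :=
      Finset.sum_congr rfl fun j hj => if_neg (Finset.ne_of_mem_erase hj)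
    rw [hne, Finset.sum_sub_distrib, Finset.sum_const,
      Finset.card_erase_of_mem (Finset.mem_univ i)]
    simp

section minCoord

variable {n : ℕ} (i : Fin (n + 2)) (t : stdSimplex ℝ (Fin (n + 2)))

theorem nonempty_univ_erase : (Finset.univ.erase i).Nonempty := by
  obtain ⟨j, hj⟩ := exists_ne i
  exact ⟨j, by simpa using hj⟩

/-- The smallest barycentric coordinate with index different from `i`; it vanishes precisely on
the horn `Λᵢ`. -/
noncomputable def minCoord : ℝ :=
  (Finset.univ.erase i).inf' (nonempty_univ_erase i) fun j => t j

theorem continuous_minCoord : Continuous (minCoord i) :=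
  Continuous.finset_inf'_apply _ fun j _ => (continuous_apply j).comp continuous_subtype_val

variable {i} in
theorem minCoord_le {j : Fin (n + 2)} (hj : j ≠ i) : minCoord i t ≤ t j :=
  Finset.inf'_le _ (by simpa using hj)

theorem minCoord_nonneg : 0 ≤ minCoord i t :=
  Finset.le_inf' _ _ fun j _ => stdSimplex.zero_le t j

theorem exists_eq_minCoord : ∃ j, j ≠ i ∧ t j = minCoord i t := by
  obtain ⟨j, hj, h⟩ := Finset.exists_mem_eq_inf' (nonempty_univ_erase i) fun j => t j
  exact ⟨j, by simpa using hj, h.symm⟩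

end minCoord

namespace NDR

variable {X : Type u} [TopologicalSpace X] {L : Set X} (N : NDR X L) {n : ℕ} (i : Fin (n + 2))

/-- The weight which `hornRetraction` moves from every vertex other than `i` to the vertex `i`; it
vanishes precisely on the relative horn. -/
noncomputable def depth (p : X × stdSimplex ℝ (Fin (n + 2))) : ℝ :=
  min (N.u p.1) (minCoord i p.2)

theorem continuous_depth : Continuous (N.depth i) :=
  (N.u.continuous.comp continuous_fst).min ((continuous_minCoord i).comp continuous_snd)

theorem shift_depth_mem (p : X × stdSimplex ℝ (Fin (n + 2))) :
    (fun j => if j = i then p.2 i + (n + 1 : ℕ) * N.depth i p else p.2 j - N.depth i p) ∈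
      stdSimplex ℝ (Fin (n + 2)) :=
  shift_mem_stdSimplex i p.2 (le_min (N.u_nonneg _) (minCoord_nonneg _ _)) fun _ hj =>
    (min_le_right _ _).trans (minCoord_le p.2 hj)

/-- A retraction of `X × Δ` onto the relative horn: points close to `L` are deformed into `L`,
and the simplex coordinate is moved away from the vertex `i` towards the opposite horn. -/
noncomputable def hornRetraction :
    C(X × stdSimplex ℝ (Fin (n + 2)), X × stdSimplex ℝ (Fin (n + 2))) where
  toFun p := (N.h (p.1, minCoord i p.2), ⟨_, N.shift_depth_mem i p⟩)
  continuous_toFun := by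
    have hcoord (j : Fin (n + 2)) :
        Continuous fun p : X × stdSimplex ℝ (Fin (n + 2)) => p.2 j :=
      (continuous_apply j).comp (continuous_subtype_val.comp continuous_snd)
    refine (N.h.continuous.comp (continuous_fst.prodMk
      ((continuous_minCoord i).comp continuous_snd))).prodMk
      (Continuous.subtype_mk (continuous_pi fun j => ?_) _)
    split_ifs
    · exact (hcoord i).add (continuous_const.mul (N.continuous_depth i))
    · exact (hcoord j).sub (N.continuous_depth i)

theorem hornRetraction_mem (p : X × stdSimplex ℝ (Fin (n + 2))) :
    N.hornRetraction i p ∈ relativeHorn L i := by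
  obtain ⟨j, hj, hjm⟩ := exists_eq_minCoord i p.2
  rcases le_or_gt (minCoord i p.2) (N.u p.1) with h | h
  · refine Or.inr ⟨j, hj, ?_⟩
    change (if j = i then _ else p.2 j - N.depth i p) = 0
    rw [if_neg hj, hjm, depth, min_eq_right h, sub_self]
  · exact Or.inl (N.h_mem _ _ (h.trans_le (hjm ▸ stdSimplex.le_one p.2 j)) h.le)

theorem hornRetraction_eq_self {p : X × stdSimplex ℝ (Fin (n + 2))}
    (hp : p ∈ relativeHorn L i) : N.hornRetraction i p = p := by
  have hshift (hd : N.depth i p = 0) :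
      (⟨_, N.shift_depth_mem i p⟩ : stdSimplex ℝ (Fin (n + 2))) = p.2 := by
    ext j
    change (if j = i then p.2 i + _ * N.depth i p else p.2 j - N.depth i p) = p.2 j
    split_ifs with h <;> simp [hd, h]
  rcases hp with hp | ⟨j, hj, hp⟩
  · refine Prod.ext (N.h_of_mem _ hp _) (hshift ?_)
    rw [depth, (N.mem_iff _).1 hp, min_eq_left (minCoord_nonneg i p.2)]
  · have hm : minCoord i p.2 = 0 :=
      le_antisymm (hp ▸ minCoord_le p.2 hj) (minCoord_nonneg i p.2)
    refine Prod.ext ((congrArg (fun s => N.h (p.1, s)) hm).trans (N.h_zero _)) (hshift ?_)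
    rw [depth, hm, min_eq_right (N.u_nonneg _)]

end NDR

section

open HomotopicalAlgebra Simplicial SSet.modelCategoryQuillen

theorem mem_horn_iff_exists {n : ℕ} (i : Fin (n + 1)) {m : SimplexCategoryᵒᵖ}
    (s : (Δ[n] : SSet.{u}).obj m) :
    s ∈ (Λ[n, i] : (Δ[n] : SSet.{u}).Subcomplex).obj m ↔
      ∃ j, j ≠ i ∧ ∀ l, (SSet.stdSimplex.objEquiv s).toOrderHom l ≠ j := by
  rw [SSet.mem_horn_iff, Ne, Set.eq_univ_iff_forall, not_forall]
  refine exists_congr fun j => ?_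
  rw [Set.mem_union, not_or, and_comm, Set.mem_singleton_iff, Set.mem_range, not_exists]
  rfl

theorem mk_mem_relativeHorn {X : Type u} {L : Set X} {n : ℕ} {i : Fin (n + 1)}
    {m : SimplexCategoryᵒᵖ} (s : (Λ[n, i] : SSet.{u}).obj m) (x : X)
    (t : stdSimplex ℝ (Fin (m.unop.len + 1))) :
    (x, affineMap (SSet.stdSimplex.objEquiv s.1) t) ∈ relativeHorn L i := by
  obtain ⟨j, hj, hsj⟩ := (mem_horn_iff_exists _ _).1 s.2
  exact Or.inr ⟨j, hj, stdSimplex_map_apply_eq_zero t hsj⟩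

theorem exists_endomorphism_avoiding {n : ℕ} {i j : Fin (n + 1)} (h : j ≠ i) :
    ∃ e : ⦋n⦌ ⟶ ⦋n⦌, (∀ l, e.toOrderHom l ≠ j) ∧ ∀ l, l ≠ j → e.toOrderHom l = l := by
  obtain ⟨r, hr, hr'⟩ := exists_orderHom_retraction {l | l ≠ j} ⟨i, h.symm⟩
  exact ⟨SimplexCategory.Hom.mk r, hr, hr'⟩

namespace Sing

variable {X Z : Type u} [TopologicalSpace X] [TopologicalSpace Z] {n : ℕ} {i : Fin (n + 1)}

theorem val_app_horn_eq (f : (Λ[n, i] : SSet.{u}) ⟶ Sing X Z) {m : SimplexCategoryᵒᵖ}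
    (s : Λ[n, i].obj m) (t : stdSimplex ℝ (Fin (m.unop.len + 1)))
    {p : stdSimplex ℝ (Fin (n + 1))} (hp : affineMap (SSet.stdSimplex.objEquiv s.1) t = p)
    {e : ⦋n⦌ ⟶ ⦋n⦌} (he : ∀ l, p l ≠ 0 → e.toOrderHom l = l)
    (hem : SSet.stdSimplex.objEquiv.symm e ∈ (Λ[n, i] : (Δ[n] : SSet.{u}).Subcomplex).obj (op ⦋n⦌))
    (x : X) :
    val (f.app m s) (x, t) =
      val (f.app (op ⦋n⦌) ⟨SSet.stdSimplex.objEquiv.symm e, hem⟩) (x, p) := by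
  -- Composing with a retraction of `[m]` onto the support of `t`, the simplex `s` becomes a
  -- pullback of `e`.
  obtain ⟨r, hr, hr'⟩ :=
    exists_orderHom_retraction {l | t l ≠ 0} (stdSimplex_exists_apply_ne_zero t)
  let ρ : m.unop ⟶ m.unop := SimplexCategory.Hom.mk r
  have hρt : affineMap ρ t = t := stdSimplex_map_eq_self hr'
  have hval : val (f.app m s) (x, t) = val (f.app m ((Λ[n, i] : SSet.{u}).map ρ.op s)) (x, t) :=
    ((val_app_map f ρ.op s x t).trans (by rw [Quiver.Hom.unop_op, hρt])).symm
  have hmap : (Λ[n, i] : SSet.{u}).map ρ.op s =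
      (Λ[n, i] : SSet.{u}).map (ρ ≫ SSet.stdSimplex.objEquiv s.1).op
        ⟨SSet.stdSimplex.objEquiv.symm e, hem⟩ := by
    refine Subtype.ext (SSet.stdSimplex.objEquiv.injective ?_)
    change ρ ≫ SSet.stdSimplex.objEquiv s.1 = (ρ ≫ SSet.stdSimplex.objEquiv s.1) ≫ e
    ext l : 3
    refine (he _ ?_).symm
    rw [← hp]
    exact stdSimplex_map_apply_ne_zero _ (hr l)
  rw [hval, hmap]
  refine (val_app_map f _ _ x t).trans ?_
  rw [Quiver.Hom.unop_op, affineMap_comp, ContinuousMap.comp_apply, hρt, hp]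

theorem exists_glue_horn {L : Set X} (hL : IsClosed L) (f : (Λ[n, i] : SSet.{u}) ⟶ Sing X Z)
    (b : (Sing L Z).obj (op ⦋n⦌))
    (hfb : ∀ (m : SimplexCategoryᵒᵖ) (s : Λ[n, i].obj m) (x : L)
      (t : stdSimplex ℝ (Fin (m.unop.len + 1))),
      val (f.app m s) (x.1, t) = val b (x, affineMap (SSet.stdSimplex.objEquiv s.1) t)) :
    ∃ G : C(relativeHorn L i, Z), (∀ p (hp : p.1.1 ∈ L), G p = val b (⟨p.1.1, hp⟩, p.1.2)) ∧
      ∀ (m : SimplexCategoryᵒᵖ) (s : Λ[n, i].obj m) (x : X)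
        (t : stdSimplex ℝ (Fin (m.unop.len + 1))),
        G ⟨_, mk_mem_relativeHorn s x t⟩ = val (f.app m s) (x, t) := by
  choose e he he' using fun j : {j // j ≠ i} => exists_endomorphism_avoiding j.2
  have hem (j) : SSet.stdSimplex.objEquiv.symm (e j) ∈
      (Λ[n, i] : (Δ[n] : SSet.{u}).Subcomplex).obj (op ⦋n⦌) :=
    (mem_horn_iff_exists _ _).2 ⟨j.1, j.2, he j⟩
  have hfix (j) (p : stdSimplex ℝ (Fin (n + 1))) (hp : p j.1 = 0) (l) (hl : p l ≠ 0) :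
      (e j).toOrderHom l = l := he' j l fun h => hl (h ▸ hp)
  have hface (j) (p : stdSimplex ℝ (Fin (n + 1))) (hp : p j.1 = 0) : affineMap (e j) p = p :=
    stdSimplex_map_eq_self (hfix j p hp)
  obtain ⟨G, hGL, hGc⟩ := exists_continuousMap_relativeHorn hL (val b)
    (fun j => val (f.app (op ⦋n⦌) ⟨_, hem j⟩))
    (fun j x p hp => (hfb _ _ x p).trans (congrArg (fun q => val b (x, q)) (hface j p hp)))
    (fun j k x p hj hk => val_app_horn_eq f ⟨_, hem j⟩ p (hface j p hj) (hfix k p hk) (hem k) x)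
  refine ⟨G, hGL, fun m s x t => ?_⟩
  obtain ⟨j, hj, hsj⟩ := (mem_horn_iff_exists _ _).1 s.2
  have hzero : affineMap (SSet.stdSimplex.objEquiv s.1) t j = 0 :=
    stdSimplex_map_apply_eq_zero t hsj
  rw [hGc ⟨j, hj⟩ _ hzero]
  exact (val_app_horn_eq f s t rfl (hfix ⟨j, hj⟩ _ hzero) (hem _) x).symm

end Sing

theorem NDR.fibration {T : Type u} [TopologicalSpace T] {L : Set T} (N : NDR T L) (Z : Type u)
    [TopologicalSpace Z] :
    Fibration (Sing.restr Z (⟨Subtype.val, continuous_subtype_val⟩ : C(L, T))) := by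
  rw [SSet.modelCategoryQuillen.fibration_iff]
  intro _ _ g hg
  simp only [J, MorphismProperty.iSup_iff] at hg
  obtain ⟨n, ⟨i⟩⟩ := hg
  refine ⟨fun {f b} sq => ?_⟩
  obtain ⟨b, rfl⟩ := SSet.yonedaEquiv.symm.surjective b
  obtain ⟨G, hGL, hGf⟩ := Sing.exists_glue_horn N.isClosed f b fun m s x t =>
    congrArg (fun g => Sing.val (g.app m s) (x, t)) sq.w
  let R : C(T × stdSimplex ℝ (Fin (n + 2)), relativeHorn L i) :=
    ⟨fun p => ⟨N.hornRetraction i p, N.hornRetraction_mem i p⟩,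
      (N.hornRetraction i).continuous.subtype_mk _⟩
  have hR {p} (hp : p ∈ relativeHorn L i) : R p = ⟨p, hp⟩ :=
    Subtype.ext (N.hornRetraction_eq_self i hp)
  refine ⟨⟨⟨SSet.yonedaEquiv.symm (Sing.mk (G.comp R)), ?_, ?_⟩⟩⟩
  · refine NatTrans.ext (funext fun m => ConcreteCategory.hom_ext _ _ fun s =>
      Sing.ext fun x t => ?_)
    exact (congrArg G (hR (mk_mem_relativeHorn s x t))).trans (hGf m s x t)
  · apply SSet.yonedaEquiv.injective
    rw [SSet.yonedaEquiv_symm_comp, Equiv.apply_symm_apply, Equiv.apply_symm_apply]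
    exact Sing.ext fun x t => (congrArg G (hR (p := (x.1, t)) (Or.inl x.2))).trans (hGL _ x.2)

end

section

open Simplicial HomotopicalAlgebra SSet.modelCategoryQuillen MonoidalCategory

/-! ### Anodyne extensions -/

/-- The morphism of simplicial sets with given values. -/
def ssetHomMk {V W : SSet.{u}} (f : ∀ n, V.obj n → W.obj n)
    (hf : ∀ {m n : SimplexCategoryᵒᵖ} (θ : m ⟶ n) (x : V.obj m),
      f n (V.map θ x) = W.map θ (f m x)) : V ⟶ W where
  app n := ↾(f n)
  naturality _ _ θ := ConcreteCategory.hom_ext _ _ fun x => hf θ x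

theorem sset_hom_ext {V W : SSet.{u}} {f g : V ⟶ W} (h : ∀ n (x : V.obj n), f.app n x = g.app n x) :
    f = g :=
  SSet.hom_ext fun n => ConcreteCategory.hom_ext _ _ (h n)

theorem sset_app_map {V W : SSet.{u}} (f : V ⟶ W) {m n : SimplexCategoryᵒᵖ} (θ : m ⟶ n)
    (x : V.obj m) : f.app n (V.map θ x) = W.map θ (f.app m x) :=
  NatTrans.naturality_apply f θ x

theorem exists_lift_of_anodyneExtensions {A B E F : SSet.{u}} {i : A ⟶ B}
    (hi : SSet.anodyneExtensions i) (p : E ⟶ F) [hp : Fibration p] (f : A ⟶ E) (g : B ⟶ F)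
    (w : f ≫ p = i ≫ g) : ∃ l : B ⟶ E, i ≫ l = f ∧ l ≫ p = g := by
  have := hi p hp.mem
  have sq : CommSq f i p g := ⟨w⟩
  exact ⟨sq.lift, sq.fac_left, sq.fac_right⟩

theorem anodyneExtensions_ι_of_eq_top {X : SSet.{u}} {A : X.Subcomplex} (h : A = ⊤) :
    SSet.anodyneExtensions A.ι := by
  subst h
  have : IsIso (⊤ : X.Subcomplex).ι :=
    ⟨ssetHomMk (fun n x => ⟨x, trivial⟩) fun _ _ => rfl, rfl, rfl⟩
  exact SSet.anodyneExtensions.of_isIso _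

theorem eq_const_of_mem_horn_one (e : Fin 2) {n : SimplexCategoryᵒᵖ}
    (s : (Δ[1] : SSet.{u}).obj n) (hs : s ∈ (Λ[1, e] : (Δ[1] : SSet.{u}).Subcomplex).obj n) :
    s = SSet.stdSimplex.const 1 e n := by
  obtain ⟨j, hj, h⟩ := (mem_horn_iff_exists _ _).1 hs
  have eq_of_ne : ∀ q : Fin 2, q ≠ j → q = e := by omega
  apply SSet.stdSimplex.objEquiv.injective
  ext l : 3
  exact eq_of_ne _ (h l)

theorem exists_homotopy_lift {V E F : SSet.{u}} (U : V.Subcomplex) (p : E ⟶ F) [Fibration p]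
    (e : Fin 2) (G : V ⊗ Δ[1] ⟶ F) (a : V ⟶ E) (b : U.toSSet ⊗ Δ[1] ⟶ E)
    (ha : ∀ n (x : V.obj n), p.app n (a.app n x) = G.app n (x, SSet.stdSimplex.const 1 e n))
    (hb : b ≫ p = U.ι ▷ Δ[1] ≫ G)
    (hab : ∀ n (x : U.toSSet.obj n), b.app n (x, SSet.stdSimplex.const 1 e n) = a.app n x.1) :
    ∃ K : V ⊗ Δ[1] ⟶ E, U.ι ▷ Δ[1] ≫ K = b ∧ K ≫ p = G := by
  have hpush := SSet.Subcomplex.unionProd.isPushout U (Λ[1, e] : (Δ[1] : SSet.{u}).Subcomplex)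
  have hw : U.ι ▷ _ ≫ SemiCartesianMonoidalCategory.fst V (Λ[1, e] : SSet.{u}) ≫ a =
      U.toSSet ◁ Λ[1, e].ι ≫ b := by
    refine sset_hom_ext fun n ⟨x, s⟩ => ?_
    refine (hab n x).symm.trans (congrArg (fun t => b.app n (x, t)) ?_)
    exact (eq_const_of_mem_horn_one e s.1 s.2).symm
  obtain ⟨K, hK, hKG⟩ := exists_lift_of_anodyneExtensions
    (SSet.anodyneExtensions_unionProd_ι U _ (SSet.anodyneExtensions.horn_ι e)) p
    (hpush.desc _ _ hw) G (hpush.hom_ext (by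
      rw [← Category.assoc, hpush.inl_desc]
      refine sset_hom_ext fun n ⟨x, s⟩ => (ha n x).trans (congrArg (fun t => G.app n (x, t)) ?_)
      exact (eq_const_of_mem_horn_one e s.1 s.2).symm) (by
      rw [← Category.assoc, hpush.inr_desc]
      exact hb))
  refine ⟨K, ?_, hKG⟩
  rw [← hpush.inr_desc _ _ hw, ← hK]
  rfl

theorem anodyneExtensions_of_deformation {V V' : SSet.{u}} (U : V.Subcomplex) (j : V' ⟶ V)
    (r : V ⟶ V') (e e' : Fin 2) (H : V ⊗ Δ[1] ⟶ V)
    (H_start : ∀ n (x : V.obj n), H.app n (x, SSet.stdSimplex.const 1 e n) = j.app n (r.app n x))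
    (H_end : ∀ n (x : V.obj n), H.app n (x, SSet.stdSimplex.const 1 e' n) = x)
    (H_mem : ∀ n (x : V.obj n) s, x ∈ U.obj n → H.app n (x, s) ∈ U.obj n)
    (hU : SSet.anodyneExtensions (U.preimage j).ι) : SSet.anodyneExtensions U.ι := by
  intro E F p hp
  have : Fibration p := ⟨hp⟩
  refine ⟨fun {f g} sq => ?_⟩
  obtain ⟨l, hlf, hlg⟩ := exists_lift_of_anodyneExtensions hU p (U.fromPreimage j ≫ f) (j ≫ g)
    (by rw [Category.assoc, sq.w, ← Category.assoc, SSet.Subcomplex.fromPreimage_ι, Category.assoc])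
  let HU : U.toSSet ⊗ Δ[1] ⟶ U.toSSet := SSet.Subcomplex.lift (U.ι ▷ Δ[1] ≫ H) (by
    rintro n _ ⟨x, rfl⟩
    exact H_mem n x.1.1 x.2 x.1.2)
  obtain ⟨K, hKf, hKg⟩ := exists_homotopy_lift U p e (H ≫ g) (r ≫ l) (HU ≫ f)
    (fun n x => (congrArg (fun q => q.app n (r.app n x)) hlg).trans
      (congrArg (g.app n) (H_start n x)).symm)
    (by rw [Category.assoc, sq.w]; rfl)
    (fun n x => by
      have hx : j.app n (r.app n x.1) ∈ U.obj n := H_start n x.1 ▸ H_mem n x.1 _ x.2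
      refine Eq.trans ?_ (congrArg (fun q => q.app n ⟨r.app n x.1, hx⟩) hlf).symm
      exact congrArg (f.app n) (Subtype.ext (H_start n x.1)))
  refine ⟨⟨⟨ssetHomMk (fun n x => K.app n (x, SSet.stdSimplex.const 1 e' n)) fun θ x => ?_,
    ?_, ?_⟩⟩⟩
  · exact sset_app_map K θ (x, SSet.stdSimplex.const 1 e' _)
  · refine sset_hom_ext fun n x => ?_
    refine (congrArg (fun q => q.app n (x, SSet.stdSimplex.const 1 e' n)) hKf).trans ?_
    exact congrArg (f.app n) (Subtype.ext (H_end n x.1))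
  · refine sset_hom_ext fun n x => ?_
    refine (congrArg (fun q => q.app n (x, SSet.stdSimplex.const 1 e' n)) hKg).trans ?_
    exact congrArg (g.app n) (H_end n x)

/-! ### Anodyne extensions of nerves of posets from involutions on chains -/

section

variable {X : Type u} [PartialOrder X] {V : (nerve X).Subcomplex}

/-- The set of vertices of a simplex of a subcomplex of a nerve. -/
def vertexSet (s : V.toSSet.S) : Set X := Set.range s.simplex.1.obj

theorem strictMono_obj (s : V.toSSet.N) : StrictMono s.simplex.1.obj :=
  (PartialOrder.mem_nerve_nonDegenerate_iff_strictMono _).1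
    ((SSet.nonDegenerate_iff_of_mono V.ι _).2 s.nonDegenerate)

theorem ncard_vertexSet (s : V.toSSet.N) : (vertexSet s.toS).ncard = s.dim + 1 := by
  rw [vertexSet, Set.ncard_range_of_injective (strictMono_obj s).injective, Nat.card_fin]

theorem finite_vertexSet (s : V.toSSet.S) : (vertexSet s).Finite := Set.finite_range _

theorem le_iff_vertexSet_subset (s t : V.toSSet.N) :
    s ≤ t ↔ vertexSet s.toS ⊆ vertexSet t.toS := by
  constructor
  · intro h
    obtain ⟨f, hf⟩ := SSet.S.le_iff.1 h
    rintro _ ⟨i, rfl⟩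
    exact ⟨f.toOrderHom i, congrArg (fun c => c.1.obj i) hf⟩
  · intro h
    choose f hf using fun i => h ⟨i, rfl⟩
    refine SSet.S.le_iff.2 ⟨SimplexCategory.Hom.mk ⟨f, fun i j hij => ?_⟩, ?_⟩
    · rw [← (strictMono_obj t).le_iff_le, hf, hf]
      exact (strictMono_obj s).monotone hij
    · exact Subtype.ext (nerve.ext_of_isThin (funext hf))

theorem isChain_vertexSet (s : V.toSSet.N) : IsChain (· ≤ ·) (vertexSet s.toS) := by
  rintro _ ⟨i, rfl⟩ _ ⟨j, rfl⟩ _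
  exact (le_total i j).imp (fun h => (strictMono_obj s).monotone h)
    fun h => (strictMono_obj s).monotone h

theorem exists_strictMono_range_eq {T : Set X} (hf : T.Finite) (hT : T.Nonempty)
    (hc : IsChain (· ≤ ·) T) :
    ∃ (n : ℕ) (c : ComposableArrows X n), StrictMono c.obj ∧ Set.range c.obj = T := by
  classical
  have := hf.fintype
  let _ : LinearOrder T := hc.linearOrder
  obtain ⟨n, hn⟩ : ∃ n, Fintype.card T = n + 1 :=
    Nat.exists_eq_succ_of_ne_zero (@Fintype.card_pos T _ hT.to_subtype).ne'
  let o := Fintype.orderIsoFinOfCardEq T hn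
  have hm : StrictMono fun i => (o i).1 := fun i j hij => o.strictMono hij
  refine ⟨n, hm.monotone.functor, hm, ?_⟩
  change Set.range (Subtype.val ∘ o) = T
  rw [Set.range_comp, o.surjective.range_eq, Set.image_univ, Subtype.range_val]

end

/-- An involution on the chains of a poset which span simplices of `V` outside of `U`: it adds the
element `vertex s` to the chain `s`, or removes it. The rank makes the corresponding pairing of
nondegenerate simplices regular. -/
structure NerveToggle {X : Type u} [PartialOrder X] {V : (nerve X).Subcomplex}
    (U : V.toSSet.Subcomplex) where
  outside : Set (Set X)
  range_mem_outside : ∀ n (c : ComposableArrows X n), Set.range c.obj ∈ outside ↔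
    ∃ h : c ∈ V.obj (op ⦋n⦌), (⟨c, h⟩ : V.toSSet _⦋n⦌) ∉ U.obj (op ⦋n⦌)
  vertex : Set X → X
  rank : Set X → ℕ
  nonempty : ∀ s ∈ outside, s.Nonempty
  isChain_insert : ∀ s ∈ outside, IsChain (· ≤ ·) s → IsChain (· ≤ ·) (insert (vertex s) s)
  insert_mem : ∀ s ∈ outside, insert (vertex s) s ∈ outside
  sdiff_mem : ∀ s ∈ outside, s \ {vertex s} ∈ outside
  vertex_insert : ∀ s ∈ outside, vertex (insert (vertex s) s) = vertex s
  vertex_sdiff : ∀ s ∈ outside, vertex (s \ {vertex s}) = vertex s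
  rank_lt : ∀ s ∈ outside, ∀ t ∈ outside, vertex s ∉ s → t.Finite → s ≠ t →
    s.ncard = t.ncard → s ⊆ insert (vertex t) t → rank s < rank t

namespace NerveToggle

variable {X : Type u} [PartialOrder X] {V : (nerve X).Subcomplex} {U : V.toSSet.Subcomplex}

theorem eq_of_vertexSet_eq {s t : U.N} (h : vertexSet s.toS = vertexSet t.toS) : s = t :=
  (SSet.Subcomplex.N.ext_iff _ _).2 (le_antisymm ((le_iff_vertexSet_subset _ _).2 h.le)
    ((le_iff_vertexSet_subset _ _).2 h.ge))

variable (T : NerveToggle U)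

theorem vertexSet_mem_outside (s : U.N) : vertexSet s.toS ∈ T.outside :=
  (T.range_mem_outside _ _).2 ⟨s.simplex.2, s.notMem⟩

theorem exists_vertexSet_eq {t : Set X} (ht : t ∈ T.outside) (hf : t.Finite)
    (hc : IsChain (· ≤ ·) t) : ∃ s : U.N, vertexSet s.toS = t := by
  obtain ⟨n, c, hm, rfl⟩ := exists_strictMono_range_eq hf (T.nonempty t ht) hc
  obtain ⟨hV, hU⟩ := (T.range_mem_outside n c).1 ht
  have hnd : (⟨c, hV⟩ : V.toSSet _⦋n⦌) ∈ V.toSSet.nonDegenerate n :=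
    (SSet.nonDegenerate_iff_of_mono V.ι _).1
      ((PartialOrder.mem_nerve_nonDegenerate_iff_strictMono c).2 hm)
  exact ⟨⟨SSet.N.mk _ hnd, hU⟩, rfl⟩

/-- The simplex obtained by adding the vertex. -/
noncomputable def add (s : U.N) : U.N :=
  (T.exists_vertexSet_eq (T.insert_mem _ (T.vertexSet_mem_outside s))
    ((finite_vertexSet s.toS).insert _)
    (T.isChain_insert _ (T.vertexSet_mem_outside s) (isChain_vertexSet s.toN))).choose

/-- The simplex obtained by removing the vertex. -/
noncomputable def remove (s : U.N) : U.N :=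
  (T.exists_vertexSet_eq (T.sdiff_mem _ (T.vertexSet_mem_outside s))
    ((finite_vertexSet s.toS).subset Set.sdiff_subset)
    ((isChain_vertexSet s.toN).mono Set.sdiff_subset)).choose

theorem vertexSet_add (s : U.N) :
    vertexSet (T.add s).toS = insert (T.vertex (vertexSet s.toS)) (vertexSet s.toS) :=
  Exists.choose_spec (p := fun t : U.N => vertexSet t.toS = _) _

theorem vertexSet_remove (s : U.N) :
    vertexSet (T.remove s).toS = vertexSet s.toS \ {T.vertex (vertexSet s.toS)} :=
  Exists.choose_spec (p := fun t : U.N => vertexSet t.toS = _) _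

theorem vertex_add (s : U.N) :
    T.vertex (vertexSet (T.add s).toS) = T.vertex (vertexSet s.toS) := by
  rw [vertexSet_add, T.vertex_insert _ (T.vertexSet_mem_outside s)]

theorem vertex_remove (s : U.N) :
    T.vertex (vertexSet (T.remove s).toS) = T.vertex (vertexSet s.toS) := by
  rw [vertexSet_remove, T.vertex_sdiff _ (T.vertexSet_mem_outside s)]

/-- The pairing of the simplices without the vertex with those with the vertex. -/
noncomputable def pairing : U.Pairing where
  I := {s | T.vertex (vertexSet s.toS) ∈ vertexSet s.toS}
  II := {s | T.vertex (vertexSet s.toS) ∉ vertexSet s.toS}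
  inter := Set.inter_compl_self _
  union := Set.union_compl_self _
  p :=
    { toFun s := ⟨T.add s.1, by
        rw [Set.mem_ofPred_eq, vertex_add, vertexSet_add]
        exact Set.mem_insert _ _⟩
      invFun s := ⟨T.remove s.1, by
        rw [Set.mem_ofPred_eq, vertex_remove, vertexSet_remove]
        simp⟩
      left_inv s := Subtype.ext (eq_of_vertexSet_eq (by
        rw [vertexSet_remove, vertex_add, vertexSet_add, Set.insert_sdiff_self_of_notMem s.2]))
      right_inv s := Subtype.ext (eq_of_vertexSet_eq (by
        rw [vertexSet_add, vertex_remove, vertexSet_remove, Set.insert_sdiff_singleton]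
        exact Set.insert_eq_of_mem s.2)) }

theorem vertex_notMem (s : T.pairing.II) :
    T.vertex (vertexSet s.1.toS) ∉ vertexSet s.1.toS := s.2

theorem vertexSet_pairing (s : T.pairing.II) :
    vertexSet (T.pairing.p s).1.toS = insert (T.vertex (vertexSet s.1.toS)) (vertexSet s.1.toS) :=
  T.vertexSet_add s.1

theorem isProper_pairing : T.pairing.IsProper := ⟨fun s => by
  have hdim := ncard_vertexSet (T.pairing.p s).1.toN
  rw [vertexSet_pairing, Set.ncard_insert_of_notMem (T.vertex_notMem s) (finite_vertexSet s.1.toS),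
    ncard_vertexSet s.1.toN] at hdim
  refine ⟨Nat.succ_injective hdim.symm,
    SSet.N.existsUnique_of_le ((le_iff_vertexSet_subset _ _).2 ?_)⟩
  rw [vertexSet_pairing]
  exact Set.subset_insert _ _⟩

theorem isRegular_pairing : T.pairing.IsRegular :=
  have := T.isProper_pairing
  SSet.Subcomplex.Pairing.WeakRankFunction.isRegular (α := ℕ)
    { rank s := T.rank (vertexSet s.1.toS)
      lt {s t} h hd := by
        refine T.rank_lt _ (T.vertexSet_mem_outside s.1) _ (T.vertexSet_mem_outside t.1)
          (T.vertex_notMem s) (finite_vertexSet _)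
          (fun h' => h.1 (Subtype.ext (eq_of_vertexSet_eq h'))) ?_ ?_
        · rw [ncard_vertexSet s.1.toN, ncard_vertexSet t.1.toN, hd]
        · exact T.vertexSet_pairing t ▸ (le_iff_vertexSet_subset _ _).1 h.2.le }

theorem anodyneExtensions (T : NerveToggle U) : SSet.anodyneExtensions U.ι :=
  have := T.isProper_pairing
  have := T.isRegular_pairing
  T.pairing.anodyneExtensions

end NerveToggle

end

section

open Simplicial HomotopicalAlgebra SSet.modelCategoryQuillen MonoidalCategory

/-! ### Cylinders in nerves of marked categories -/

/-- A class of objects called points, and a set of vertices for every object. -/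
structure Marking (C I : Type*) where
  isPt : C → Prop
  verts : C → Set I

namespace Marking

variable {C D : Type u} {I I' : Type*}

section

variable [Category.{v} C]

/-- The chains in which the vertices of the points belong to those of the other objects. -/
def cyl (μ : Marking C I) : (nerve C).Subcomplex where
  obj _ := {c | ∀ a b, ¬ μ.isPt (c.obj a) → μ.isPt (c.obj b) →
    μ.verts (c.obj b) ⊆ μ.verts (c.obj a)}
  map θ _ hc a b := hc (θ.unop.toOrderHom a) (θ.unop.toOrderHom b)

/-- The chains without points. -/
def base (μ : Marking C I) : μ.cyl.toSSet.Subcomplex where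
  obj _ := {c | ∀ a, ¬ μ.isPt (c.1.obj a)}
  map θ _ hc a := hc (θ.unop.toOrderHom a)

/-- The chains of points. -/
def pts (μ : Marking C I) : μ.cyl.toSSet.Subcomplex where
  obj _ := {c | ∀ a, μ.isPt (c.1.obj a)}
  map θ _ hc a := hc (θ.unop.toOrderHom a)

/-- All vertices of the members of a chain. -/
def supp (μ : Marking C I) {n : SimplexCategoryᵒᵖ} (c : μ.cyl.toSSet.obj n) : Set I :=
  ⋃ a, μ.verts (c.1.obj a)

theorem supp_map_subset (μ : Marking C I) {m n : SimplexCategoryᵒᵖ} (θ : m ⟶ n)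
    (c : μ.cyl.toSSet.obj m) : μ.supp (μ.cyl.toSSet.map θ c) ⊆ μ.supp c :=
  Set.iUnion_subset fun _ => Set.subset_iUnion (fun a => μ.verts (c.1.obj a)) _

/-- The chains with too few vertices. -/
def bd (μ : Marking C I) : μ.cyl.toSSet.Subcomplex where
  obj _ := {c | μ.supp c ≠ Set.univ}
  map θ c hc h := hc (Set.eq_univ_of_univ_subset (h ▸ μ.supp_map_subset θ c))

end

variable [Category.{0} C] [Category.{0} D]

/-- The map of cylinders induced by a functor. -/
def cylMap (μ : Marking C I) (ν : Marking D I') (F : C ⥤ D)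
    (hF : ∀ n (c : ComposableArrows C n), c ∈ μ.cyl.obj (op ⦋n⦌) →
      (c ⋙ F : ComposableArrows D n) ∈ ν.cyl.obj (op ⦋n⦌)) :
    μ.cyl.toSSet ⟶ ν.cyl.toSSet :=
  ssetHomMk (fun n c => ⟨(c.1 ⋙ F : ComposableArrows D n.unop.len), hF n.unop.len c.1 c.2⟩)
    fun _ _ => rfl

/-- The chain whose members are those of `c ⋙ G₀` where `ε` is `0` and of `c ⋙ G₁` where `ε` is
`1`. -/
def deformChain {G₀ G₁ : C ⥤ D} (τ : G₀ ⟶ G₁) {n : ℕ} (c : ComposableArrows C n)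
    (ε : Fin (n + 1) →o Fin 2) : ComposableArrows D n :=
  Functor.prod' ε.monotone.functor c ⋙ Functor.uncurry.obj (ComposableArrows.mk₁ τ)

section

variable {G₀ G₁ : C ⥤ D} (τ : G₀ ⟶ G₁) {n : ℕ} (c : ComposableArrows C n)

theorem deformChain_obj_eq_or (ε : Fin (n + 1) →o Fin 2) (a : Fin (n + 1)) :
    (ε a = 0 ∧ (deformChain τ c ε).obj a = G₀.obj (c.obj a)) ∨
      (ε a = 1 ∧ (deformChain τ c ε).obj a = G₁.obj (c.obj a)) := by
  change (_ ∧ ((ComposableArrows.mk₁ τ).obj (ε a)).obj (c.obj a) = _) ∨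
    (_ ∧ ((ComposableArrows.mk₁ τ).obj (ε a)).obj (c.obj a) = _)
  generalize ε a = e
  fin_cases e
  · exact Or.inl ⟨rfl, rfl⟩
  · exact Or.inr ⟨rfl, rfl⟩

theorem deformChain_const (e : Fin 2) :
    deformChain τ c (OrderHom.const _ e) = c ⋙ (ComposableArrows.mk₁ τ).obj e := by
  refine Functor.hext (fun _ => rfl) fun a b f => heq_of_eq ?_
  have map_id : (ComposableArrows.mk₁ τ).map (𝟙 e) = 𝟙 _ := CategoryTheory.Functor.map_id _ _
  change ((ComposableArrows.mk₁ τ).map (𝟙 e)).app _ ≫ ((ComposableArrows.mk₁ τ).obj e).map _ = _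
  rw [map_id]
  exact Category.id_comp _

end

/-- The homotopy given by a natural transformation. -/
def deform (μ : Marking C I) {G₀ G₁ : C ⥤ C} (τ : G₀ ⟶ G₁)
    (h : ∀ n (c : ComposableArrows C n) ε, c ∈ μ.cyl.obj (op ⦋n⦌) →
      deformChain τ c ε ∈ μ.cyl.obj (op ⦋n⦌)) : μ.cyl.toSSet ⊗ Δ[1] ⟶ μ.cyl.toSSet :=
  ssetHomMk (fun n x => ⟨deformChain τ x.1.1 (SSet.stdSimplex.objEquiv x.2).toOrderHom,
    h n.unop.len _ _ x.1.2⟩) fun _ _ => rfl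

end Marking

end

/-! ### Faces and points of a simplex -/

/-- The category of maps `[l] → [k]`, in which the morphisms go to maps that factor. -/
structure FaceCat (k : SimplexCategory) : Type u where
  {dom : SimplexCategory}
  map : dom ⟶ k

namespace FaceCat

variable {k l : SimplexCategory}

instance : Category.{0} (FaceCat.{u} k) where
  Hom φ ψ := {θ : ψ.dom ⟶ φ.dom // θ ≫ φ.map = ψ.map}
  id φ := ⟨𝟙 _, Category.id_comp _⟩
  comp f g := ⟨g.1 ≫ f.1, by rw [Category.assoc, f.2, g.2]⟩
  id_comp _ := Subtype.ext (Category.comp_id _)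
  comp_id _ := Subtype.ext (Category.id_comp _)
  assoc _ _ _ := Subtype.ext (Category.assoc _ _ _).symm

@[ext]
theorem hom_ext {φ ψ : FaceCat.{u} k} {f g : φ ⟶ ψ} (h : f.1 = g.1) : f = g := Subtype.ext h

/-- The first vertex. -/
def first (φ : FaceCat.{u} k) : Fin (k.len + 1) := φ.map.toOrderHom 0

theorem first_le {φ ψ : FaceCat.{u} k} (f : φ ⟶ ψ) : φ.first ≤ ψ.first := by
  have h : ψ.first = φ.map.toOrderHom (f.1.toOrderHom 0) :=
    (congrArg (fun θ => θ.toOrderHom 0) f.2).symm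
  rw [h]
  exact φ.map.toOrderHom.monotone (Fin.zero_le _)

/-- Composition with a map `[k] → [l]`. -/
def push (α : k ⟶ l) : FaceCat.{u} k ⥤ FaceCat.{u} l where
  obj φ := ⟨φ.map ≫ α⟩
  map f := ⟨f.1, by rw [← Category.assoc, f.2]⟩

end FaceCat

/-- The category of faces and vertices of a simplex, with morphisms from faces to vertices. -/
inductive Coll (k : SimplexCategory) : Type u
  | face (φ : FaceCat.{u} k)
  | pt (i : Fin (k.len + 1))

namespace Coll

variable {k l m : SimplexCategory}

/-- The morphisms of `Coll k`: a face maps to the vertices which are not before its first one. -/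
def Hom : Coll.{u} k → Coll.{u} k → Type
  | face φ, face ψ => φ ⟶ ψ
  | face φ, pt i => PLift (φ.first ≤ i)
  | pt i, pt j => PLift (i ≤ j)
  | pt _, face _ => PEmpty

/-- The identities of `Coll k`. -/
def Hom.id : ∀ x : Coll.{u} k, Hom x x
  | face φ => 𝟙 φ
  | pt _ => ⟨le_rfl⟩

/-- The composition of `Coll k`. -/
def Hom.comp : ∀ {x y z : Coll.{u} k}, Hom x y → Hom y z → Hom x z
  | face _, face _, face _, f, g => CategoryStruct.comp (obj := FaceCat.{u} k) f g
  | face _, face _, pt _, f, g => ⟨(FaceCat.first_le f).trans g.down⟩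
  | face _, pt _, pt _, f, g => ⟨f.down.trans g.down⟩
  | pt _, pt _, pt _, f, g => ⟨f.down.trans g.down⟩
  | pt _, face _, _, f, _ => f.elim
  | face _, pt _, face _, _, g => g.elim
  | pt _, pt _, face _, _, g => g.elim

instance : Category.{0} (Coll.{u} k) where
  Hom := Hom
  id := Hom.id
  comp := Hom.comp
  id_comp {x y} f := by
    rcases x with φ | i <;> rcases y with ψ | j
    · exact Category.id_comp (obj := FaceCat.{u} k) f
    · rfl
    · exact f.elim
    · rfl
  comp_id {x y} f := by
    rcases x with φ | i <;> rcases y with ψ | j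
    · exact Category.comp_id (obj := FaceCat.{u} k) f
    · rfl
    · exact f.elim
    · rfl
  assoc {x y z w} f g h := by
    rcases x with φ | i <;> rcases y with ψ | j <;> rcases z with χ | p <;> rcases w with ω | q <;>
      first
      | exact Category.assoc (obj := FaceCat.{u} k) f g h
      | rfl
      | exact f.elim
      | exact g.elim
      | exact h.elim

instance (x : Coll.{u} k) (i : Fin (k.len + 1)) : Subsingleton (x ⟶ pt i) := by
  rcases x with φ | j <;> exact ⟨fun ⟨_⟩ ⟨_⟩ => rfl⟩

/-- The inclusion of the category of faces. -/
def inc (k : SimplexCategory) : FaceCat.{u} k ⥤ Coll.{u} k where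
  obj := face
  map f := f

/-- The marking of `Coll k` by its vertices. -/
def marking (k : SimplexCategory) : Marking (Coll.{u} k) (Fin (k.len + 1)) where
  isPt := fun x => match x with
    | face _ => False
    | pt _ => True
  verts := fun x => match x with
    | face φ => Set.range φ.map.toOrderHom
    | pt i => {i}

@[simp]
theorem verts_face (φ : FaceCat.{u} k) :
    (marking k).verts (face φ) = Set.range φ.map.toOrderHom := rfl

/-- The functor induced by a map `[k] → [l]`. -/
def push (α : k ⟶ l) : Coll.{u} k ⥤ Coll.{u} l where
  obj x := match x with
    | face φ => face ((FaceCat.push α).obj φ)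
    | pt i => pt (α.toOrderHom i)
  map {x y} f := match x, y, f with
    | face φ, face ψ, f => (FaceCat.push α).map f
    | face _, pt _, f => ⟨α.toOrderHom.monotone f.down⟩
    | pt _, pt _, f => ⟨α.toOrderHom.monotone f.down⟩
    | pt _, face _, f => f.elim
  map_id x := by
    rcases x with φ | i <;> rfl
  map_comp {x y z} f g := by
    rcases x with φ | i <;> rcases y with ψ | j <;> rcases z with χ | p <;>
      first
      | rfl
      | exact f.elim
      | exact g.elim

/-- The functor which sends a face to its first vertex. -/
def firstVertex (k : SimplexCategory) : Coll.{u} k ⥤ Coll.{u} k where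
  obj x := match x with
    | face φ => pt φ.first
    | pt i => pt i
  map {x y} f := match x, y, f with
    | face _, face _, f => ⟨FaceCat.first_le f⟩
    | face _, pt _, f => ⟨f.down⟩
    | pt _, pt _, f => ⟨f.down⟩
    | pt _, face _, f => f.elim
  map_id x := by rcases x with φ | i <;> rfl
  map_comp {x y z} f g := by
    rcases x with φ | i <;> rcases y with ψ | j <;> rcases z with χ | p <;> rfl

/-- The canonical morphisms to the first vertices. -/
def toFirstVertex (k : SimplexCategory) : 𝟭 (Coll.{u} k) ⟶ firstVertex k where
  app x := match x with
    | face _ => ⟨le_rfl⟩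
    | pt _ => ⟨le_rfl⟩
  naturality x y f := by
    rcases x with φ | i <;> rcases y with ψ | j <;> rfl

theorem verts_subset {x y : Coll.{u} k} (f : x ⟶ y) (hx : ¬ (marking k).isPt x)
    (hy : ¬ (marking k).isPt y) : (marking k).verts y ⊆ (marking k).verts x := by
  rcases x with φ | i <;> rcases y with ψ | j
  · rintro _ ⟨a, rfl⟩
    exact ⟨f.1.toOrderHom a, congrArg (fun θ => θ.toOrderHom a) f.2⟩
  · exact absurd trivial hy
  · exact absurd trivial hx
  · exact absurd trivial hx

theorem isPt_firstVertex (x : Coll.{u} k) : (marking k).isPt ((firstVertex k).obj x) := by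
  rcases x with _ | _ <;> exact trivial

theorem verts_firstVertex_subset (x : Coll.{u} k) :
    (marking k).verts ((firstVertex k).obj x) ⊆ (marking k).verts x := by
  rcases x with φ | i
  · rintro _ rfl
    exact ⟨0, rfl⟩
  · exact subset_rfl

end Coll

section

open Simplicial MonoidalCategory

namespace Coll

variable {k : SimplexCategory}

theorem deformChain_toFirstVertex_mem_cyl {n : ℕ} (c : ComposableArrows (Coll.{u} k) n)
    (ε : Fin (n + 1) →o Fin 2) (hc : c ∈ (marking k).cyl.obj (op ⦋n⦌)) :
    Marking.deformChain (toFirstVertex k) c ε ∈ (marking k).cyl.obj (op ⦋n⦌) := by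
  intro a b ha hb
  change Fin (n + 1) at a b
  obtain ⟨hεa, h⟩ | ⟨-, h⟩ := Marking.deformChain_obj_eq_or (toFirstVertex k) c ε a <;> rw [h] at ha
  · rw [h]
    obtain ⟨-, h'⟩ | ⟨hεb, h'⟩ := Marking.deformChain_obj_eq_or (toFirstVertex k) c ε b <;>
      rw [h'] at hb ⊢
    · exact hc a b ha hb
    · refine (verts_firstVertex_subset _).trans ?_
      by_cases hb' : (marking k).isPt (c.obj b)
      · exact hc a b ha hb'
      · have hab : a ≤ b := (ε.monotone.reflect_lt (by rw [hεa, hεb]; exact Fin.zero_lt_one)).le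
        exact verts_subset (c.map (homOfLE hab)) ha hb'
  · exact absurd (isPt_firstVertex _) ha

theorem firstVertex_comp_mem_cyl {n : SimplexCategoryᵒᵖ} (c : (nerve (Coll.{u} k)).obj n) :
    (c ⋙ firstVertex k : ComposableArrows _ n.unop.len) ∈ (marking k).cyl.obj n :=
  fun _ _ ha => absurd (isPt_firstVertex _) ha

/-- The retraction of the cylinder to its points. -/
def toPts (k : SimplexCategory) : (marking.{u} k).cyl.toSSet ⟶ (marking.{u} k).pts.toSSet :=
  ssetHomMk (fun _ c => ⟨⟨c.1 ⋙ firstVertex k, firstVertex_comp_mem_cyl c.1⟩,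
    fun _ => isPt_firstVertex _⟩) fun _ _ => rfl

/-- The homotopy from the identity of the cylinder to the retraction to its points. -/
def homotopyToPts (k : SimplexCategory) :
    (marking.{u} k).cyl.toSSet ⊗ Δ[1] ⟶ (marking.{u} k).cyl.toSSet :=
  Marking.deform _ (toFirstVertex k) fun _ => deformChain_toFirstVertex_mem_cyl

theorem homotopyToPts_obj_eq_or {n : SimplexCategoryᵒᵖ} (x : (marking.{u} k).cyl.toSSet.obj n)
    (s : (Δ[1] : SSet.{u}).obj n) (a : Fin (n.unop.len + 1)) :
    ((homotopyToPts k).app n (x, s)).1.obj a = x.1.obj a ∨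
      ((homotopyToPts k).app n (x, s)).1.obj a = (firstVertex k).obj (x.1.obj a) :=
  (Marking.deformChain_obj_eq_or (toFirstVertex k) x.1 (SSet.stdSimplex.objEquiv s).toOrderHom
    a).imp And.right And.right

theorem homotopyToPts_mem_pts_sup_bd {n : SimplexCategoryᵒᵖ}
    (x : (marking.{u} k).cyl.toSSet.obj n) (s : (Δ[1] : SSet.{u}).obj n)
    (hx : x ∈ ((marking.{u} k).pts ⊔ (marking k).bd).obj n) :
    (homotopyToPts k).app n (x, s) ∈ ((marking.{u} k).pts ⊔ (marking k).bd).obj n := by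
  refine hx.imp (fun hx a => ?_) fun hx h => hx (Set.eq_univ_of_univ_subset ?_)
  · obtain h | h := homotopyToPts_obj_eq_or x s a <;> rw [h]
    exacts [hx a, isPt_firstVertex _]
  · rw [← h]
    refine Set.iUnion_mono fun a => ?_
    obtain h | h := homotopyToPts_obj_eq_or x s a <;> rw [h]
    exact verts_firstVertex_subset _

theorem anodyneExtensions_pts_sup_bd (k : SimplexCategory) :
    SSet.anodyneExtensions ((marking.{u} k).pts ⊔ (marking k).bd).ι := by
  refine anodyneExtensions_of_deformation _ (marking.{u} k).pts.ι (toPts k) 1 0 (homotopyToPts k)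
    (fun n x => Subtype.ext (Marking.deformChain_const _ _ 1))
    (fun n x => Subtype.ext (Marking.deformChain_const _ _ 0))
    (fun n x s hx => homotopyToPts_mem_pts_sup_bd x s hx)
    (anodyneExtensions_ι_of_eq_top ?_)
  ext n x
  exact ⟨fun _ => trivial, fun _ => Or.inl x.2⟩

end Coll

end

/-! ### The poset of faces and points -/

namespace FaceCat

variable {k : SimplexCategory}

theorem subsingleton_hom (φ ψ : FaceCat.{u} k) (hφ : Function.Injective φ.map.toOrderHom) :
    Subsingleton (φ ⟶ ψ) := by
  refine ⟨fun f g => ?_⟩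
  ext a : 4
  refine hφ ?_
  have hf := congrArg (fun θ => θ.toOrderHom a) f.2
  have hg := congrArg (fun θ => θ.toOrderHom a) g.2
  exact hf.trans hg.symm

theorem nonempty_hom (φ ψ : FaceCat.{u} k) (hφ : Function.Injective φ.map.toOrderHom)
    (h : Set.range ψ.map.toOrderHom ⊆ Set.range φ.map.toOrderHom) : Nonempty (φ ⟶ ψ) := by
  choose f hf using fun a => h ⟨a, rfl⟩
  refine ⟨⟨SimplexCategory.Hom.mk ⟨f, fun a b hab => ?_⟩, ?_⟩⟩
  · have hs : StrictMono φ.map.toOrderHom := φ.map.toOrderHom.monotone.strictMono_of_injective hφ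
    rw [← hs.le_iff_le, hf, hf]
    exact ψ.map.toOrderHom.monotone hab
  · ext a : 3
    exact hf a

theorem first_le_of_mem_range (φ : FaceCat.{u} k) {i : Fin (k.len + 1)}
    (hi : i ∈ Set.range φ.map.toOrderHom) : φ.first ≤ i := by
  obtain ⟨a, rfl⟩ := hi
  exact φ.map.toOrderHom.monotone (Fin.zero_le _)

/-- The inclusion of a nonempty set of vertices. -/
def ofFinset (S : Finset (Fin (k.len + 1))) (hS : S.Nonempty) : FaceCat.{u} k where
  dom := SimplexCategory.mk (S.card - 1)
  map := SimplexCategory.Hom.mk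
    (S.orderEmbOfFin (Nat.sub_add_cancel hS.card_pos).symm).toOrderHom

theorem ofFinset_injective (S : Finset (Fin (k.len + 1))) (hS : S.Nonempty) :
    Function.Injective (ofFinset.{u} S hS).map.toOrderHom :=
  (S.orderEmbOfFin (Nat.sub_add_cancel hS.card_pos).symm).injective

theorem range_ofFinset (S : Finset (Fin (k.len + 1))) (hS : S.Nonempty) :
    Set.range (ofFinset.{u} S hS).map.toOrderHom = S :=
  S.range_orderEmbOfFin (Nat.sub_add_cancel hS.card_pos).symm

/-- The set of vertices of a face. -/
def image (φ : FaceCat.{u} k) : Finset (Fin (k.len + 1)) := Finset.univ.image φ.map.toOrderHom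

theorem coe_image (φ : FaceCat.{u} k) : (φ.image : Set _) = Set.range φ.map.toOrderHom := by
  simp [image]

theorem image_nonempty (φ : FaceCat.{u} k) : φ.image.Nonempty :=
  Finset.univ_nonempty.image _

end FaceCat

/-- Nonempty sets of vertices of a simplex, and vertices. This is the poset of nondegenerate faces
in `Coll k`, onto which `Coll k` deforms. -/
inductive Cell (k : SimplexCategory) : Type u
  | set (S : Finset (Fin (k.len + 1))) (hS : S.Nonempty)
  | pt (i : Fin (k.len + 1))

namespace Cell

variable {k : SimplexCategory}

/-- Sets are ordered by reverse inclusion, and they precede the vertices that are not smaller than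
all of their elements. -/
def Le : Cell.{u} k → Cell.{u} k → Prop
  | set S _, set T _ => T ⊆ S
  | set S hS, pt i => S.min' hS ≤ i
  | pt i, pt j => i ≤ j
  | pt _, set _ _ => False

instance : PartialOrder (Cell.{u} k) where
  le := Le
  le_refl x := by
    rcases x with ⟨S, _⟩ | i
    · exact subset_rfl (a := S)
    · exact le_refl i
  le_trans x y z h h' := by
    rcases x with ⟨S, hS⟩ | i <;> rcases y with ⟨T, hT⟩ | j <;> rcases z with ⟨W, hW⟩ | m
    · exact subset_trans (show W ⊆ T from h') h
    · exact (Finset.min'_subset hT (show T ⊆ S from h)).trans h'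
    · exact False.elim h'
    · exact le_trans (b := j) h h'
    · exact False.elim h
    · exact False.elim h
    · exact False.elim h'
    · exact le_trans (b := j) h h'
  le_antisymm x y h h' := by
    rcases x with ⟨S, hS⟩ | i <;> rcases y with ⟨T, hT⟩ | j
    · obtain rfl : S = T := subset_antisymm h' h
      rfl
    · exact False.elim h'
    · exact False.elim h
    · exact congrArg pt (le_antisymm h h')

theorem set_le_set {S T : Finset (Fin (k.len + 1))} {hS : S.Nonempty} {hT : T.Nonempty} :
    set.{u} S hS ≤ set T hT ↔ T ⊆ S := Iff.rfl

theorem set_le_pt {S : Finset (Fin (k.len + 1))} {hS : S.Nonempty} {i : Fin (k.len + 1)} :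
    set.{u} S hS ≤ pt i ↔ S.min' hS ≤ i := Iff.rfl

/-- The marking of `Cell k` by its vertices. -/
def marking (k : SimplexCategory) : Marking (Cell.{u} k) (Fin (k.len + 1)) where
  isPt := fun x => match x with
    | set _ _ => False
    | pt _ => True
  verts := fun x => match x with
    | set S _ => S
    | pt i => {i}

/-- A nonempty set of vertices as the face which it spans. -/
def collObj : Cell.{u} k → Coll.{u} k
  | set S hS => Coll.face (FaceCat.ofFinset S hS)
  | pt i => Coll.pt i

theorem isPt_collObj (x : Cell.{u} k) :
    (Coll.marking k).isPt (collObj x) ↔ (marking k).isPt x := by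
  rcases x with ⟨S, hS⟩ | i <;> exact Iff.rfl

theorem verts_collObj (x : Cell.{u} k) :
    (Coll.marking k).verts (collObj x) = (marking k).verts x := by
  rcases x with ⟨S, hS⟩ | i
  · exact FaceCat.range_ofFinset.{u} S hS
  · rfl

theorem subsingleton_hom (x : Cell.{u} k) (y : Coll.{u} k) : Subsingleton (collObj x ⟶ y) := by
  rcases y with ψ | j
  · rcases x with ⟨S, hS⟩ | i
    · exact FaceCat.subsingleton_hom _ _ (FaceCat.ofFinset_injective S hS)
    · exact ⟨fun f => PEmpty.elim f⟩
  · infer_instance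

theorem nonempty_hom_collObj {x y : Cell.{u} k} (h : x ≤ y) :
    Nonempty (collObj x ⟶ collObj y) := by
  rcases x with ⟨S, hS⟩ | i <;> rcases y with ⟨T, hT⟩ | j
  · refine FaceCat.nonempty_hom _ _ (FaceCat.ofFinset_injective S hS) ?_
    rw [FaceCat.range_ofFinset, FaceCat.range_ofFinset]
    exact h
  · refine ⟨⟨(FaceCat.first_le_of_mem_range (i := S.min' hS) _ ?_).trans h⟩⟩
    rw [FaceCat.range_ofFinset]
    exact S.min'_mem hS
  · exact False.elim h
  · exact ⟨⟨h⟩⟩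

/-- The functor to faces and points. -/
noncomputable def toColl (k : SimplexCategory) : Cell.{u} k ⥤ Coll.{u} k where
  obj := collObj
  map f := (nonempty_hom_collObj (leOfHom f)).some
  map_id _ := (subsingleton_hom _ _).elim _ _
  map_comp _ _ := (subsingleton_hom _ _).elim _ _

/-- The set of vertices of a face, and a point as it is. -/
def ofCollObj : Coll.{u} k → Cell.{u} k
  | Coll.face φ => set φ.image φ.image_nonempty
  | Coll.pt i => pt i

theorem isPt_ofCollObj (x : Coll.{u} k) :
    (marking k).isPt (ofCollObj x) ↔ (Coll.marking k).isPt x := by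
  rcases x with φ | i <;> exact Iff.rfl

theorem verts_ofCollObj (x : Coll.{u} k) :
    (marking k).verts (ofCollObj x) = (Coll.marking k).verts x := by
  rcases x with φ | i
  · exact φ.coe_image
  · rfl

theorem ofCollObj_le {x y : Coll.{u} k} (f : x ⟶ y) : ofCollObj x ≤ ofCollObj y := by
  rcases x with φ | i <;> rcases y with ψ | j
  · have := Coll.verts_subset f id id
    rw [Coll.verts_face, Coll.verts_face, ← FaceCat.coe_image, ← FaceCat.coe_image] at this
    exact Finset.coe_subset.1 this
  · refine (Finset.min'_le _ φ.first ?_).trans (PLift.down f)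
    exact Finset.mem_image.2 ⟨0, Finset.mem_univ _, rfl⟩
  · exact PEmpty.elim f
  · exact PLift.down f

/-- The functor from faces and points. -/
def ofColl (k : SimplexCategory) : Coll.{u} k ⥤ Cell.{u} k where
  obj := ofCollObj
  map f := homOfLE (ofCollObj_le f)

theorem nonempty_hom_counit (x : Coll.{u} k) : Nonempty (collObj (ofCollObj x) ⟶ x) := by
  rcases x with φ | i
  · refine FaceCat.nonempty_hom _ _ (FaceCat.ofFinset_injective _ _) ?_
    rw [FaceCat.range_ofFinset, FaceCat.coe_image]
  · exact ⟨𝟙 _⟩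

/-- The morphisms from the images of faces to the faces. -/
noncomputable def counit (k : SimplexCategory) : ofColl.{u} k ⋙ toColl k ⟶ 𝟭 _ where
  app x := (nonempty_hom_counit x).some
  naturality _ _ _ := (subsingleton_hom _ _).elim _ _

end Cell

section

open Simplicial MonoidalCategory

namespace Cell

variable {k : SimplexCategory}

/-- The map of cylinders from cells to faces and points. -/
noncomputable def cylToColl (k : SimplexCategory) :
    (marking.{u} k).cyl.toSSet ⟶ (Coll.marking.{u} k).cyl.toSSet :=
  ssetHomMk (fun n c => ⟨(c.1 ⋙ toColl k : ComposableArrows _ n.unop.len), fun a b ha hb =>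
    (verts_collObj _).le.trans ((c.2 a b (fun h => ha ((isPt_collObj _).2 h))
      ((isPt_collObj _).1 hb)).trans (verts_collObj _).ge)⟩) fun _ _ => rfl

/-- The map of cylinders from faces and points to cells. -/
def cylOfColl (k : SimplexCategory) :
    (Coll.marking.{u} k).cyl.toSSet ⟶ (marking.{u} k).cyl.toSSet :=
  ssetHomMk (fun n c => ⟨(c.1 ⋙ ofColl k : ComposableArrows _ n.unop.len), fun a b ha hb =>
    (verts_ofCollObj _).le.trans ((c.2 a b (fun h => ha ((isPt_ofCollObj _).2 h))
      ((isPt_ofCollObj _).1 hb)).trans (verts_ofCollObj _).ge)⟩) fun _ _ => rfl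

section

variable {n : ℕ} (c : ComposableArrows (Coll.{u} k) n) (ε : Fin (n + 1) →o Fin 2) (a : Fin (n + 1))

theorem isPt_deformChain_counit :
    (Coll.marking k).isPt ((Marking.deformChain (counit k) c ε).obj a) ↔
      (Coll.marking k).isPt (c.obj a) := by
  obtain ⟨-, h⟩ | ⟨-, h⟩ := Marking.deformChain_obj_eq_or (counit k) c ε a <;> rw [h]
  exacts [(isPt_collObj _).trans (isPt_ofCollObj _), Iff.rfl]

theorem verts_deformChain_counit :
    (Coll.marking k).verts ((Marking.deformChain (counit k) c ε).obj a) =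
      (Coll.marking k).verts (c.obj a) := by
  obtain ⟨-, h⟩ | ⟨-, h⟩ := Marking.deformChain_obj_eq_or (counit k) c ε a <;> rw [h]
  exacts [(verts_collObj _).trans (verts_ofCollObj _), rfl]

end

/-- The homotopy to the identity of `Coll k` from the composite through the poset of cells. -/
noncomputable def homotopyToColl (k : SimplexCategory) :
    (Coll.marking.{u} k).cyl.toSSet ⊗ Δ[1] ⟶ (Coll.marking.{u} k).cyl.toSSet :=
  Marking.deform _ (counit k) fun n c ε hc a b ha hb => by
    rw [isPt_deformChain_counit] at ha hb
    rw [verts_deformChain_counit, verts_deformChain_counit]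
    exact hc a b ha hb

theorem homotopyToColl_mem_base_sup_bd {n : SimplexCategoryᵒᵖ}
    (x : (Coll.marking.{u} k).cyl.toSSet.obj n) (s : (Δ[1] : SSet.{u}).obj n)
    (hx : x ∈ ((Coll.marking.{u} k).base ⊔ (Coll.marking k).bd).obj n) :
    (homotopyToColl k).app n (x, s) ∈ ((Coll.marking.{u} k).base ⊔ (Coll.marking k).bd).obj n :=
  hx.imp (fun hx a h => hx a ((isPt_deformChain_counit x.1 _ a).1 h)) fun hx h =>
    hx ((Set.iUnion_congr (verts_deformChain_counit x.1 _)).symm.trans h)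

open Classical in
/-- The vertices which are points of a chain. -/
noncomputable def ptSet (s : Set (Cell.{u} k)) : Finset (Fin (k.len + 1)) :=
  Finset.univ.filter fun i => pt i ∈ s

@[simp]
theorem mem_ptSet (s : Set (Cell.{u} k)) (i : Fin (k.len + 1)) : i ∈ ptSet s ↔ pt i ∈ s := by
  simp [ptSet]

open Classical in
/-- The face spanned by the points of a chain, with the junk value `pt 0` if there are none. -/
noncomputable def ptCell (s : Set (Cell.{u} k)) : Cell.{u} k :=
  if h : (ptSet s).Nonempty then set (ptSet s) h else pt 0

theorem ptCell_eq {s : Set (Cell.{u} k)} (h : (ptSet s).Nonempty) :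
    ptCell s = set (ptSet s) h := dif_pos h

theorem ptCell_congr {s t : Set (Cell.{u} k)} (h : ptSet s = ptSet t) : ptCell s = ptCell t := by
  simp only [ptCell, h]

/-- The sets of members of the chains in the cylinder outside of the base and the boundary. -/
def outside (k : SimplexCategory) : Set (Set (Cell.{u} k)) :=
  {s | (∀ S hS, set S hS ∈ s → ptSet s ⊆ S) ∧ (ptSet s).Nonempty ∧
    ⋃ x ∈ s, (marking k).verts x = Set.univ}

theorem mem_cyl_iff {n : ℕ} (c : ComposableArrows (Cell.{u} k) n) :
    c ∈ (marking k).cyl.obj (op ⦋n⦌) ↔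
      ∀ S hS, set S hS ∈ Set.range c.obj → ptSet (Set.range c.obj) ⊆ S := by
  constructor
  · rintro hc S hS ⟨a, ha⟩ i hi
    obtain ⟨b, hb⟩ := (mem_ptSet _ _).1 hi
    have := hc a b
    rw [ha, hb] at this
    exact this id trivial rfl
  · intro h a b ha hb
    rcases hS : c.obj a with ⟨S, hS'⟩ | i
    · rcases hi : c.obj b with _ | i
      · rw [hi] at hb
        exact hb.elim
      · rintro _ rfl
        exact h S hS' ⟨a, hS⟩ ((mem_ptSet _ _).2 ⟨b, hi⟩)
    · rw [hS] at ha
      exact absurd trivial ha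

theorem ptSet_nonempty_iff {s : Set (Cell.{u} k)} :
    (ptSet s).Nonempty ↔ ∃ x ∈ s, (marking k).isPt x := by
  constructor
  · rintro ⟨i, hi⟩
    exact ⟨pt i, (mem_ptSet _ _).1 hi, trivial⟩
  · rintro ⟨_ | i, hx, h⟩
    · exact h.elim
    · exact ⟨i, (mem_ptSet _ _).2 hx⟩

theorem notMem_preimage_iff {n : ℕ} (x : (marking.{u} k).cyl.toSSet _⦋n⦌) :
    x ∉ (((Coll.marking.{u} k).base ⊔ (Coll.marking k).bd).preimage (cylToColl k)).obj (op ⦋n⦌) ↔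
      (ptSet (Set.range x.1.obj)).Nonempty ∧
        ⋃ y ∈ Set.range x.1.obj, (marking k).verts y = Set.univ := by
  refine not_or.trans (and_congr ?_ ?_)
  · rw [ptSet_nonempty_iff, Set.exists_range_iff]
    refine not_forall.trans (exists_congr fun a => not_not.trans ?_)
    exact isPt_collObj _
  · rw [Set.biUnion_range]
    refine not_not.trans (Eq.congr_left (Set.iUnion_congr fun a => ?_))
    exact verts_collObj _

theorem ptSet_insert_ptCell {s : Set (Cell.{u} k)} (hs : (ptSet s).Nonempty) :
    ptSet (insert (ptCell s) s) = ptSet s := by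
  ext i
  simp [ptCell_eq hs]

theorem ptSet_sdiff_ptCell {s : Set (Cell.{u} k)} (hs : (ptSet s).Nonempty) :
    ptSet (s \ {ptCell s}) = ptSet s := by
  ext i
  simp [ptCell_eq hs]

theorem isChain_insert_ptCell {s : Set (Cell.{u} k)} (hs : s ∈ outside k)
    (hc : IsChain (· ≤ ·) s) : IsChain (· ≤ ·) (insert (ptCell s) s) := by
  refine hc.insert fun x hx _ => ?_
  rw [ptCell_eq hs.2.1]
  rcases x with ⟨S, hS⟩ | i
  · exact Or.inr (set_le_set.2 (hs.1 S hS hx))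
  · exact Or.inl (set_le_pt.2 (Finset.min'_le _ _ ((mem_ptSet _ _).2 hx)))

theorem insert_ptCell_mem_outside {s : Set (Cell.{u} k)} (hs : s ∈ outside k) :
    insert (ptCell s) s ∈ outside k := by
  obtain ⟨hsub, hne, hun⟩ := hs
  have hpt := ptSet_insert_ptCell hne
  refine ⟨?_, hpt ▸ hne, Set.eq_univ_of_univ_subset
    (hun ▸ Set.biUnion_subset_biUnion_left (Set.subset_insert _ _))⟩
  rintro S hS (h | h)
  · rw [ptCell_eq hne, set.injEq] at h
    rw [hpt, h]
  · exact hpt ▸ hsub S hS h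

theorem sdiff_ptCell_mem_outside {s : Set (Cell.{u} k)} (hs : s ∈ outside k) :
    s \ {ptCell s} ∈ outside k := by
  obtain ⟨hsub, hne, hun⟩ := hs
  have hpt := ptSet_sdiff_ptCell hne
  refine ⟨fun S hS h => hpt ▸ hsub S hS h.1, hpt ▸ hne, Set.eq_univ_of_univ_subset ?_⟩
  rw [← hun]
  refine Set.iUnion₂_subset fun y hy i hi => ?_
  by_cases hy' : y = ptCell s
  · rw [hy', ptCell_eq hne] at hi
    refine Set.mem_biUnion (x := pt i) ?_ rfl
    exact (mem_ptSet _ _).1 (hpt ▸ hi)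
  · exact Set.mem_biUnion (x := y) ⟨hy, hy'⟩ hi

theorem card_ptSet_lt {s t : Set (Cell.{u} k)} (ht : (ptSet t).Nonempty) (hs : ptCell s ∉ s)
    (htf : t.Finite) (hst : s ≠ t) (hcard : s.ncard = t.ncard) (hsub : s ⊆ insert (ptCell t) t) :
    (ptSet s).card < (ptSet t).card := by
  refine Finset.card_lt_card (Finset.ssubset_iff_subset_ne.2 ⟨fun i hi => ?_, fun heq => ?_⟩)
  · rw [mem_ptSet] at hi ⊢
    refine (hsub hi).resolve_left ?_
    rw [ptCell_eq ht]
    nofun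
  · have hle : s ⊆ t := fun x hx => (hsub hx).resolve_left fun hx' =>
      hs (ptCell_congr heq ▸ hx' ▸ hx)
    exact hst (Set.eq_of_subset_of_ncard_le hle hcard.ge htf)

/-- The toggle which adds the face spanned by the points of a chain, or removes it. -/
noncomputable def nerveToggle (k : SimplexCategory) :
    NerveToggle (((Coll.marking.{u} k).base ⊔ (Coll.marking k).bd).preimage (cylToColl k)) where
  outside := outside k
  range_mem_outside _ c :=
    ⟨fun h => ⟨(mem_cyl_iff c).2 h.1, (notMem_preimage_iff _).2 h.2⟩,
      fun ⟨h, h'⟩ => ⟨(mem_cyl_iff c).1 h, (notMem_preimage_iff _).1 h'⟩⟩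
  vertex := ptCell
  rank s := (ptSet s).card
  nonempty _ hs := (ptSet_nonempty_iff.1 hs.2.1).imp fun _ h => h.1
  isChain_insert _ := isChain_insert_ptCell
  insert_mem _ := insert_ptCell_mem_outside
  sdiff_mem _ := sdiff_ptCell_mem_outside
  vertex_insert _ hs := ptCell_congr (ptSet_insert_ptCell hs.2.1)
  vertex_sdiff _ hs := ptCell_congr (ptSet_sdiff_ptCell hs.2.1)
  rank_lt _ _ _ ht := card_ptSet_lt ht.2.1

end Cell

theorem Coll.anodyneExtensions_base_sup_bd (k : SimplexCategory) :
    SSet.anodyneExtensions ((marking.{u} k).base ⊔ (marking k).bd).ι :=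
  anodyneExtensions_of_deformation _ (Cell.cylToColl k) (Cell.cylOfColl k) 0 1
    (Cell.homotopyToColl k) (fun _ _ => Subtype.ext (Marking.deformChain_const _ _ 0))
    (fun _ _ => Subtype.ext (Marking.deformChain_const _ _ 1))
    (fun _ x s hx => Cell.homotopyToColl_mem_base_sup_bd x s hx)
    (Cell.nerveToggle k).anodyneExtensions

end

section

open Simplicial

/-! ### The cosimplicial cylinder -/

namespace Coll

variable {k l m : SimplexCategory}

theorem isPt_push (α : k ⟶ l) (x : Coll.{u} k) :
    (marking l).isPt ((push α).obj x) ↔ (marking k).isPt x := by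
  rcases x with φ | i <;> rfl

theorem verts_push (α : k ⟶ l) (x : Coll.{u} k) :
    (marking l).verts ((push α).obj x) = α.toOrderHom '' (marking k).verts x := by
  rcases x with φ | i
  · exact Set.range_comp α.toOrderHom φ.map.toOrderHom
  · exact (Set.image_singleton (f := α.toOrderHom)).symm

theorem verts_nonempty (x : Coll.{u} k) : ((marking k).verts x).Nonempty := by
  rcases x with φ | i
  · exact ⟨_, 0, rfl⟩
  · exact ⟨i, rfl⟩

theorem face_heq {φ ψ : FaceCat.{u} k} (f : φ ⟶ ψ) {a a' : φ.dom ⟶ l} {b b' : ψ.dom ⟶ l}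
    (ha : a = a') (hb : b = b') (w : f.1 ≫ a = b) (w' : f.1 ≫ a' = b') :
    HEq (⟨f.1, w⟩ : FaceCat.mk.{u} a ⟶ FaceCat.mk.{u} b)
      (⟨f.1, w'⟩ : FaceCat.mk.{u} a' ⟶ FaceCat.mk.{u} b') := by
  subst ha hb
  rfl

theorem hom_pt_heq {x y : Coll.{u} k} {i j : Fin (k.len + 1)} (f : x ⟶ pt i) (g : y ⟶ pt j)
    (h : x = y) (h' : i = j) : HEq f g := by
  subst h h'
  exact heq_of_eq (Subsingleton.elim _ _)

theorem push_obj_congr {α β : k ⟶ l} (x : Coll.{u} k)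
    (h : ∀ i ∈ (marking k).verts x, α.toOrderHom i = β.toOrderHom i) :
    (push α).obj x = (push β).obj x := by
  rcases x with φ | i
  · refine congrArg face (congrArg FaceCat.mk ?_)
    ext i : 3
    exact h _ ⟨i, rfl⟩
  · exact congrArg pt (h i rfl)

theorem push_map_congr {α β : k ⟶ l} {x y : Coll.{u} k} (f : x ⟶ y)
    (hx : ∀ i ∈ (marking k).verts x, α.toOrderHom i = β.toOrderHom i)
    (hy : ∀ i ∈ (marking k).verts y, α.toOrderHom i = β.toOrderHom i) :
    HEq ((push α).map f) ((push β).map f) := by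
  rcases x with φ | i <;> rcases y with ψ | j
  · refine face_heq f ?_ ?_ _ _
    · ext i : 3
      exact hx _ ⟨i, rfl⟩
    · ext i : 3
      exact hy _ ⟨i, rfl⟩
  · exact hom_pt_heq _ _ (push_obj_congr _ hx) (hy j rfl)
  · exact f.elim
  · exact hom_pt_heq _ _ (push_obj_congr _ hx) (hy j rfl)

theorem comp_push_congr {α β : k ⟶ l} {n : ℕ} (c : ComposableArrows (Coll.{u} k) n)
    (h : ∀ a, ∀ i ∈ (marking k).verts (c.obj a), α.toOrderHom i = β.toOrderHom i) :
    c ⋙ push α = c ⋙ push β :=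
  CategoryTheory.Functor.hext (fun a => push_obj_congr _ (h a))
    fun a b f => push_map_congr (c.map f) (h a) (h b)

theorem push_id : push.{u} (𝟙 k) = 𝟭 _ := by
  refine CategoryTheory.Functor.hext (fun x => ?_) fun x y f => ?_
  · rcases x with φ | i
    · exact congrArg (fun a => face (FaceCat.mk a)) (Category.comp_id φ.map)
    · rfl
  · rcases x with φ | i <;> rcases y with ψ | j
    · exact face_heq f (Category.comp_id φ.map) (Category.comp_id ψ.map) _ _
    · exact hom_pt_heq _ _ (congrArg (fun a => face (FaceCat.mk a)) (Category.comp_id φ.map)) rfl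
    · exact PEmpty.elim f
    · rfl

theorem push_comp (α : k ⟶ l) (β : l ⟶ m) : push.{u} (α ≫ β) = push α ⋙ push β := by
  refine CategoryTheory.Functor.hext (fun x => ?_) fun x y f => ?_
  · rcases x with φ | i
    · exact congrArg (fun a => face (FaceCat.mk a)) (Category.assoc φ.map α β).symm
    · rfl
  · rcases x with φ | i <;> rcases y with ψ | j
    · exact face_heq f (Category.assoc φ.map α β).symm (Category.assoc ψ.map α β).symm _ _
    · exact hom_pt_heq _ _
        (congrArg (fun a => face (FaceCat.mk a)) (Category.assoc φ.map α β).symm) rfl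
    · exact PEmpty.elim f
    · rfl

theorem comp_push_mem_cyl (α : k ⟶ l) (n : ℕ) (c : ComposableArrows (Coll.{u} k) n)
    (hc : c ∈ (marking k).cyl.obj (op ⦋n⦌)) :
    (c ⋙ push α : ComposableArrows (Coll.{u} l) n) ∈ (marking l).cyl.obj (op ⦋n⦌) := by
  intro a b ha hb
  change (marking l).verts ((push α).obj (c.obj b)) ⊆ (marking l).verts ((push α).obj (c.obj a))
  rw [verts_push, verts_push]
  exact Set.image_mono (hc a b (fun h => ha ((isPt_push α _).2 h)) ((isPt_push α _).1 hb))

end Coll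

/-- A cosimplicial simplicial set whose simplices in degree `k` are supported on sets of vertices
of `[k]`, and depend only on the restriction of maps to the support. -/
structure SupportedCosimplicial where
  functor : SimplexCategory ⥤ SSet.{u}
  supp : ∀ {k n}, (functor.obj k).obj n → Set (Fin (k.len + 1))
  supp_nonempty : ∀ {k n} (m : (functor.obj k).obj n), (supp m).Nonempty
  supp_map_subset : ∀ {k n n'} (θ : n ⟶ n') (m : (functor.obj k).obj n),
    supp ((functor.obj k).map θ m) ⊆ supp m
  supp_push : ∀ {k l : SimplexCategory} {n} (α : k ⟶ l) (m : (functor.obj k).obj n),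
    supp ((functor.map α).app n m) = α.toOrderHom '' supp m
  push_congr : ∀ {k l : SimplexCategory} {n} (α β : k ⟶ l) (m : (functor.obj k).obj n),
    (∀ i ∈ supp m, α.toOrderHom i = β.toOrderHom i) →
      (functor.map α).app n m = (functor.map β).app n m

/-- The cosimplicial simplicial set of the cylinders of the simplices. -/
def Coll.cylinder : SupportedCosimplicial.{u} where
  functor :=
    { obj k := (marking k).cyl.toSSet
      map α := (marking _).cylMap (marking _) (push α) (comp_push_mem_cyl α)
      map_id k := by
        refine sset_hom_ext fun n c => Subtype.ext ?_
        exact congrArg (fun F => (c.1 ⋙ F : ComposableArrows _ _)) push_id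
      map_comp α β := by
        refine sset_hom_ext fun n c => Subtype.ext ?_
        exact congrArg (fun F => (c.1 ⋙ F : ComposableArrows _ _)) (push_comp α β) }
  supp {k n} m := (marking k).supp m
  supp_nonempty {k n} m := (verts_nonempty (m.1.obj 0)).mono
    (Set.subset_iUnion (fun a => (marking k).verts (m.1.obj a)) 0)
  supp_map_subset {k n n'} θ m := (marking k).supp_map_subset θ m
  supp_push {k l n} α m := by
    refine Eq.trans ?_ (Set.image_iUnion (f := α.toOrderHom)).symm
    exact Set.iUnion_congr fun a => verts_push α (m.1.obj a)
  push_congr {k l n} α β m h := Subtype.ext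
    (comp_push_congr _ fun a i hi => h i (Set.mem_iUnion.2 ⟨a, hi⟩))

/-! ### Extension of natural families -/

section

variable {ι : Type*} {r : ι → ι → Prop} {T : ι → Type*}

theorem exists_dependent_family_of_nonempty (hr : WellFounded r) [∀ n, Nonempty (T n)]
    (R : ∀ n, (∀ l, r l n → T l) → T n → Prop)
    (step : ∀ n (F : ∀ l, T l), (∀ m, r m n → R m (fun l _ => F l) (F m)) →
      ∃ t, R n (fun l _ => F l) t) :
    ∃ F : ∀ n, T n, ∀ n, R n (fun l _ => F l) (F n) := by
  classical
  let F : ∀ n, T n := hr.fix fun n f => Classical.epsilon (R n f)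
  have hF n : F n = Classical.epsilon (R n fun l _ => F l) := hr.fix_eq _ n
  refine ⟨F, fun n => ?_⟩
  induction n using hr.induction with
  | _ n ih =>
    rw [hF n]
    exact Classical.epsilon_spec (step n F ih)

theorem exists_dependent_family (hr : WellFounded r) (hr' : ∀ {l m n}, r l m → r m n → r l n)
    (R : ∀ n, (∀ l, r l n → T l) → T n → Prop)
    (step : ∀ n (f : ∀ l, r l n → T l),
      (∀ m (hm : r m n), R m (fun l hl => f l (hr' hl hm)) (f m hm)) → ∃ t, R n f t) :
    ∃ F : ∀ n, T n, ∀ n, R n (fun l _ => F l) (F n) := by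
  have hT n : Nonempty (T n) := by
    induction n using hr.induction with
    | _ n ih =>
      have (l : {l // r l n}) : Nonempty (T l) := ih l l.2
      obtain ⟨f, hf⟩ := exists_dependent_family_of_nonempty (T := fun l : {l // r l n} => T l)
        (InvImage.wf Subtype.val hr) (fun m g => R m fun l hl => g ⟨l, hr' hl m.2⟩ hl)
        fun m g hg => step m (fun l hl => g ⟨l, hr' hl m.2⟩) fun p hp => hg ⟨p, hr' hp m.2⟩ hp
      obtain ⟨t, -⟩ := step n (fun l hl => f ⟨l, hl⟩) fun m hm => hf ⟨m, hm⟩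
      exact ⟨t⟩
  exact exists_dependent_family_of_nonempty hr R fun n F hF => step n _ hF

end

theorem exists_simplexCategory_retraction {n : SimplexCategory} (S : Set (Fin (n.len + 1)))
    (hS : S.Nonempty) :
    ∃ (l : SimplexCategory) (i : l ⟶ n) (r : n ⟶ l), l.len ≤ n.len ∧
      (S ≠ Set.univ → l.len < n.len) ∧ (∀ a, i.toOrderHom a ∈ S) ∧
      ∀ a ∈ S, i.toOrderHom (r.toOrderHom a) = a := by
  obtain ⟨f, hf, hf'⟩ := exists_orderHom_retraction S hS
  let φ : n ⟶ n := SimplexCategory.mkHom f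
  have fac : Limits.factorThruImage φ ≫ Limits.image.ι φ = φ := Limits.image.fac φ
  have hfac : ∀ a, (Limits.image.ι φ).toOrderHom ((Limits.factorThruImage φ).toOrderHom a) = f a :=
    fun a => congrArg (fun θ => θ.toOrderHom a) fac
  have hmem : ∀ a, (Limits.image.ι φ).toOrderHom a ∈ S := by
    intro a
    obtain ⟨b, rfl⟩ := SimplexCategory.epi_iff_surjective.1
      (inferInstance : Epi (Limits.factorThruImage φ)) a
    rw [hfac]
    exact hf b
  have hle := SimplexCategory.len_le_of_mono (Limits.image.ι φ)
  refine ⟨Limits.image φ, Limits.image.ι φ, Limits.factorThruImage φ, hle, fun h => ?_, hmem,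
    fun a ha => (hfac a).trans (hf' a ha)⟩
  refine hle.lt_of_ne fun he => h (Set.eq_univ_of_forall fun b => ?_)
  have hinj := SimplexCategory.mono_iff_injective.1 (inferInstance : Mono (Limits.image.ι φ))
  have hsurj := ((Fintype.bijective_iff_injective_and_card _).2 ⟨hinj, by simp [he]⟩).2
  obtain ⟨a, rfl⟩ := hsurj b
  exact hmem a

section

variable {K : SSet.{u}} {n : SimplexCategory} {Z : Type*}
  (v : ∀ l : SimplexCategory, l.len < n.len → (n ⟶ l) → K.obj (op l) → Z)

theorem exists_nonDegenerate_eq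
    (hv : ∀ l hl p hp (f : n ⟶ l) (π : l ⟶ p) (w : K.obj (op p)),
      v p hp (f ≫ π) w = v l hl f (K.map π.op w))
    {l : SimplexCategory} (hl : l.len < n.len) (f : n ⟶ l)
    (y : K.obj (op l)) :
    ∃ (m : ℕ) (hm : m < n.len) (e : n ⟶ ⦋m⦌) (_ : Epi e) (w : K.nonDegenerate m),
      K.map f.op y = K.map e.op w ∧ v l hl f y = v _ hm e w := by
  have fac : Limits.factorThruImage f ≫ Limits.image.ι f = f := Limits.image.fac f
  have hq : (Limits.image f).len < n.len :=
    (SimplexCategory.len_le_of_mono (Limits.image.ι f)).trans_lt hl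
  obtain ⟨m, g, hg, w, hw⟩ := K.exists_nonDegenerate (n := (Limits.image f).len)
    (K.map (Limits.image.ι f).op y)
  have hm : m < n.len := (SimplexCategory.len_le_of_epi g).trans_lt hq
  have hg' : Epi (Y := SimplexCategory.mk m) (X := Limits.image f) g := hg
  refine ⟨m, hm, CategoryStruct.comp (Y := Limits.image f) (Limits.factorThruImage f) g,
    epi_comp _ _, w, ?_, ?_⟩
  · have h1 : K.map f.op y =
        K.map (Limits.factorThruImage f).op (K.map (Limits.image.ι f).op y) := by
      rw [← ConcreteCategory.comp_apply, ← K.map_comp, ← op_comp, fac]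
    rw [h1, hw, ← ConcreteCategory.comp_apply, ← K.map_comp, ← op_comp]
  · have h1 := hv _ hq l hl (Limits.factorThruImage f) (Limits.image.ι f) y
    rw [fac] at h1
    rw [h1, hw]
    exact (hv _ hq _ hm (Limits.factorThruImage f) g w).symm

theorem eq_of_degeneracy_eq
    (hv : ∀ l hl p hp (f : n ⟶ l) (π : l ⟶ p) (w : K.obj (op p)),
      v p hp (f ≫ π) w = v l hl f (K.map π.op w))
    {l l' : SimplexCategory} (hl : l.len < n.len) (hl' : l'.len < n.len)
    (f : n ⟶ l) (f' : n ⟶ l') (y : K.obj (op l)) (y' : K.obj (op l'))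
    (h : K.map f.op y = K.map f'.op y') : v l hl f y = v l' hl' f' y' := by
  obtain ⟨m, hm, e, he, w, h1, h2⟩ := exists_nonDegenerate_eq v hv hl f y
  obtain ⟨m', hm', e', he', w', h1', h2'⟩ := exists_nonDegenerate_eq v hv hl' f' y'
  have hx : K.map e.op w = K.map e'.op w' := h1.symm.trans (h.trans h1')
  obtain rfl := K.unique_nonDegenerate_dim (n := n.len) (K.map e.op w) e w rfl e' w' hx
  obtain rfl := K.unique_nonDegenerate_simplex (n := n.len) (K.map e.op w) e w rfl e' w' hx
  obtain rfl := K.unique_nonDegenerate_map (n := n.len) (K.map e.op w) e w rfl e' w hx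
  exact h2.trans h2'.symm

end

/-- The singular simplicial sets of the mapping spaces out of a simplicial space. -/
noncomputable def SimplicialSpace.sing (Y : SimplicialObject TopCat.{u}) (Z : Type u)
    [TopologicalSpace Z] :
    SimplexCategory ⥤ SSet.{u} where
  obj k := Sing (Y.obj (op k)) Z
  map α := Sing.restr Z (Y.map α.op).hom
  map_id k := by
    rw [op_id, Y.map_id]
    rfl
  map_comp α β := by
    rw [op_comp, Y.map_comp]
    rfl

namespace SupportedCosimplicial

variable (Q : SupportedCosimplicial.{u})

/-- The simplices which are not supported everywhere. -/
def bd (k : SimplexCategory) : (Q.functor.obj k).Subcomplex where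
  obj _ := {m | Q.supp m ≠ Set.univ}
  map θ m hm h := hm (Set.eq_univ_of_univ_subset (h ▸ Q.supp_map_subset θ m))

variable {Q}

theorem push_mem_bd {k l : SimplexCategory} (h : k.len < l.len) (α : k ⟶ l) {n : SimplexCategoryᵒᵖ}
    (m : (Q.functor.obj k).obj n) : (Q.functor.map α).app n m ∈ (Q.bd l).obj n := by
  change Q.supp _ ≠ Set.univ
  rw [Q.supp_push]
  intro he
  have hs : Function.Surjective α.toOrderHom := fun b => by
    obtain ⟨a, -, ha⟩ := he.symm ▸ Set.mem_univ b
    exact ⟨a, ha⟩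
  have := Fintype.card_le_of_surjective _ hs
  simp at this
  omega

theorem push_push {k l p : SimplexCategory} (α : k ⟶ l) (β : l ⟶ p) {n : SimplexCategoryᵒᵖ}
    (m : (Q.functor.obj k).obj n) : (Q.functor.map β).app n ((Q.functor.map α).app n m) =
      (Q.functor.map (α ≫ β)).app n m := by
  rw [Q.functor.map_comp]
  rfl

theorem push_id {k : SimplexCategory} {n : SimplexCategoryᵒᵖ} (m : (Q.functor.obj k).obj n) :
    (Q.functor.map (𝟙 k)).app n m = m := by
  rw [Q.functor.map_id]
  rfl

theorem push_retract {k l : SimplexCategory} (i : l ⟶ k) (r : k ⟶ l) {n : SimplexCategoryᵒᵖ}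
    (m : (Q.functor.obj k).obj n) (h : ∀ a ∈ Q.supp m, i.toOrderHom (r.toOrderHom a) = a) :
    (Q.functor.map i).app n ((Q.functor.map r).app n m) = m := by
  rw [push_push]
  exact (Q.push_congr (r ≫ i) (𝟙 k) m h).trans (push_id m)

theorem exists_push_eq_of_mem_bd {k : SimplexCategory} {n : SimplexCategoryᵒᵖ}
    {m : (Q.functor.obj k).obj n} (hm : m ∈ (Q.bd k).obj n) :
    ∃ l, ∃ _ : l.len < k.len, ∃ (i : l ⟶ k) (r : k ⟶ l),
      (Q.functor.map i).app n ((Q.functor.map r).app n m) = m := by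
  obtain ⟨l, i, r, -, hl, -, hr⟩ :=
    exists_simplexCategory_retraction (Q.supp m) (Q.supp_nonempty m)
  exact ⟨l, hl hm, i, r, push_retract i r m hr⟩

end SupportedCosimplicial

section

variable {Q : SupportedCosimplicial.{u}} {S : SimplexCategory ⥤ SSet.{u}}

/-- Naturality of a family of maps which are defined in cosimplicial degrees less than `n`. -/
def NatBelow (n : ℕ) (f : ∀ l : SimplexCategory, l.len < n → (Q.functor.obj l ⟶ S.obj l)) : Prop :=
  ∀ l l' (hl : l.len < n) (hl' : l'.len < n) (α : l ⟶ l'),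
    Q.functor.map α ≫ f l' hl' = f l hl ≫ S.map α

namespace NatBelow

section

variable {n : ℕ} {f : ∀ l : SimplexCategory, l.len < n → (Q.functor.obj l ⟶ S.obj l)}

theorem apply (hf : NatBelow n f) {l l' : SimplexCategory} (hl : l.len < n) (hl' : l'.len < n)
    (α : l ⟶ l') {d : SimplexCategoryᵒᵖ} (m : (Q.functor.obj l).obj d) :
    (f l' hl').app d ((Q.functor.map α).app d m) = (S.map α).app d ((f l hl).app d m) :=
  congrArg (fun q => q.app d m) (hf l l' hl hl' α)

theorem congr (hf : NatBelow n f) {l p : SimplexCategory} (hl : l.len < n) (α β : l ⟶ p)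
    {d : SimplexCategoryᵒᵖ} (m : (Q.functor.obj l).obj d)
    (h : ∀ i ∈ Q.supp m, α.toOrderHom i = β.toOrderHom i) :
    (S.map α).app d ((f l hl).app d m) = (S.map β).app d ((f l hl).app d m) := by
  obtain ⟨q, i, r, hq, -, hi, hr⟩ :=
    exists_simplexCategory_retraction (Q.supp m) (Q.supp_nonempty m)
  have apply_push := hf.apply (hq.trans_lt hl) hl i ((Q.functor.map r).app d m)
  rw [SupportedCosimplicial.push_retract i r m hr] at apply_push
  have comp_eq : i ≫ α = i ≫ β := by
    ext a : 3
    exact h _ (hi a)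
  have map_eq (γ : l ⟶ p) : (S.map γ).app d ((f l hl).app d m) =
      (S.map (i ≫ γ)).app d ((f q (hq.trans_lt hl)).app d ((Q.functor.map r).app d m)) := by
    rw [apply_push, S.map_comp]
    rfl
  rw [map_eq, map_eq, comp_eq]

end

variable {n : SimplexCategory}
  {f : ∀ l : SimplexCategory, l.len < n.len → (Q.functor.obj l ⟶ S.obj l)}

theorem map_eq_of_push_eq (hf : NatBelow n.len f) {l l' : SimplexCategory} (hl : l.len < n.len)
    (hl' : l'.len < n.len) (α : l ⟶ n) (α' : l' ⟶ n) {d : SimplexCategoryᵒᵖ}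
    (x : (Q.functor.obj l).obj d) (x' : (Q.functor.obj l').obj d)
    (h : (Q.functor.map α).app d x = (Q.functor.map α').app d x') :
    (S.map α).app d ((f l hl).app d x) = (S.map α').app d ((f l' hl').app d x') := by
  set m := (Q.functor.map α).app d x
  obtain ⟨q, i, r, -, hq, -, hr⟩ :=
    exists_simplexCategory_retraction (Q.supp m) (Q.supp_nonempty m)
  replace hq := hq (SupportedCosimplicial.push_mem_bd hl α x)
  have map_eq {p : SimplexCategory} (hp : p.len < n.len) (β : p ⟶ n) (y : (Q.functor.obj p).obj d)
      (hy : m = (Q.functor.map β).app d y) : (S.map β).app d ((f p hp).app d y) =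
        (S.map i).app d ((f q hq).app d ((Q.functor.map r).app d m)) := by
    have hβ : (S.map i).app d ((S.map (β ≫ r)).app d ((f p hp).app d y)) =
        (S.map ((β ≫ r) ≫ i)).app d ((f p hp).app d y) := by
      rw [S.map_comp (β ≫ r) i]
      rfl
    rw [hy, SupportedCosimplicial.push_push, hf.apply hp hq, hβ]
    refine hf.congr hp _ _ y fun a ha => (hr _ ?_).symm
    rw [hy, Q.supp_push]
    exact ⟨a, ha, rfl⟩
  rw [map_eq hl α x rfl, map_eq hl' α' x' h]

theorem exists_bd (hf : NatBelow n.len f) :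
    ∃ b : (Q.bd n).toSSet ⟶ S.obj n, ∀ l (hl : l.len < n.len) (α : l ⟶ n) d
      (m : (Q.functor.obj l).obj d) (h : (Q.functor.map α).app d m ∈ (Q.bd n).obj d),
      b.app d ⟨(Q.functor.map α).app d m, h⟩ = (S.map α).app d ((f l hl).app d m) := by
  have exists_push (d) (m : (Q.bd n).toSSet.obj d) : ∃ l, ∃ _ : l.len < n.len, ∃ (α : l ⟶ n)
      (x : (Q.functor.obj l).obj d), (Q.functor.map α).app d x = m.1 := by
    obtain ⟨l, hl, i, r, h⟩ := SupportedCosimplicial.exists_push_eq_of_mem_bd m.2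
    exact ⟨l, hl, i, _, h⟩
  choose l hl α x hx using exists_push
  refine ⟨ssetHomMk (fun d m => (S.map (α d m)).app d ((f (l d m) (hl d m)).app d (x d m))) ?_,
    fun p hp β d y h => hf.map_eq_of_push_eq _ hp _ β _ y (hx d ⟨_, h⟩)⟩
  intro d d' θ m
  rw [← sset_app_map, ← sset_app_map]
  refine hf.map_eq_of_push_eq _ _ _ _ _ _ ?_
  rw [hx, sset_app_map, hx]
  rfl

end NatBelow

end

end

theorem exists_glue_subcomplex {X W : SSet.{u}} (A B : X.Subcomplex) (f : A.toSSet ⟶ W)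
    (g : B.toSSet ⟶ W)
    (h : ∀ n x (ha : x ∈ A.obj n) (hb : x ∈ B.obj n), f.app n ⟨x, ha⟩ = g.app n ⟨x, hb⟩) :
    ∃ k : (A ⊔ B).toSSet ⟶ W,
      (∀ n x (ha : x ∈ A.obj n), k.app n ⟨x, Or.inl ha⟩ = f.app n ⟨x, ha⟩) ∧
      ∀ n x (hb : x ∈ B.obj n), k.app n ⟨x, Or.inr hb⟩ = g.app n ⟨x, hb⟩ := by
  have sq : Lattice.BicartSq (A ⊓ B) A B (A ⊔ B) := ⟨rfl, rfl⟩
  have hp := SSet.Subcomplex.BicartSq.isPushout sq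
  have w : SSet.Subcomplex.homOfLE sq.le₁₂ ≫ f = SSet.Subcomplex.homOfLE sq.le₁₃ ≫ g :=
    sset_hom_ext fun n x => h n x.1 x.2.1 x.2.2
  exact ⟨hp.desc f g w, fun n x ha => congrArg (fun q => q.app n ⟨x, ha⟩) (hp.inl_desc f g w),
    fun n x hb => congrArg (fun q => q.app n ⟨x, hb⟩) (hp.inr_desc f g w)⟩

namespace SimplicialSpace

variable (Y : SimplicialObject TopCat.{u})

theorem map_map {k l p : SimplexCategory} (α : k ⟶ l) (β : l ⟶ p) (y : Y.obj (op p)) :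
    Y.map α.op (Y.map β.op y) = Y.map (α ≫ β).op y := by
  rw [op_comp, Y.map_comp]
  rfl

theorem map_id_apply {k : SimplexCategory} (y : Y.obj (op k)) : Y.map (𝟙 k).op y = y := by
  rw [op_id, Y.map_id]
  rfl

/-- The set of degenerate simplices. -/
def degenerate (n : SimplexCategory) : Set (Y.obj (op n)) :=
  {y | ∃ l : SimplexCategory, l.len < n.len ∧ ∃ (f : n ⟶ l) (x : Y.obj (op l)), Y.map f.op x = y}

theorem degenerate_zero : degenerate Y (SimplexCategory.mk 0) = ∅ :=
  Set.eq_empty_of_forall_notMem fun _ ⟨_, hl, _⟩ => absurd hl (Nat.not_lt_zero _)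

theorem degenerate_succ (n : ℕ) : degenerate Y (SimplexCategory.mk (n + 1)) =
    ⋃ i, Set.range (Y.map (SimplexCategory.σ (n := n) i).op) := by
  refine Set.Subset.antisymm ?_ (Set.iUnion_subset fun i => ?_)
  · rintro y ⟨l, hl, f, x, rfl⟩
    let K : SSet.{u} := Y ⋙ CategoryTheory.forget TopCat.{u}
    have mem_degenerate : (Y.map f.op x : K.obj _) ∈ K.degenerate (n + 1) :=
      ⟨l.len, hl, f, x, rfl⟩
    rwa [SSet.degenerate_eq_iUnion_range_σ] at mem_degenerate
  · rintro _ ⟨x, rfl⟩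
    exact ⟨SimplexCategory.mk n, Nat.lt_succ_self n, SimplexCategory.σ i, x, rfl⟩

/-- The condition on a simplicial space that each degeneracy operator has a closed image. -/
def ClosedDegeneracies : Prop :=
  ∀ (n : ℕ) (i : Fin (n + 1)), IsClosed (Set.range (Y.map (SimplexCategory.σ i).op))

variable {Y}

theorem ClosedDegeneracies.exists_cover (h : ClosedDegeneracies Y) (n : SimplexCategory) :
    ∃ (ι : Type) (_ : Finite ι) (l : ι → SimplexCategory) (_ : ∀ i, (l i).len < n.len)
      (r : ∀ i, n ⟶ l i) (s : ∀ i, l i ⟶ n), (∀ i, s i ≫ r i = 𝟙 _) ∧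
      (∀ i, IsClosed (Set.range (Y.map (r i).op))) ∧
      ∀ y ∈ degenerate Y n, ∃ i, y ∈ Set.range (Y.map (r i).op) := by
  induction n using SimplexCategory.rec with
  | _ n =>
    cases n with
    | zero =>
      refine ⟨Empty, inferInstance, Empty.elim, fun i => i.elim, fun i => i.elim, fun i => i.elim,
        fun i => i.elim, fun i => i.elim, fun y hy => ?_⟩
      exact absurd ((degenerate_zero Y).subset hy) (Set.notMem_empty y)
    | succ n =>
      refine ⟨Fin (n + 1), inferInstance, fun _ => SimplexCategory.mk n,
        fun _ => Nat.lt_succ_self n, SimplexCategory.σ, fun i => SimplexCategory.δ i.castSucc,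
        fun i => SimplexCategory.δ_comp_σ_self, h n, fun y hy => ?_⟩
      exact Set.mem_iUnion.1 ((degenerate_succ Y n).subset hy)

theorem ClosedDegeneracies.exists_continuousMap (hY : ClosedDegeneracies Y) {n : SimplexCategory}
    {A : Set (Y.obj (op n))} (hA : IsClosed A) {T Z : Type*} [TopologicalSpace T]
    [TopologicalSpace Z] (a : C(A × T, Z))
    (v : ∀ l : SimplexCategory, l.len < n.len → (n ⟶ l) → C(Y.obj (op l) × T, Z))
    (hav : ∀ l hl (r : n ⟶ l) (s : l ⟶ n) y (hy : y ∈ A) t, Y.map r.op (Y.map s.op y) = y →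
      a (⟨y, hy⟩, t) = v l hl r (Y.map s.op y, t))
    (hv : ∀ l hl p hp (r : n ⟶ l) (π : l ⟶ p) y t,
      v p hp (r ≫ π) (y, t) = v l hl r (Y.map π.op y, t)) :
    ∃ c : C((A ∪ degenerate Y n : Set _) × T, Z),
      (∀ y (hy : y ∈ A) t, c (⟨y, Or.inl hy⟩, t) = a (⟨y, hy⟩, t)) ∧
      ∀ l hl (r : n ⟶ l) y h t, c (⟨Y.map r.op y, h⟩, t) = v l hl r (y, t) := by
  have v_eq {l l' : SimplexCategory} (hl hl') (r : n ⟶ l) (r' : n ⟶ l') y y' t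
      (h : Y.map r.op y = Y.map r'.op y') : v l hl r (y, t) = v l' hl' r' (y', t) :=
    eq_of_degeneracy_eq (K := Y ⋙ CategoryTheory.forget TopCat.{u})
      (fun l hl r y => v l hl r (y, t)) (fun l hl p hp r π y => hv l hl p hp r π y t)
      hl hl' r r' y y' h
  obtain ⟨ι, hι, l, hl, r, s, hsr, hcl, hcov⟩ := hY.exists_cover n
  have map_map_eq (i y) (hy : y ∈ Set.range (Y.map (r i).op)) :
      Y.map (r i).op (Y.map (s i).op y) = y := by
    obtain ⟨y, rfl⟩ := hy
    rw [map_map Y (s i) (r i), hsr, map_id_apply]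
  let cov (i : Option ι) : Set ((A ∪ degenerate Y n : Set _) × T) :=
    i.elim {p | p.1.1 ∈ A} fun i => {p | p.1.1 ∈ Set.range (Y.map (r i).op)}
  let g : ∀ i, C(cov i, Z)
    | none => a.comp ⟨fun p => (⟨p.1.1, p.2⟩, p.1.2), by fun_prop⟩
    | some i => (v _ (hl i) (r i)).comp ⟨fun p => (Y.map (s i).op p.1.1.1, p.1.2), by fun_prop⟩
  have isClosed_cov : ∀ i, IsClosed (cov i) := by
    rintro (_ | i)
    exacts [hA.preimage (by fun_prop), (hcl i).preimage (by fun_prop)]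
  have exists_mem_cov : ∀ p, ∃ i, p ∈ cov i := by
    rintro ⟨⟨y, hy | hy⟩, t⟩
    · exact ⟨none, hy⟩
    · exact (hcov y hy).imp' some fun _ h => h
  have agree : ∀ i j p (hi : p ∈ cov i) (hj : p ∈ cov j), g i ⟨p, hi⟩ = g j ⟨p, hj⟩ := by
    rintro (_ | i) (_ | j) p hi hj
    · rfl
    · exact hav _ (hl j) (r j) (s j) _ hi _ (map_map_eq j _ hj)
    · exact (hav _ (hl i) (r i) (s i) _ hj _ (map_map_eq i _ hi)).symm
    · exact v_eq (hl i) (hl j) (r i) (r j) _ _ _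
        ((map_map_eq i _ hi).trans (map_map_eq j _ hj).symm)
  obtain ⟨c, hc⟩ :=
    exists_continuousMap_of_isClosed_cover cov isClosed_cov exists_mem_cov g agree
  refine ⟨c, fun y hy t => hc none (⟨y, Or.inl hy⟩, t) hy, fun l' hl' r' y h t => ?_⟩
  obtain ⟨i, hi⟩ := hcov (Y.map r'.op y) ⟨l', hl', r', y, rfl⟩
  rw [hc (some i) (⟨Y.map r'.op y, h⟩, t) hi]
  exact v_eq (hl i) hl' (r i) r' _ _ t (map_map_eq i _ hi)

end SimplicialSpace

section

open SimplicialSpace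

variable {Q : SupportedCosimplicial.{u}} {Y : SimplicialObject TopCat.{u}} {Z : Type u}
  [TopologicalSpace Z]

theorem NatBelow.val_apply {n : ℕ}
    {f : ∀ l : SimplexCategory, l.len < n → (Q.functor.obj l ⟶ (sing Y Z).obj l)}
    (hf : NatBelow n f) {l l' : SimplexCategory} (hl : l.len < n) (hl' : l'.len < n) (α : l ⟶ l')
    {d : SimplexCategoryᵒᵖ} (m : (Q.functor.obj l).obj d) (y : Y.obj (op l'))
    (t : stdSimplex ℝ (Fin (d.unop.len + 1))) :
    Sing.val ((f l' hl').app d ((Q.functor.map α).app d m)) (y, t) =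
      Sing.val ((f l hl).app d m) (Y.map α.op y, t) :=
  congrArg (fun s => Sing.val s (y, t)) (hf.apply hl hl' α m)

theorem image_len_lt_of_not_isIso {l : SimplexCategory} (α : l ⟶ l) (hα : ¬ IsIso α) :
    (Limits.image α).len < l.len := by
  refine (SimplexCategory.len_le_of_mono (Limits.image.ι α)).lt_of_ne fun hlen => hα ?_
  have : IsIso (Limits.image.ι α) := SimplexCategory.isIso_of_bijective
    ((Fintype.bijective_iff_injective_and_card _).2
      ⟨SimplexCategory.mono_iff_injective.1 inferInstance, by simp [hlen]⟩)
  have : IsIso (Limits.factorThruImage α) := SimplexCategory.isIso_of_bijective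
    ((Fintype.bijective_iff_surjective_and_card _).2
      ⟨SimplexCategory.epi_iff_surjective.1 inferInstance, by simp [hlen]⟩)
  rw [← Limits.image.fac α]
  infer_instance

theorem natBelow_of_lt {S : SimplexCategory ⥤ SSet.{u}} {n : ℕ}
    {f : ∀ l : SimplexCategory, l.len < n → (Q.functor.obj l ⟶ S.obj l)}
    (h : ∀ m (hm : m.len < n) l (hl : l.len < m.len) (α : l ⟶ m),
      Q.functor.map α ≫ f m hm = f l (hl.trans hm) ≫ S.map α)
    (h' : ∀ m (hm : m.len < n) l (hl : l.len < m.len) (α : m ⟶ l),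
      Q.functor.map α ≫ f l (hl.trans hm) = f m hm ≫ S.map α) : NatBelow n f := by
  intro l l' hl hl' α
  rcases lt_trichotomy l.len l'.len with hlt | heq | hlt
  · exact h l' hl' l hlt α
  · obtain rfl : l = l' := SimplexCategory.ext heq
    by_cases hα : IsIso α
    · rw [SimplexCategory.eq_id_of_isIso α, Q.functor.map_id, S.map_id, Category.id_comp,
        Category.comp_id]
    · have hlt := image_len_lt_of_not_isIso α hα
      rw [← Limits.image.fac α, Q.functor.map_comp, S.map_comp, Category.assoc, h l hl _ hlt,
        ← Category.assoc, h' l hl _ hlt, Category.assoc]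
  · exact h' l hl l' hlt α

/-- A natural family of maps into `sing Y Z` which is defined on subobjects `P` of the simplicial
sets `Q` only, together with values of all of `Q` on subspaces `A` of `Y`. -/
structure PartialFamily (Q : SupportedCosimplicial.{u}) (Y : SimplicialObject TopCat.{u})
    (Z : Type u) [TopologicalSpace Z] where
  P : ∀ k, (Q.functor.obj k).Subcomplex
  push_mem : ∀ {k l : SimplexCategory} (α : k ⟶ l) d (m : (Q.functor.obj k).obj d),
    m ∈ (P k).obj d → (Q.functor.map α).app d m ∈ (P l).obj d
  A : ∀ k, Set (Y.obj (op k))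
  map_mem : ∀ {k l : SimplexCategory} (α : k ⟶ l) y, y ∈ A l → Y.map α.op y ∈ A k
  fP : ∀ k, (P k).toSSet ⟶ (sing Y Z).obj k
  fA : ∀ k, Q.functor.obj k ⟶ Sing (A k) Z
  fP_push : ∀ {k l : SimplexCategory} (α : k ⟶ l) d (m : (Q.functor.obj k).obj d)
    (hm : m ∈ (P k).obj d),
    (fP l).app d ⟨_, push_mem α d m hm⟩ = ((sing Y Z).map α).app d ((fP k).app d ⟨m, hm⟩)
  fA_push : ∀ {k l : SimplexCategory} (α : k ⟶ l) d (m : (Q.functor.obj k).obj d) y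
    (hy : y ∈ A l) t, Sing.val ((fA l).app d ((Q.functor.map α).app d m)) (⟨y, hy⟩, t) =
      Sing.val ((fA k).app d m) (⟨_, map_mem α y hy⟩, t)
  fP_eq_fA : ∀ k d m (hm : m ∈ (P k).obj d) y (hy : y ∈ A k) t,
    Sing.val ((fP k).app d ⟨m, hm⟩) (y, t) = Sing.val ((fA k).app d m) (⟨y, hy⟩, t)

namespace PartialFamily

variable (D : PartialFamily Q Y Z)

/-- The property of a map in cosimplicial degree `k` to extend a partial family. -/
structure Extends {k : SimplexCategory} (g : Q.functor.obj k ⟶ (sing Y Z).obj k) : Prop where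
  eq_fP : ∀ d m (hm : m ∈ (D.P k).obj d), g.app d m = (D.fP k).app d ⟨m, hm⟩
  eq_fA : ∀ d m y (hy : y ∈ D.A k) t,
    Sing.val (g.app d m) (y, t) = Sing.val ((D.fA k).app d m) (⟨y, hy⟩, t)

variable {D} {n : SimplexCategory}
  {f : ∀ l : SimplexCategory, l.len < n.len → (Q.functor.obj l ⟶ (sing Y Z).obj l)}

theorem exists_degenerate (hf : NatBelow n.len f) (hfD : ∀ l hl, D.Extends (f l hl))
    (hY : ClosedDegeneracies Y) (hA : IsClosed (D.A n)) :
    ∃ c : Q.functor.obj n ⟶ Sing (D.A n ∪ degenerate Y n : Set _) Z,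
      (∀ d (m : (Q.functor.obj n).obj d) y (hy : y ∈ D.A n) t,
        Sing.val (c.app d m) (⟨y, Or.inl hy⟩, t) = Sing.val ((D.fA n).app d m) (⟨y, hy⟩, t)) ∧
      ∀ l (hl : l.len < n.len) (r : n ⟶ l) d (m : (Q.functor.obj n).obj d) y h t,
        Sing.val (c.app d m) (⟨Y.map r.op y, h⟩, t) =
          Sing.val ((f l hl).app d ((Q.functor.map r).app d m)) (y, t) := by
  have exists_map d (m : (Q.functor.obj n).obj d) := hY.exists_continuousMap hA
    (Sing.val ((D.fA n).app d m))
    (fun l hl r => Sing.val ((f l hl).app d ((Q.functor.map r).app d m)))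
    (fun l hl r s y hy t h => by
      rw [(hfD l hl).eq_fA _ _ _ (D.map_mem s y hy), D.fA_push r]
      simp only [h])
    (fun l hl p hp r π y t => by
      rw [← hf.val_apply hl hp π, SupportedCosimplicial.push_push])
  choose c hcA hc using exists_map
  refine ⟨ssetHomMk (fun d m => Sing.mk (c d m)) fun {d d'} θ m => Sing.ext ?_, hcA,
    fun l hl r d m y h t => hc d m l hl r y h t⟩
  rintro ⟨y, hy⟩ t
  rw [Sing.val_map]
  change c d' _ _ = c d m _
  rcases hy with hy | ⟨l, hl, r, y, rfl⟩
  · rw [hcA _ _ y hy, hcA _ _ y hy, Sing.val_app_map]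
  · refine (hc d' _ l hl r y _ t).trans (Eq.trans ?_ (hc d m l hl r y _ _).symm)
    rw [sset_app_map (Q.functor.map r) θ m]
    exact Sing.val_app_map (f l hl) θ _ y t

theorem exists_extension_sup_bd (hf : NatBelow n.len f) (hfD : ∀ l hl, D.Extends (f l hl)) :
    ∃ b : (D.P n ⊔ Q.bd n).toSSet ⟶ (sing Y Z).obj n,
      (∀ d m (hm : m ∈ (D.P n).obj d), b.app d ⟨m, Or.inl hm⟩ = (D.fP n).app d ⟨m, hm⟩) ∧
      ∀ l (hl : l.len < n.len) (α : l ⟶ n) d (m : (Q.functor.obj l).obj d) h,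
        b.app d ⟨(Q.functor.map α).app d m, h⟩ = ((sing Y Z).map α).app d ((f l hl).app d m) := by
  obtain ⟨b, hb⟩ := hf.exists_bd
  obtain ⟨k, hkP, hkb⟩ := exists_glue_subcomplex (D.P n) (Q.bd n) (D.fP n) b fun d m hP hbd => by
    obtain ⟨l, hl, i, r, h⟩ := SupportedCosimplicial.exists_push_eq_of_mem_bd hbd
    have hr := D.push_mem r d m hP
    calc (D.fP n).app d ⟨m, hP⟩
        = (D.fP n).app d ⟨_, D.push_mem i d _ hr⟩ := by simp only [h]
      _ = b.app d ⟨_, SupportedCosimplicial.push_mem_bd hl i _⟩ := by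
        rw [hb l hl, D.fP_push i d _ hr, (hfD l hl).eq_fP _ _ hr]
      _ = b.app d ⟨m, hbd⟩ := by simp only [h]
  exact ⟨k, hkP, fun l hl α d m _ =>
    (hkb d _ (SupportedCosimplicial.push_mem_bd hl α m)).trans (hb l hl α d m _)⟩

theorem exists_extension_step (hf : NatBelow n.len f) (hfD : ∀ l hl, D.Extends (f l hl))
    (hP : SSet.anodyneExtensions (D.P n ⊔ Q.bd n).ι) (hY : ClosedDegeneracies Y)
    (N : NDR (Y.obj (op n)) (D.A n ∪ degenerate Y n)) (hA : IsClosed (D.A n)) :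
    ∃ g : Q.functor.obj n ⟶ (sing Y Z).obj n,
      (∀ l (hl : l.len < n.len) (α : l ⟶ n),
        Q.functor.map α ≫ g = f l hl ≫ (sing Y Z).map α) ∧
      (∀ l (hl : l.len < n.len) (α : n ⟶ l),
        Q.functor.map α ≫ f l hl = g ≫ (sing Y Z).map α) ∧ D.Extends g := by
  obtain ⟨b, hbP, hb⟩ := exists_extension_sup_bd hf hfD
  obtain ⟨c, hcA, hc⟩ := exists_degenerate hf hfD hY hA
  have b_eq_c (d m hm) (y : Y.obj (op n)) hy t :
      Sing.val (b.app d ⟨m, hm⟩) (y, t) = Sing.val (c.app d m) (⟨y, hy⟩, t) := by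
    obtain hmP | hm := hm
    · rw [hbP d m hmP]
      obtain hy | ⟨l, hl, r, y, rfl⟩ := hy
      · rw [hcA d m y hy, D.fP_eq_fA]
      · refine Eq.trans ?_ (hc l hl r d m y _ t).symm
        rw [(hfD l hl).eq_fP _ _ (D.push_mem r d m hmP), D.fP_push r d m hmP]
        rfl
    · obtain ⟨l, hl, i, r, h⟩ := SupportedCosimplicial.exists_push_eq_of_mem_bd hm
      generalize (Q.functor.map r).app d m = x at h
      subst h
      refine (congrArg (fun s => Sing.val s (y, t)) (hb l hl i d x _)).trans ?_
      change Sing.val ((f l hl).app d x) (Y.map i.op y, t) = _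
      obtain hy | ⟨p, hp, e, y, rfl⟩ := hy
      · rw [hcA d _ y hy, D.fA_push i, (hfD l hl).eq_fA _ _ _ (D.map_mem i y hy)]
      · refine Eq.trans ?_ (hc p hp e d _ y _ t).symm
        rw [SupportedCosimplicial.push_push, map_map, hf.val_apply hl hp]
  have := N.fibration Z
  obtain ⟨g, hgb, hgc⟩ := exists_lift_of_anodyneExtensions hP
    (Sing.restr Z (⟨Subtype.val, continuous_subtype_val⟩ :
      C((D.A n ∪ degenerate Y n : Set (Y.obj (op n))), Y.obj (op n)))) b c
    (sset_hom_ext fun d m => Sing.ext fun y t => b_eq_c d m.1 m.2 y.1 y.2 t)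
  replace hgb d m hm : g.app d m = b.app d ⟨m, hm⟩ := congrArg (fun q => q.app d ⟨m, hm⟩) hgb
  replace hgc d m y hy t : Sing.val (g.app d m) (y, t) = Sing.val (c.app d m) (⟨y, hy⟩, t) :=
    congrArg (fun q => Sing.val (q.app d m) (⟨y, hy⟩, t)) hgc
  refine ⟨g, fun l hl α => sset_hom_ext fun d m => ?_,
    fun l hl α => sset_hom_ext fun d m => Sing.ext fun y t => ?_,
    fun d m hm => (hgb d m (Or.inl hm)).trans (hbP d m hm),
    fun d m y hy t => (hgc d m y (Or.inl hy) t).trans (hcA d m y hy t)⟩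
  · exact (hgb d _ (Or.inr (SupportedCosimplicial.push_mem_bd hl α m))).trans (hb l hl α d m _)
  · exact ((hgc d m _ (Or.inr ⟨l, hl, α, y, rfl⟩) t).trans (hc l hl α d m y _ t)).symm

theorem exists_extension (D : PartialFamily Q Y Z)
    (hP : ∀ k, SSet.anodyneExtensions (D.P k ⊔ Q.bd k).ι) (hY : ClosedDegeneracies Y)
    (N : ∀ k, NDR (Y.obj (op k)) (D.A k ∪ degenerate Y k)) (hA : ∀ k, IsClosed (D.A k)) :
    ∃ F : Q.functor ⟶ sing Y Z, ∀ k, D.Extends (F.app k) := by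
  obtain ⟨F, hF⟩ := exists_dependent_family (r := fun k l : SimplexCategory => k.len < l.len)
    (measure SimplexCategory.len).wf lt_trans
    (T := fun k => Q.functor.obj k ⟶ (sing Y Z).obj k)
    (fun n f g =>
      (∀ (l : SimplexCategory) (hl : l.len < n.len) (α : l ⟶ n),
        Q.functor.map α ≫ g = f l hl ≫ (sing Y Z).map α) ∧
      (∀ (l : SimplexCategory) (hl : l.len < n.len) (α : n ⟶ l),
        Q.functor.map α ≫ f l hl = g ≫ (sing Y Z).map α) ∧ D.Extends g)
    fun n f h => exists_extension_step
      (natBelow_of_lt (fun m hm => (h m hm).1) fun m hm => (h m hm).2.1)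
      (fun l hl => (h l hl).2.2) (hP n) hY (N n) (hA n)
  refine ⟨⟨F, fun k l α => ?_⟩, fun k => (hF k).2.2⟩
  exact natBelow_of_lt (n := max k.len l.len + 1) (f := fun l _ => F l)
    (fun m _ => (hF m).1) (fun m _ => (hF m).2.1) k l (by omega) (by omega) α

end PartialFamily

end

/-! ### Degeneracies of bar constructions -/

/-- The set of identities in the space of morphisms of a category. -/
def Mor.identities (C : Type u) [Category.{v} C] : Set (Mor C) :=
  Set.range fun a : C => Mor.mk (𝟙 a)

section

variable {C : Type u} [Category.{v} C]

theorem Mor.mk_mem_identities {a b : C} (f : a ⟶ b) :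
    Mor.mk f ∈ Mor.identities C ↔ ∃ h : a = b, f = eqToHom h := by
  constructor
  · rintro ⟨c, hc⟩
    obtain ⟨rfl, h⟩ := Mor.mk.inj hc
    obtain ⟨rfl, h⟩ := h
    exact ⟨rfl, (eq_of_heq h).symm⟩
  · rintro ⟨rfl, rfl⟩
    exact ⟨a, rfl⟩

theorem Mor.mk_eq_of_comp_eq {a b c d : C} {f : a ⟶ b} {g : b ⟶ d} {f' : a ⟶ c} {g' : c ⟶ d}
    (h : f ≫ g = f' ≫ g') (hg : Mor.mk g ∈ Mor.identities C)
    (hf' : Mor.mk f' ∈ Mor.identities C) : Mor.mk f = Mor.mk g' := by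
  obtain ⟨rfl, rfl⟩ := (Mor.mk_mem_identities _).1 hg
  obtain ⟨rfl, rfl⟩ := (Mor.mk_mem_identities _).1 hf'
  simpa using h

theorem Mor.mk_eqToHom_comp (f : Mor C) {a b : C} (ha : a = f.source) (hb : f.target = b) :
    Mor.mk (eqToHom ha ≫ f.hom ≫ eqToHom hb) = f := by
  subst ha hb
  simp

theorem Mor.eq_eqToHom_comp {a b c d : C} {f : a ⟶ b} {g : c ⟶ d} (h : Mor.mk f = Mor.mk g)
    (ha : a = c) (hb : d = b) : f = eqToHom ha ≫ g ≫ eqToHom hb := by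
  subst ha hb
  simpa using h

theorem composableArrows_ext_mor {n : ℕ} {F G : ComposableArrows C n} (h₀ : F.obj 0 = G.obj 0)
    (h : ∀ i : Fin n, Mor.mk (F.map (homOfLE i.castSucc_le_succ)) =
      Mor.mk (G.map (homOfLE i.castSucc_le_succ))) : F = G := by
  have hobj (i) : F.obj i = G.obj i := by
    induction i using Fin.cases with
    | zero => exact h₀
    | succ i => exact congrArg Mor.target (h i)
  exact ComposableArrows.ext hobj fun i hi => Mor.eq_eqToHom_comp (h ⟨i, hi⟩) _ _

end

section

open unitInterval

theorem exists_continuousMap_isLUB {X K : Type*} [TopologicalSpace X] [TopologicalSpace K]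
    [CompactSpace K] [Nonempty K] (w : C(X × K, ℝ)) :
    ∃ u : C(X, ℝ), ∀ x, IsLUB (Set.range fun s => w (x, s)) (u x) := by
  refine ⟨⟨fun x => sSup ((fun s => w (x, s)) '' Set.univ),
    isCompact_univ.continuous_sSup w.continuous⟩, fun x => ?_⟩
  rw [← Set.image_univ]
  have bdd : BddAbove ((fun s => w (x, s)) '' Set.univ) :=
    (isCompact_univ.image (by fun_prop)).bddAbove
  exact isLUB_csSup (Set.univ_nonempty.image _) bdd

theorem exists_continuousMap_isLeast {ι X : Type*} [Finite ι] [Nonempty ι] [TopologicalSpace X]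
    (a : ι → C(X, ℝ)) : ∃ w : C(X, ℝ), ∀ x, IsLeast (Set.range fun i => a i x) (w x) := by
  have := Fintype.ofFinite ι
  have hne : (Finset.univ : Finset ι).Nonempty := Finset.univ_nonempty
  refine ⟨⟨fun x => Finset.univ.inf' hne fun i => a i x,
    Continuous.finset_inf'_apply hne fun i _ => (a i).continuous⟩, fun x => ⟨?_, ?_⟩⟩
  · obtain ⟨i, -, hi⟩ := Finset.exists_mem_eq_inf' hne fun i => a i x
    exact ⟨i, hi.symm⟩
  · rintro _ ⟨i, rfl⟩
    exact Finset.inf'_le _ (Finset.mem_univ i)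

theorem NDR.exists_of_retraction {X : Type u} [TopologicalSpace X] {L : Set X} (hL : IsClosed L)
    (r : C(X × I, X × I)) (hr_zero : ∀ x, r (x, 0) = (x, 0))
    (hr_of_mem : ∀ x ∈ L, ∀ s, r (x, s) = (x, s)) (hr : ∀ p, (r p).2 = 0 ∨ (r p).1 ∈ L) :
    ∃ N : NDR X L, ∀ x s, N.h (x, s) = (r (x, Set.projIcc 0 1 zero_le_one s)).1 := by
  obtain ⟨u, hu⟩ := exists_continuousMap_isLUB
    (⟨fun p => (p.2 : ℝ) - (r p).2, by fun_prop⟩ : C(X × I, ℝ))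
  have le_u x (s : I) : (s : ℝ) - (r (x, s)).2 ≤ u x := (hu x).1 ⟨s, rfl⟩
  have u_nonneg x : 0 ≤ u x := by simpa [hr_zero] using le_u x 0
  have retraction_mem x (s : I) (h : u x < s) : (r (x, s)).1 ∈ L := by
    refine (hr _).resolve_left fun h0 => h.not_ge ?_
    simpa [h0] using le_u x s
  have u_eq_zero x (hx : x ∈ L) : u x = 0 := by
    refine le_antisymm ((isLUB_le_iff (hu x)).2 ?_) (u_nonneg x)
    rintro _ ⟨s, rfl⟩
    simp [hr_of_mem x hx s]
  have mem_of_u_eq_zero x (hx : u x = 0) : x ∈ L := by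
    have : (nhdsWithin (0 : I) (Set.Ioi 0)).NeBot := nhdsGT_neBot_of_exists_gt ⟨1, zero_lt_one⟩
    have h : Filter.Tendsto (fun s : I => (r (x, s)).1) (nhds 0) (nhds (r (x, 0)).1) :=
      Continuous.tendsto (by fun_prop) 0
    rw [hr_zero] at h
    refine hL.mem_of_tendsto (b := nhdsWithin 0 (Set.Ioi 0)) (h.mono_left nhdsWithin_le_nhds) ?_
    filter_upwards [self_mem_nhdsWithin] with s hs
    exact retraction_mem x s (hx.trans_lt hs)
  refine ⟨⟨⟨fun x => 2 * u x, by fun_prop⟩,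
    ⟨fun p => (r (p.1, Set.projIcc 0 1 zero_le_one p.2)).1, by fun_prop⟩,
    fun x => mul_nonneg zero_le_two (u_nonneg x), fun x => ⟨fun hx => ?_, fun hx => ?_⟩,
    fun x => ?_, fun x hx s => ?_, fun x s h1 hs => ?_⟩, fun _ _ => rfl⟩
  · simp [u_eq_zero x hx]
  · exact mem_of_u_eq_zero x (by simpa using hx)
  · simp only [ContinuousMap.coe_mk, Set.projIcc_left]
    exact congrArg Prod.fst (hr_zero x)
  · exact congrArg Prod.fst (hr_of_mem x hx _)
  · simp only [ContinuousMap.coe_mk] at h1 hs ⊢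
    obtain h0 | hpos := (u_nonneg x).eq_or_lt
    · have hx := mem_of_u_eq_zero x h0.symm
      rwa [hr_of_mem x hx]
    · refine retraction_mem x _ ?_
      rw [Set.coe_projIcc]
      exact lt_max_of_lt_right (lt_min (by linarith) (by linarith))

theorem TopologicalCategory.IdentityIsCofibration.exists_ndr {A : TopologicalCategory.{u, u}}
    (hA : A.IdentityIsCofibration) : ∃ N : NDR A.mor (Mor.identities A.ob),
      (∀ f s, (N.h (f, s)).source = f.source) ∧ (∀ f s, (N.h (f, s)).target = f.target) ∧
        ∀ f s, s ≤ 0 → N.h (f, s) = f := by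
  let Z : Type u := {p : A.mor × I // p.2 = 0 ∨ p.1 ∈ Mor.identities A.ob}
  have continuous_source_target : Continuous fun f : A.mor => (f.source, f.target) :=
    A.continuous_source.prodMk A.continuous_target
  obtain ⟨H, hH, hH_zero, hH_id⟩ := hA.extension Z
    ⟨fun p => (p.1.1.source, p.1.1.target),
      continuous_source_target.comp (continuous_fst.comp continuous_subtype_val)⟩
    ⟨fun f => ⟨(f, 0), Or.inl rfl⟩, (_root_.continuous_id.prodMk continuous_const).subtype_mk _⟩
    ⟨fun p => ⟨(Mor.mk (𝟙 p.1), p.2), Or.inr ⟨p.1, rfl⟩⟩,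
      ((A.continuous_id.comp continuous_fst).prodMk continuous_snd).subtype_mk _⟩
    (fun _ => rfl) (fun _ _ => rfl) (fun _ => rfl)
  have r_zero f : (H (f, 0)).1 = (f, 0) := congrArg Subtype.val (hH_zero f)
  have r_id : ∀ f ∈ Mor.identities A.ob, ∀ s, (H (f, s)).1 = (f, s) := by
    rintro _ ⟨a, rfl⟩ s
    exact congrArg Subtype.val (hH_id a s)
  obtain ⟨N, hN⟩ := NDR.exists_of_retraction hA.isClosed_range
    ⟨fun p => (H p).1, continuous_subtype_val.comp H.continuous⟩ r_zero r_id fun p => (H p).2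
  refine ⟨N, fun f s => ?_, fun f s => ?_, fun f s hs => ?_⟩
  · rw [hN]
    exact congrArg Prod.fst (hH f _)
  · rw [hN]
    exact congrArg Prod.snd (hH f _)
  · rw [hN, Set.projIcc_of_le_left _ hs]
    exact congrArg Prod.fst (r_zero f)

end

namespace CatWithModule.BarSimplex

section

variable {P : CatWithModule.{v, u}} {n : ℕ}

/-- The `i`-th arrow of the chain. -/
abbrev spine (z : BarSimplex P n) (i : Fin n) : P.A.mor :=
  z.arrow i.castSucc i.succ i.castSucc_le_succ

theorem ext_toProd {z w : BarSimplex P n} (h : z.toProd = w.toProd) : z = w := by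
  have hpt : z.pt = w.pt := congrArg Prod.snd h
  have hobj : z.chain.obj 0 = w.chain.obj 0 := by rw [z.eq, w.eq, hpt]
  exact ext' (composableArrows_ext_mor hobj fun i => congrFun (congrArg Prod.fst h) i) hpt

theorem arrow_mem_identities (z : BarSimplex P n) {i j : Fin (n + 1)} (h : i ≤ j) (hij : i = j) :
    z.arrow i j h ∈ Mor.identities _ := by
  subst hij
  exact ⟨z.chain.obj i, congrArg Mor.mk (z.chain.map_id i).symm⟩

theorem pull_eq_self (z : BarSimplex P n) (e : Fin (n + 1) →o Fin (n + 1)) (he : ∀ j, e j ≤ j)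
    (h : ∀ j, z.arrow (e j) j (he j) ∈ Mor.identities _) : pull e z = z := by
  refine ext_toProd (Prod.ext (funext fun i => ?_) ?_)
  · refine Mor.mk_eq_of_comp_eq (f := z.chain.map (homOfLE (e.monotone i.castSucc_le_succ))) ?_
      (h i.succ) (h i.castSucc)
    rw [← Functor.map_comp, ← Functor.map_comp]
    rfl
  · exact act_map_self z _ (le_antisymm (he 0) (Fin.zero_le _)) _

theorem range_pull_σ (i : Fin (n + 1)) :
    Set.range (pull (P := P) (SimplexCategory.σ i).toOrderHom) =
      {z : BarSimplex P (n + 1) | z.spine i ∈ Mor.identities _} := by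
  refine Set.Subset.antisymm ?_ fun z hz =>
    ⟨pull (SimplexCategory.δ i.succ).toOrderHom z, ?_⟩
  · rintro _ ⟨y, rfl⟩
    exact y.arrow_mem_identities
      ((SimplexCategory.σ i).toOrderHom.monotone i.castSucc_le_succ)
      ((Fin.predAbove_castSucc_self i).trans (Fin.predAbove_succ_self i).symm)
  · let e := (SimplexCategory.δ i.succ).toOrderHom.comp (SimplexCategory.σ i).toOrderHom
    have e_succ : e i.succ = i.castSucc := by
      change i.succ.succAbove (i.predAbove i.succ) = _
      rw [Fin.predAbove_succ_self, Fin.succAbove_succ_self]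
    have e_of_ne j (hj : j ≠ i.succ) : e j = j := Fin.succ_succAbove_predAbove hj
    have e_le j : e j ≤ j := by
      obtain rfl | hj := eq_or_ne j i.succ
      exacts [e_succ.trans_le i.castSucc_le_succ, (e_of_ne j hj).le]
    rw [← pull_comp]
    refine pull_eq_self z e e_le fun j => ?_
    obtain rfl | hj := eq_or_ne j i.succ
    · have (a) (ha : a ≤ i.succ) (h : a = i.castSucc) : z.arrow a i.succ ha ∈ Mor.identities _ := by
        subst h
        exact hz
      exact this _ _ e_succ
    · exact z.arrow_mem_identities _ (e_of_ne j hj)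

section

variable (g : P.A.mor → P.A.mor) (hs : ∀ f, (g f).source = f.source)
  (ht : ∀ f, (g f).target = f.target)

/-- Replacement of the arrows of a chain by arrows with the same sources and targets. -/
noncomputable def replace (z : BarSimplex P n) : BarSimplex P n where
  chain := ComposableArrows.mkOfObjOfMapSucc z.chain.obj fun i =>
    eqToHom (hs (z.spine i)).symm ≫ (g (z.spine i)).hom ≫ eqToHom (ht (z.spine i))
  pt := z.pt
  eq := z.eq

theorem spine_replace (z : BarSimplex P n) (i : Fin n) :
    (replace g hs ht z).spine i = g (z.spine i) :=
  (congrArg Mor.mk (ComposableArrows.mkOfObjOfMapSucc_map_succ z.chain.obj (fun i =>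
    eqToHom (hs (z.spine i)).symm ≫ (g (z.spine i)).hom ≫ eqToHom (ht (z.spine i))) i.1 i.2)).trans
    (Mor.mk_eqToHom_comp _ _ _)

theorem toProd_replace (z : BarSimplex P n) :
    (replace g hs ht z).toProd = (fun i => g (z.spine i), z.pt) :=
  Prod.ext (funext fun i => spine_replace g hs ht z i) rfl

end

theorem continuous_replace {T : Type*} [TopologicalSpace T] {g : T → P.A.mor → P.A.mor}
    (hs : ∀ t f, (g t f).source = f.source) (ht : ∀ t f, (g t f).target = f.target)
    {z : T → BarSimplex P n} (hz : Continuous z)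
    (hg : ∀ i, Continuous fun t => g t ((z t).spine i)) :
    Continuous fun t => replace (g t) (hs t) (ht t) (z t) := by
  refine continuous_induced_rng.2 (Continuous.congr ?_ fun t => (toProd_replace _ _ _ _).symm)
  exact (continuous_pi hg).prodMk (continuous_pt.comp hz)

end

theorem exists_ndr {P : CatWithModule.{u, u}} (hA : P.A.IdentityIsCofibration) (n : ℕ) :
    Nonempty (NDR (BarSimplex P n) {z | ∃ i, z.spine i ∈ Mor.identities _}) := by
  obtain ⟨N, hs, ht, h_nonpos⟩ := hA.exists_ndr
  obtain ⟨w, hw⟩ := exists_continuousMap_isLeast fun i : Option (Fin n) =>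
    i.elim (1 : C(BarSimplex P n, ℝ)) fun i => N.u.comp ⟨fun z => z.spine i, continuous_spine i⟩
  have w_nonneg z : 0 ≤ w z := by
    obtain ⟨_ | i, hi⟩ := (hw z).1
    exacts [zero_le_one.trans_eq hi, (N.u_nonneg _).trans_eq hi]
  have w_le z i : w z ≤ N.u (z.spine i) := (hw z).2 ⟨some i, rfl⟩
  have exists_eq_w z (hz : w z < 1) : ∃ i, N.u (z.spine i) = w z := by
    obtain ⟨_ | i, hi⟩ := (hw z).1
    exacts [absurd hi hz.ne', ⟨i, hi⟩]
  have exists_mem_iff z : (∃ i, z.spine i ∈ Mor.identities _) ↔ w z = 0 := by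
    constructor
    · rintro ⟨i, hi⟩
      exact le_antisymm ((w_le z i).trans ((N.mem_iff _).1 hi).le) (w_nonneg z)
    · intro hz
      obtain ⟨i, hi⟩ := exists_eq_w z (hz.trans_lt zero_lt_one)
      exact ⟨i, (N.mem_iff _).2 (hi.trans hz)⟩
  let h (p : BarSimplex P n × ℝ) : BarSimplex P n :=
    replace (fun f => N.h (f, min p.2 (w p.1))) (fun f => hs f _) (fun f => ht f _) p.1
  have continuous_h : Continuous h := continuous_replace _ _ continuous_fst fun i =>
    N.h.continuous.comp (((continuous_spine i).comp continuous_fst).prodMk (by fun_prop))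
  have h_of_nonpos z s (hsz : min s (w z) ≤ 0) : h (z, s) = z :=
    ext_toProd ((toProd_replace _ _ _ _).trans
      (Prod.ext (funext fun i => h_nonpos _ _ hsz) rfl))
  refine ⟨⟨w, ⟨h, continuous_h⟩, w_nonneg, exists_mem_iff,
    fun z => h_of_nonpos z 0 (min_le_left _ _),
    fun z hz s => h_of_nonpos z s ((min_le_right _ _).trans ((exists_mem_iff z).1 hz).le),
    fun z s h1 hzs => ?_⟩⟩
  obtain ⟨i, hi⟩ := exists_eq_w z h1
  refine ⟨i, ?_⟩
  change (replace _ _ _ z).spine i ∈ _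
  rw [spine_replace]
  exact N.h_mem _ _ (hi.trans_lt h1) (hi.trans_le (le_min hzs le_rfl))

end CatWithModule.BarSimplex

namespace SimplicialSpace

section

open CatWithModule

theorem closedDegeneracies_bar {P : CatWithModule.{u, u}} (hA : P.A.IdentityIsCofibration) :
    ClosedDegeneracies (bar.obj P) := fun _ i =>
  (BarSimplex.range_pull_σ (P := P) i).symm ▸
    (hA.isClosed_range : IsClosed (Mor.identities _)).preimage (BarSimplex.continuous_spine i)

theorem degenerate_bar (P : CatWithModule.{u, u}) (n : SimplexCategory) :
    degenerate (bar.obj P) n =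
      {z : BarSimplex P n.len | ∃ i, z.spine i ∈ Mor.identities _} := by
  induction n using SimplexCategory.rec with
  | _ n =>
    cases n with
    | zero =>
      rw [degenerate_zero]
      refine (Set.eq_empty_of_forall_notMem ?_).symm
      rintro z ⟨i, _⟩
      exact i.elim0
    | succ n =>
      rw [degenerate_succ]
      refine (Set.iUnion_congr fun i => BarSimplex.range_pull_σ (P := P) i).trans ?_
      exact (Set.ofPred_exists _).symm

theorem exists_ndr_bar {P : CatWithModule.{u, u}} (hA : P.A.IdentityIsCofibration)
    (n : SimplexCategory) : Nonempty (NDR ((bar.obj P).obj (op n)) (degenerate (bar.obj P) n)) := by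
  rw [degenerate_bar]
  exact BarSimplex.exists_ndr hA n.len

end

section

variable (Y : SimplicialObject TopCat.{u}) (J : Type) [TopologicalSpace J]

/-- The product of a simplicial space with a space. -/
def prodConst : SimplicialObject TopCat.{u} where
  obj n := TopCat.of (Y.obj n × J)
  map θ := TopCat.ofHom ⟨fun p => (Y.map θ p.1, p.2),
    ((Y.map θ).hom.continuous.comp continuous_fst).prodMk continuous_snd⟩
  map_id n := by
    refine TopCat.hom_ext (ContinuousMap.ext fun p => Prod.ext ?_ rfl)
    change Y.map (𝟙 n) p.1 = p.1
    simp
  map_comp f g := by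
    refine TopCat.hom_ext (ContinuousMap.ext fun p => Prod.ext ?_ rfl)
    change Y.map (f ≫ g) p.1 = Y.map g (Y.map f p.1)
    simp

variable {Y}

theorem mem_range_prodConst_map {k l : SimplexCategory} (f : k ⟶ l) (p : Y.obj (op k) × J) :
    p ∈ Set.range ((prodConst Y J).map f.op) ↔ p.1 ∈ Set.range (Y.map f.op) :=
  ⟨fun ⟨x, hx⟩ => ⟨x.1, congrArg Prod.fst hx⟩, fun ⟨x, hx⟩ => ⟨(x, p.2), Prod.ext hx rfl⟩⟩

theorem mem_degenerate_prodConst {n : SimplexCategory} (p : Y.obj (op n) × J) :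
    p ∈ degenerate (prodConst Y J) n ↔ p.1 ∈ degenerate Y n :=
  exists_congr fun _ => and_congr_right fun _ => exists_congr fun f =>
    mem_range_prodConst_map J f p

theorem ClosedDegeneracies.prodConst (hY : ClosedDegeneracies Y) :
    ClosedDegeneracies (prodConst Y J) := by
  intro n i
  have h : IsClosed {p : Y.obj _ × J | p.1 ∈ Set.range (Y.map (SimplexCategory.σ i).op)} :=
    (hY n i).preimage continuous_fst
  exact (Set.ext (mem_range_prodConst_map J (SimplexCategory.σ i))).symm ▸ h

end

end SimplicialSpace

section

open unitInterval

theorem NDR.exists_prod {X : Type u} {J : Type*} [TopologicalSpace X] [TopologicalSpace J]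
    {L : Set X} {J₀ : Set J} (N : NDR X L) (M : NDR J J₀) :
    Nonempty (NDR (X × J) {p | p.2 ∈ J₀ ∨ p.1 ∈ L}) := by
  let w : C(X × J, ℝ) := ⟨fun p => min (N.u p.1) (M.u p.2), by fun_prop⟩
  have w_nonneg p : 0 ≤ w p := le_min (N.u_nonneg _) (M.u_nonneg _)
  let τ (p : X × J) (s : ℝ) : ℝ := max 0 (min s (w p))
  have mem_iff (p : X × J) : (p.2 ∈ J₀ ∨ p.1 ∈ L) ↔ w p = 0 := by
    rw [M.mem_iff, N.mem_iff]
    constructor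
    · rintro (h | h)
      · exact (congrArg _ h).trans (min_eq_right (N.u_nonneg _))
      · exact (congrArg (min · _) h).trans (min_eq_left (M.u_nonneg _))
    · intro h
      rcases min_choice (N.u p.1) (M.u p.2) with h' | h'
      · exact Or.inr (h'.symm.trans h)
      · exact Or.inl (h'.symm.trans h)
  have h_fix p s (h : min s (w p) ≤ 0) : (N.h (p.1, τ p s), M.h (p.2, τ p s)) = p := by
    rw [show τ p s = 0 from max_eq_left h, N.h_zero, M.h_zero]
  refine ⟨⟨w, ⟨fun q => (N.h (q.1.1, τ q.1 q.2), M.h (q.1.2, τ q.1 q.2)), by fun_prop⟩, w_nonneg,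
    mem_iff, fun p => h_fix p 0 (min_le_left _ _),
    fun p hp s => h_fix p s ((min_le_right _ _).trans ((mem_iff p).1 hp).le),
    fun p s h1 hs => ?_⟩⟩
  have hτ : τ p s = w p := (congrArg (max 0) (min_eq_right hs)).trans (max_eq_right (w_nonneg p))
  change M.h (p.2, τ p s) ∈ J₀ ∨ N.h (p.1, τ p s) ∈ L
  rw [hτ]
  rcases min_choice (N.u p.1) (M.u p.2) with h | h
  · exact Or.inr (N.h_mem _ _ (h.symm.trans_lt h1) h.ge)
  · exact Or.inl (M.h_mem _ _ (h.symm.trans_lt h1) h.ge)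

/-- The end points of the unit interval form an NDR pair: the interval is stretched linearly about
its midpoint and truncated at the end points. -/
noncomputable def NDR.endpoints : NDR I ({0, 1} : Set I) where
  u := ⟨fun r => 3 * min (r : ℝ) (1 - r), by fun_prop⟩
  h := ⟨fun p => Set.projIcc 0 1 zero_le_one (1 / 2 + ((p.1 : ℝ) - 1 / 2) * (1 + 2 * max p.2 0)),
    continuous_projIcc.comp (by fun_prop)⟩
  u_nonneg r := mul_nonneg (by norm_num) (le_min r.2.1 (sub_nonneg.2 r.2.2))
  mem_iff r := by
    simp only [Set.mem_insert_iff, Set.mem_singleton_iff, ContinuousMap.coe_mk]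
    constructor
    · rintro (rfl | rfl) <;> simp
    · intro h
      rcases min_choice (r : ℝ) (1 - r) with h' | h' <;> rw [h'] at h
      · exact Or.inl (Subtype.ext (show (r : ℝ) = 0 by linarith))
      · exact Or.inr (Subtype.ext (show (r : ℝ) = 1 by linarith))
  h_zero r := by
    simp only [ContinuousMap.coe_mk, max_self, mul_zero, add_zero, mul_one, add_sub_cancel]
    exact Set.projIcc_val zero_le_one r
  h_of_mem r hr s := by
    have hs : 0 ≤ max s 0 := le_max_right _ _
    simp only [ContinuousMap.coe_mk]
    rcases hr with rfl | rfl
    · refine (Set.projIcc_of_le_left _ ?_).trans rfl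
      change 1 / 2 + ((0 : ℝ) - 1 / 2) * (1 + 2 * max s 0) ≤ 0
      linarith
    · refine (Set.projIcc_of_right_le _ ?_).trans rfl
      change 1 ≤ 1 / 2 + ((1 : ℝ) - 1 / 2) * (1 + 2 * max s 0)
      linarith
  h_mem r s h1 h2 := by
    have hr0 := r.2.1
    have hr1 := r.2.2
    have hs : s ≤ max s 0 := le_max_left _ _
    simp only [ContinuousMap.coe_mk] at h1 h2 ⊢
    rcases le_total (r : ℝ) (1 - r) with h | h
    · rw [min_eq_left h] at h1 h2
      refine Or.inl ((Set.projIcc_of_le_left _ ?_).trans rfl)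
      nlinarith
    · rw [min_eq_right h] at h1 h2
      refine Or.inr ((Set.projIcc_of_right_le _ ?_).trans rfl)
      nlinarith

end

/-! ### The comparison map -/

namespace CatWithModule.BarSimplex

section

variable {D : Type u} [Category.{v} D] {F : D ⥤ TopCat.{u}} {n : ℕ}

/-- The module `∐_d F(d)` over a discrete category given by a functor to spaces. -/
def discreteModule (F : D ⥤ TopCat.{u}) : CatWithModule.{v, u} :=
  ⟨TopologicalCategory.discrete D, LeftModule.ofFunctor F⟩

/-- The simplex given by a chain in a discrete category and a point over its first member. -/
def ofChain (c : ComposableArrows D n) (y : F.obj (c.obj 0)) :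
    BarSimplex (discreteModule F) n :=
  ⟨c, ⟨c.obj 0, y⟩, rfl⟩

theorem exists_ofChain (z : BarSimplex (discreteModule F) n) :
    ∃ (c : ComposableArrows D n) (y : F.obj (c.obj 0)), z = ofChain c y := by
  obtain ⟨c, ⟨d, y⟩, h⟩ := z
  change c.obj 0 = d at h
  subst h
  exact ⟨c, y, rfl⟩

theorem continuous_ofChain (c : ComposableArrows D n) : Continuous (ofChain (F := F) c) := by
  have continuous_arrows : Continuous fun _ : F.obj (c.obj 0) => fun i : Fin n =>
      (Mor.mk (c.map (homOfLE i.castSucc_le_succ)) : (discreteModule F).A.mor) := continuous_const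
  have continuous_point :
      Continuous fun y : F.obj (c.obj 0) => (⟨c.obj 0, y⟩ : (discreteModule F).X.space) :=
    continuous_sigmaMk (σ := fun d => F.obj d)
  exact continuous_induced_rng.2 (continuous_arrows.prodMk continuous_point)

theorem range_ofChain (c : ComposableArrows D n) :
    Set.range (ofChain (F := F) c) = toProd ⁻¹' (({fun i : Fin n =>
      Mor.mk (c.map (homOfLE i.castSucc_le_succ))} : Set (Fin n → (discreteModule F).A.mor)) ×ˢ
        (Sigma.fst ⁻¹' {c.obj 0} : Set (Σ d, F.obj d))) := by
  ext z
  constructor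
  · rintro ⟨y, rfl⟩
    exact ⟨rfl, rfl⟩
  · rintro ⟨harrows, hobj⟩
    obtain ⟨c', y, rfl⟩ := exists_ofChain z
    obtain rfl : c' = c := composableArrows_ext_mor hobj fun i => congrFun harrows i
    exact ⟨y, rfl⟩

theorem isOpenEmbedding_ofChain (c : ComposableArrows D n) :
    Topology.IsOpenEmbedding (ofChain (F := F) c) := by
  have embedding_pt : Topology.IsEmbedding ((fun z => z.pt) ∘ ofChain (F := F) c) :=
    Topology.IsEmbedding.sigmaMk (σ := fun d => F.obj d)
  refine ⟨.of_comp (continuous_ofChain c) continuous_pt embedding_pt, ?_⟩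
  rw [range_ofChain]
  refine IsOpen.preimage continuous_toProd (IsOpen.prod ?_ ?_)
  · have : DiscreteTopology (discreteModule F).A.mor := ⟨rfl⟩
    exact isOpen_discrete _
  · let _ : TopologicalSpace D := ⊥
    have : DiscreteTopology D := ⟨rfl⟩
    exact (isOpen_discrete (α := D) _).preimage (LeftModule.continuous_fst_discrete F)

theorem continuous_of_ofChain {T W : Type*} [TopologicalSpace T] [TopologicalSpace W]
    {g : BarSimplex (discreteModule F) n × T → W}
    (h : ∀ c : ComposableArrows D n,
      Continuous fun p : F.obj (c.obj 0) × T => g (ofChain c p.1, p.2)) : Continuous g := by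
  rw [continuous_iff_continuousAt]
  rintro ⟨z, t⟩
  obtain ⟨c, y, rfl⟩ := exists_ofChain z
  have := (isOpenEmbedding_ofChain (F := F) c).prodMap (.id (X := T))
  exact (this.continuousAt_iff (x := (y, t))).1 (h c).continuousAt

end

end CatWithModule.BarSimplex

namespace ModuleOverDiscrete

open CatWithModule

section

variable {C : Type u} [SmallCategory C] {n : ℕ}

/-- The map `[kᵢ] → [k₀]` underlying a morphism of simplices. -/
def face {σ τ : SimplexOver C} (f : σ ⟶ τ) : τ.1.unop ⟶ σ.1.unop := f.1.unop

theorem face_map_zero_le (c : ComposableArrows (SimplexOver C) n) {i j : Fin (n + 1)} (h : i ≤ j) :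
    face (c.map (homOfLE (Fin.zero_le j))) =
      face (c.map (homOfLE h)) ≫ face (c.map (homOfLE (Fin.zero_le i))) :=
  congrArg face (c.map_comp (homOfLE (Fin.zero_le i)) (homOfLE h))

/-- The images in the first simplex of a chain of simplices of the first vertices of the members
of the chain. -/
def lead (c : ComposableArrows (SimplexOver C) n) :
    Fin (n + 1) →o Fin ((c.obj 0).1.unop.len + 1) where
  toFun i := (face (c.map (homOfLE (Fin.zero_le i)))).toOrderHom 0
  monotone' i j h := by
    change _ ≤ (face (c.map (homOfLE (Fin.zero_le j)))).toOrderHom 0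
    rw [face_map_zero_le c h]
    exact (face (c.map (homOfLE (Fin.zero_le i)))).toOrderHom.monotone (Fin.zero_le _)

end

variable (D : ModuleOverDiscrete.{u})

/-- The point of the first member of a chain. -/
def fibrePt {n : ℕ} (z : BarSimplex (simplexModule.obj D) n) : D.Fibre (z.chain.obj 0) :=
  cast (congrArg D.Fibre z.eq.symm) z.pt.2

/-- The map of bar constructions in a single degree. -/
def compareApp {n : ℕ} (z : BarSimplex (simplexModule.obj D) n) : BarSimplex D.toCatWithModule n :=
  BarSimplex.pull (lead z.chain) (D.fibrePt z).1

theorem compareApp_ofChain {n : ℕ} (c : ComposableArrows (SimplexOver D.C) n)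
    (y : D.Fibre (c.obj 0)) :
    D.compareApp (BarSimplex.ofChain (F := D.pushforward) c y) = BarSimplex.pull (lead c) y.1 := rfl

theorem continuous_compareApp (n : ℕ) : Continuous (D.compareApp (n := n)) := by
  have : Continuous fun p : BarSimplex (simplexModule.obj D) n × Unit => D.compareApp p.1 :=
    BarSimplex.continuous_of_ofChain (F := D.pushforward) fun c =>
      (BarSimplex.continuous_pull (lead c)).comp
        ((continuous_subtype_val (p := fun z : BarSimplex D.toCatWithModule _ =>
          z.chain ⋙ D.ρ.functor = (c.obj 0).2)).comp
          (continuous_fst (X := D.Fibre (c.obj 0)) (Y := Unit)))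
  exact this.comp (continuous_id.prodMk (continuous_const (y := ())))

theorem pull_ofChain {m n : ℕ} (θ : Fin (m + 1) →o Fin (n + 1))
    (c : ComposableArrows (SimplexOver D.C) n) (y : D.Fibre (c.obj 0)) :
    BarSimplex.pull θ (BarSimplex.ofChain (F := D.pushforward) c y) =
      BarSimplex.ofChain (F := D.pushforward) (θ.monotone.functor ⋙ c : ComposableArrows _ m)
        (D.pushforward.map (c.map (homOfLE (Fin.zero_le (θ 0)))) y) := by
  refine BarSimplex.ext' rfl ?_
  change (⟨_, D.pushforward.map (eqToHom rfl ≫ c.map _) y⟩ : Σ d, D.pushforward.obj d) = ⟨_, _⟩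
  rw [eqToHom_refl, Category.id_comp]
  rfl

theorem compareApp_pull {m n : ℕ} (θ : Fin (m + 1) →o Fin (n + 1))
    (z : BarSimplex (simplexModule.obj D) n) :
    D.compareApp (BarSimplex.pull θ z) = BarSimplex.pull θ (D.compareApp z) := by
  obtain ⟨c, y, rfl⟩ := BarSimplex.exists_ofChain (F := D.pushforward) z
  refine (congrArg D.compareApp (D.pull_ofChain θ c y)).trans ?_
  rw [compareApp_ofChain D c y, ← BarSimplex.pull_comp]
  refine (BarSimplex.pull_comp _ _ _).symm.trans (congrArg (fun e => BarSimplex.pull e y.1) ?_)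
  refine OrderHom.ext _ _ (funext fun i => ?_)
  change _ = (face (c.map (homOfLE (Fin.zero_le (θ i))))).toOrderHom 0
  rw [face_map_zero_le c (θ.monotone (Fin.zero_le i))]
  rfl

/-- The map of bar constructions `B(*, Δ ↓ C, ρ_* X) → B(*, A, X)`. -/
def compare : simplexModule.{u} ⋙ bar.{0, u} ⟶ forget.{u} ⋙ bar.{u, u} where
  app D :=
    { app n := TopCat.ofHom ⟨D.compareApp, D.continuous_compareApp n.unop.len⟩
      naturality m n θ := by
        ext z
        exact D.compareApp_pull θ.unop.toOrderHom z }
  naturality D E f := by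
    ext n z
    obtain ⟨c, y, rfl⟩ := BarSimplex.exists_ofChain (F := D.pushforward) z
    exact (BarSimplex.push_pull f.hom (lead c) y.1).symm

end ModuleOverDiscrete

/-! ### Maps out of realizations -/

namespace SimplicialSpace

/-- The map `Y_k × Δ^k → |Y|`. -/
def incl (Y : SimplicialObject TopCat.{u}) (k : SimplexCategory) :
    C(Y.obj (op k) × stdSimplex ℝ (Fin (k.len + 1)), realization.obj Y) :=
  ⟨fun p => Quot.mk _ ⟨k, p⟩, continuous_quot_mk.comp continuous_sigmaMk⟩

theorem incl_map (Y : SimplicialObject TopCat.{u}) {k l : SimplexCategory} (θ : k ⟶ l)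
    (y : Y.obj (op l)) (t : stdSimplex ℝ (Fin (k.len + 1))) :
    incl Y k (Y.map θ.op y, t) = incl Y l (y, affineMap θ t) :=
  Quot.sound (Rel.intro θ y t)

/-- A map out of the realization, from its restrictions. -/
def desc (Y : SimplicialObject TopCat.{u}) {Z : Type u} [TopologicalSpace Z]
    (g : ∀ k : SimplexCategory, C(Y.obj (op k) × stdSimplex ℝ (Fin (k.len + 1)), Z))
    (hg : ∀ {k l : SimplexCategory} (θ : k ⟶ l) y t,
      g k (Y.map θ.op y, t) = g l (y, affineMap θ t)) : C(realization.obj Y, Z) :=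
  ⟨Quot.lift (fun w => g w.1 w.2) (by rintro _ _ ⟨θ, y, t⟩; exact hg θ y t),
    continuous_quot_lift _ (continuous_sigma fun k => (g k).continuous)⟩

theorem exists_incl (Y : SimplicialObject TopCat.{u}) (x : realization.obj Y) :
    ∃ k p, x = incl Y k p := by
  obtain ⟨⟨k, p⟩, rfl⟩ := Quot.exists_rep x
  exact ⟨k, p, rfl⟩

end SimplicialSpace

namespace Coll

variable {k l d : SimplexCategory}

/-- The first vertex of a face, and the index of a point. -/
def index : Coll.{u} k → Fin (k.len + 1)
  | face φ => φ.first
  | pt i => i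

theorem index_le {x y : Coll.{u} k} (f : x ⟶ y) : index x ≤ index y := by
  rcases x with φ | i <;> rcases y with ψ | j
  · exact FaceCat.first_le f
  · exact f.down
  · exact PEmpty.elim f
  · exact f.down

theorem index_push (α : k ⟶ l) (x : Coll.{u} k) :
    index ((push α).obj x) = α.toOrderHom (index x) := by
  rcases x with φ | i <;> rfl

/-- The indices of the members of a chain. -/
def indexHom {d : SimplexCategoryᵒᵖ} (m : (cylinder.{u}.functor.obj k).obj d) : d.unop ⟶ k :=
  SimplexCategory.Hom.mk
    ⟨fun i => index (m.1.obj i), fun _ _ h => index_le (m.1.map (homOfLE h))⟩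

theorem indexHom_map {d d' : SimplexCategoryᵒᵖ} (θ : d ⟶ d')
    (m : (cylinder.{u}.functor.obj k).obj d) :
    indexHom ((cylinder.functor.obj k).map θ m) = θ.unop ≫ indexHom m := rfl

theorem indexHom_push (α : k ⟶ l) {d : SimplexCategoryᵒᵖ}
    (m : (cylinder.{u}.functor.obj k).obj d) :
    indexHom ((cylinder.functor.map α).app d m) = indexHom m ≫ α := by
  ext i : 3
  exact index_push α _

/-- The chain of points given by a map `[d] → [k]`. -/
def ptChain (a : d ⟶ k) : (cylinder.{u}.functor.obj k).obj (op d) :=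
  ⟨{ obj i := pt (a.toOrderHom i)
     map f := ⟨a.toOrderHom.monotone (leOfHom f)⟩
     map_id _ := Subsingleton.elim _ _
     map_comp _ _ := Subsingleton.elim _ _ }, fun _ _ h _ => absurd trivial h⟩

theorem eq_pt_index {x : Coll.{u} k} (h : (marking k).isPt x) : x = pt (index x) := by
  rcases x with φ | i
  · exact False.elim h
  · rfl

theorem subsingleton_hom (x : Coll.{u} k) {y : Coll.{u} k} (hy : (marking k).isPt y) :
    Subsingleton (x ⟶ y) := by
  rw [eq_pt_index hy]
  exact ⟨fun f g => eq_of_heq (hom_pt_heq f g rfl rfl)⟩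

theorem eq_ptChain {d : SimplexCategoryᵒᵖ} (m : (cylinder.{u}.functor.obj k).obj d)
    (hm : m ∈ (marking k).pts.obj d) : m = ptChain (indexHom m) :=
  Subtype.ext (ComposableArrows.ext (fun i => eq_pt_index (hm i)) fun i hi =>
    (subsingleton_hom _ (hm ⟨i + 1, by lia⟩)).elim _ _)

theorem map_ptChain {d' : SimplexCategory} (θ : d' ⟶ d) (a : d ⟶ k) :
    (cylinder.functor.obj k).map θ.op (ptChain.{u} a) = ptChain (θ ≫ a) :=
  eq_ptChain _ fun _ => trivial

theorem push_ptChain (α : k ⟶ l) (a : d ⟶ k) :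
    (cylinder.functor.map α).app (op d) (ptChain.{u} a) = ptChain (a ≫ α) :=
  eq_ptChain _ fun _ => trivial

open SimplicialSpace

variable {Y : SimplicialObject TopCat.{u}} {Z : Type u} [TopologicalSpace Z]

/-- The map out of the realization given by the restriction of a natural family to points. -/
noncomputable def descPts (G : cylinder.functor ⟶ sing Y Z) : C(realization.obj Y, Z) :=
  desc Y (fun k => Sing.val ((G.app k).app (op k) (ptChain (𝟙 k)))) fun {k l} θ y t => by
    have h1 : (G.app l).app (op k) ((cylinder.functor.map θ).app (op k) (ptChain (𝟙 k))) =
      ((sing Y Z).map θ).app (op k) ((G.app k).app (op k) (ptChain (𝟙 k))) :=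
      congrArg (fun q => q.app (op k) (ptChain (𝟙 k))) (G.naturality θ)
    have h2 := Sing.val_app_map (G.app l) θ.op (ptChain (𝟙 l)) y t
    rw [push_ptChain, Category.id_comp] at h1
    rw [map_ptChain, Category.comp_id] at h2
    exact (congrArg (fun s => Sing.val s (y, t)) h1).symm.trans h2

theorem val_of_mem_pts (G : cylinder.functor ⟶ sing Y Z) {d : SimplexCategoryᵒᵖ}
    (m : (cylinder.functor.obj k).obj d) (hm : m ∈ (marking k).pts.obj d) (y) (t) :
    Sing.val ((G.app k).app d m) (y, t) =
      descPts G (incl Y k (y, affineMap (indexHom m) t)) := by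
  refine Eq.trans ?_ (Sing.val_app_map (G.app k) (indexHom m).op (ptChain (𝟙 k)) y t)
  rw [map_ptChain, Category.comp_id, ← eq_ptChain m hm]
  rfl

/-- The natural family given by a map out of the realization. -/
noncomputable def familyOfMap (g : C(realization.obj Y, Z)) : cylinder.functor ⟶ sing Y Z where
  app k := ssetHomMk (fun d m => Sing.mk (g.comp ((incl Y k).comp
      ((ContinuousMap.id _).prodMap (affineMap (indexHom m)))))) (by
    intro d d' θ m
    refine Sing.ext fun y t => ?_
    change g (incl Y k (y, affineMap (indexHom _) t)) =
      g (incl Y k (y, affineMap (indexHom m) (affineMap θ.unop t)))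
    rw [indexHom_map, affineMap_comp]
    rfl)
  naturality k l α := by
    refine sset_hom_ext fun d m => Sing.ext fun y t => ?_
    change g (incl Y l (y, affineMap (indexHom ((cylinder.functor.map α).app d m)) t)) =
      g (incl Y k (Y.map α.op y, affineMap (indexHom m) t))
    rw [indexHom_push, affineMap_comp, incl_map]
    rfl

end Coll

namespace Coll

variable {k l : SimplexCategory}

/-- The face underlying an object which is not a point. -/
def faceOf : ∀ x : Coll.{u} k, ¬ (marking k).isPt x → FaceCat.{u} k
  | face φ, _ => φ
  | pt _, h => absurd trivial h

/-- The morphism of faces underlying a morphism. -/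
def faceHom : ∀ {x y : Coll.{u} k} (hx : ¬ (marking k).isPt x) (hy : ¬ (marking k).isPt y),
    (x ⟶ y) → (faceOf x hx ⟶ faceOf y hy)
  | face _, face _, _, _, f => f
  | pt _, _, h, _, _ => absurd trivial h
  | face _, pt _, _, h, _ => absurd trivial h

theorem faceHom_id {x : Coll.{u} k} (hx : ¬ (marking k).isPt x) : faceHom hx hx (𝟙 x) = 𝟙 _ := by
  rcases x with φ | i
  · rfl
  · exact absurd trivial hx

theorem faceHom_comp {x y z : Coll.{u} k} (hx : ¬ (marking k).isPt x) (hy : ¬ (marking k).isPt y)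
    (hz : ¬ (marking k).isPt z) (f : x ⟶ y) (g : y ⟶ z) :
    faceHom hx hz (f ≫ g) = faceHom hx hy f ≫ faceHom hy hz g := by
  rcases x with φ | i
  swap; · exact absurd trivial hx
  rcases y with ψ | i
  swap; · exact absurd trivial hy
  rcases z with χ | i
  swap; · exact absurd trivial hz
  rfl

/-- The chain of faces underlying a chain without points. -/
def lower {n : ℕ} (c : ComposableArrows (Coll.{u} k) n) (h : ∀ a, ¬ (marking k).isPt (c.obj a)) :
    ComposableArrows (FaceCat.{u} k) n where
  obj a := faceOf (c.obj a) (h a)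
  map f := faceHom (h _) (h _) (c.map f)
  map_id a := by rw [c.map_id, faceHom_id]
  map_comp f g := by rw [c.map_comp, faceHom_comp]

theorem faceOf_push (α : k ⟶ l) (x : Coll.{u} k) (hx : ¬ (marking k).isPt x)
    (hx' : ¬ (marking l).isPt ((push α).obj x)) :
    faceOf ((push α).obj x) hx' = (FaceCat.push α).obj (faceOf x hx) := by
  rcases x with φ | i
  · rfl
  · exact absurd trivial hx

theorem faceHom_push (α : k ⟶ l) {x y : Coll.{u} k} (f : x ⟶ y) (hx : ¬ (marking k).isPt x)
    (hy : ¬ (marking k).isPt y) (hx' : ¬ (marking l).isPt ((push α).obj x))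
    (hy' : ¬ (marking l).isPt ((push α).obj y)) :
    HEq (faceHom hx' hy' ((push α).map f)) ((FaceCat.push α).map (faceHom hx hy f)) := by
  rcases x with φ | i
  swap; · exact absurd trivial hx
  rcases y with ψ | i
  swap; · exact absurd trivial hy
  rfl

theorem lower_push (α : k ⟶ l) {n : ℕ} (c : ComposableArrows (Coll.{u} k) n)
    (h : ∀ a, ¬ (marking k).isPt (c.obj a))
    (h' : ∀ a, ¬ (marking l).isPt ((push α).obj (c.obj a))) :
    lower (c ⋙ push α : ComposableArrows _ n) h' = lower c h ⋙ FaceCat.push α :=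
  CategoryTheory.Functor.hext (fun _ => faceOf_push α _ _ _) fun _ _ _ => faceHom_push α _ _ _ _ _

theorem index_eq_first (x : Coll.{u} k) (hx : ¬ (marking k).isPt x) :
    index x = (faceOf x hx).first := by
  rcases x with φ | i
  · rfl
  · exact absurd trivial hx

/-- A chain of faces as a simplex of the cylinder. -/
def incChain {n : ℕ} (c : ComposableArrows (FaceCat.{u} k) n) :
    (cylinder.{u}.functor.obj k).obj (op (SimplexCategory.mk n)) :=
  ⟨(c ⋙ inc k : ComposableArrows _ n), fun _ _ _ h => False.elim h⟩

theorem incChain_mem {n : ℕ} (c : ComposableArrows (FaceCat.{u} k) n) :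
    incChain c ∈ (marking k).base.obj (op (SimplexCategory.mk n)) := fun _ h => False.elim h

theorem push_mem_pts (α : k ⟶ l) (d : SimplexCategoryᵒᵖ)
    (m : (cylinder.{u}.functor.obj k).obj d) (hm : m ∈ (marking k).pts.obj d) :
    (cylinder.functor.map α).app d m ∈ (marking l).pts.obj d :=
  fun a => (isPt_push α _).2 (hm a)

theorem push_mem_base (α : k ⟶ l) (d : SimplexCategoryᵒᵖ)
    (m : (cylinder.{u}.functor.obj k).obj d) (hm : m ∈ (marking k).base.obj d) :
    (cylinder.functor.map α).app d m ∈ (marking l).base.obj d :=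
  fun a h => hm a ((isPt_push α _).1 h)

end Coll

namespace ModuleOverDiscrete

open CatWithModule SimplicialSpace

section

variable {C : Type u} [SmallCategory C] {n : ℕ}

theorem homMk_heq {K L : SimplexCategoryᵒᵖ} {s s' : (nerve C).obj K} {t t' : (nerve C).obj L}
    (f : K ⟶ L) (hs : s = s') (ht : t = t') (h : (nerve C).map f s = t)
    (h' : (nerve C).map f s' = t') :
    HEq (CategoryOfElements.homMk (F := nerve C) ⟨K, s⟩ ⟨L, t⟩ f h)
      (CategoryOfElements.homMk (F := nerve C) ⟨K, s'⟩ ⟨L, t'⟩ f h') := by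
  subst hs ht
  rfl

/-- A chain of simplices as a chain of faces of its first member. -/
def toFaceChain (c : ComposableArrows (SimplexOver C) n) :
    ComposableArrows (FaceCat.{u} (c.obj 0).1.unop) n where
  obj i := ⟨face (c.map (homOfLE (Fin.zero_le i)))⟩
  map f := ⟨face (c.map f), (face_map_zero_le c (leOfHom f)).symm⟩
  map_id i := Subtype.ext (congrArg face (c.map_id i))
  map_comp f g := Subtype.ext (congrArg face (c.map_comp f g))

theorem nerve_map_map {k l p : SimplexCategory} (α : k ⟶ l) (β : l ⟶ p) (σ : (nerve C).obj (op p)) :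
    (nerve C).map α.op ((nerve C).map β.op σ) = (nerve C).map (α ≫ β).op σ := by
  rw [op_comp, (nerve C).map_comp]
  rfl

/-- The faces of a simplex of the nerve, as a functor to the category of simplices. -/
def faces {k : SimplexCategory} (σ : (nerve C).obj (op k)) : FaceCat.{u} k ⥤ SimplexOver C where
  obj φ := ⟨op φ.dom, (nerve C).map φ.map.op σ⟩
  map f := ⟨f.1.op, by rw [nerve_map_map, f.2]⟩

theorem toFaceChain_comp_faces (c : ComposableArrows (SimplexOver C) n) :
    toFaceChain c ⋙ faces (c.obj 0).2 = c := by
  have hobj (i) :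
      (nerve C).map (face (c.map (homOfLE (Fin.zero_le i)))).op (c.obj 0).2 = (c.obj i).2 :=
    (c.map (homOfLE (Fin.zero_le i))).2
  refine CategoryTheory.Functor.hext (fun i => Sigma.ext rfl (heq_of_eq (hobj i))) fun i j f => ?_
  exact homMk_heq (c.map f).1 (hobj i) (hobj j) _ (c.map f).2

theorem push_comp_faces {k l : SimplexCategory} (α : k ⟶ l) (σ : (nerve C).obj (op l)) :
    FaceCat.push α ⋙ faces σ = faces ((nerve C).map α.op σ) := by
  have hobj (φ : FaceCat.{u} k) : (nerve C).map (φ.map ≫ α).op σ =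
      (nerve C).map φ.map.op ((nerve C).map α.op σ) := (nerve_map_map _ _ _).symm
  refine CategoryTheory.Functor.hext (fun φ => Sigma.ext rfl (heq_of_eq (hobj φ))) fun φ ψ f => ?_
  exact homMk_heq f.1.op (hobj φ) (hobj ψ) _ _

theorem push_incChain {m n : SimplexCategory} (θ : m ⟶ n)
    (c : ComposableArrows (SimplexOver C) n.len) :
    (Coll.cylinder.functor.map (face (c.map (homOfLE (Fin.zero_le (θ.toOrderHom 0)))))).app (op m)
        (Coll.incChain
          (toFaceChain (θ.toOrderHom.monotone.functor ⋙ c : ComposableArrows _ m.len))) =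
      (Coll.cylinder.functor.obj _).map θ.op (Coll.incChain (toFaceChain c)) := by
  have hface (i) : face (c.map (homOfLE (θ.toOrderHom.monotone (Fin.zero_le i)))) ≫
      face (c.map (homOfLE (Fin.zero_le (θ.toOrderHom 0)))) =
        face (c.map (homOfLE (Fin.zero_le (θ.toOrderHom i)))) :=
    (face_map_zero_le c _).symm
  refine Subtype.ext (CategoryTheory.Functor.hext
    (fun i => congrArg (fun a => Coll.face (FaceCat.mk a)) (hface i)) fun i j f => ?_)
  exact Coll.face_heq
    ((toFaceChain (θ.toOrderHom.monotone.functor ⋙ c : ComposableArrows _ m.len)).map f)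
    (hface i) (hface j) _ _

end

variable (D : ModuleOverDiscrete.{u})

/-- The image of the chain of a simplex in `C`. -/
def baseChain {k : SimplexCategory} (y : (bar.obj D.toCatWithModule).obj (op k)) :
    (nerve D.C).obj (op k) :=
  (BarSimplex.chain y ⋙ D.ρ.functor : ComposableArrows D.C k.len)

theorem setOf_baseChain_eq {k : SimplexCategory} (σ : (nerve D.C).obj (op k)) :
    {y | D.baseChain y = σ} =
      {y | D.ρ.functor.obj (BarSimplex.chain y |>.obj 0) = σ.obj 0} ∩
        ⋂ i : Fin k.len, {y | D.ρ.functor.mapMor (BarSimplex.spine y i) =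
          Mor.mk (σ.map (homOfLE i.castSucc_le_succ))} := by
  ext y
  constructor
  · rintro rfl
    exact ⟨rfl, Set.mem_iInter.2 fun _ => rfl⟩
  · rintro ⟨hobj, harrows⟩
    exact composableArrows_ext_mor hobj fun i => Set.mem_iInter.1 harrows i

theorem isOpen_setOf_baseChain_eq {k : SimplexCategory} (σ : (nerve D.C).obj (op k)) :
    IsOpen {y | D.baseChain y = σ} := by
  rw [setOf_baseChain_eq]
  refine IsOpen.inter ?_ (isOpen_iInter_of_finite fun i => ?_)
  · let _ : TopologicalSpace D.C := ⊥
    have : DiscreteTopology D.C := ⟨rfl⟩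
    exact (isOpen_discrete {σ.obj 0}).preimage
      (D.ρ.continuous_obj.comp (BarSimplex.continuous_obj (P := D.toCatWithModule) 0))
  · let _ : TopologicalSpace (Mor D.C) := ⊥
    have : DiscreteTopology (Mor D.C) := ⟨rfl⟩
    exact (isOpen_discrete {Mor.mk (σ.map (homOfLE i.castSucc_le_succ))}).preimage
      (D.ρ.continuous_map.comp (BarSimplex.continuous_spine (P := D.toCatWithModule) i))

theorem ofChain_congr {n : ℕ} {c c' : ComposableArrows (SimplexOver D.C) n} (hc : c = c')
    {y : D.Fibre (c.obj 0)} {y' : D.Fibre (c'.obj 0)} (hy : y.1 ≍ y'.1) :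
    BarSimplex.ofChain (F := D.pushforward) c y =
      BarSimplex.ofChain (F := D.pushforward) c' y' := by
  subst hc
  exact congrArg _ (Subtype.ext (eq_of_heq hy))

/-- The simplex of `B(*, Δ ↓ C, ρ_* X)` given by a simplex of `B(*, A, X)` and a chain of faces. -/
def faceSimplex {k : SimplexCategory} {n : ℕ} (c : ComposableArrows (FaceCat.{u} k) n)
    (y : (bar.obj D.toCatWithModule).obj (op k)) : BarSimplex (simplexModule.obj D) n :=
  BarSimplex.ofChain (F := D.pushforward) (c ⋙ faces (D.baseChain y) : ComposableArrows _ n)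
    (⟨BarSimplex.pull (c.obj 0).map.toOrderHom y, rfl⟩ : D.Fibre _)

theorem continuous_faceSimplex {k : SimplexCategory} {n : ℕ}
    (c : ComposableArrows (FaceCat.{u} k) n) : Continuous (D.faceSimplex c) := by
  rw [continuous_iff_continuousAt]
  intro y₀
  have isOpen_fibre : IsOpen {y | D.baseChain y = D.baseChain y₀} :=
    D.isOpen_setOf_baseChain_eq _
  refine ContinuousOn.continuousAt (s := {y | D.baseChain y = D.baseChain y₀}) ?_
    (isOpen_fibre.mem_nhds rfl)
  rw [continuousOn_iff_continuous_domRestrict]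
  let g : {y | D.baseChain y = D.baseChain y₀} →
      D.Fibre ((c ⋙ faces (D.baseChain y₀)).obj 0) := fun y =>
    ⟨BarSimplex.pull (c.obj 0).map.toOrderHom y.1,
      congrArg (fun σ => (nerve D.C).map (c.obj 0).map.op σ) y.2⟩
  have hg : Continuous g := ((BarSimplex.continuous_pull (P := D.toCatWithModule) _).comp
    continuous_subtype_val).subtype_mk _
  have ofChain_eq (y : {y | D.baseChain y = D.baseChain y₀}) :
      BarSimplex.ofChain (F := D.pushforward)
        (c ⋙ faces (D.baseChain y₀) : ComposableArrows _ n) (g y) = D.faceSimplex c y.1 :=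
    D.ofChain_congr (congrArg (fun σ => (c ⋙ faces σ : ComposableArrows _ n)) y.2.symm) HEq.rfl
  exact ((BarSimplex.continuous_ofChain _).comp hg).congr ofChain_eq

variable {Z : Type u} [TopologicalSpace Z]

theorem faceSimplex_comp {k : SimplexCategory} {m n : ℕ} (θ : Fin (m + 1) →o Fin (n + 1))
    (c : ComposableArrows (FaceCat.{u} k) n) (y : (bar.obj D.toCatWithModule).obj (op k)) :
    D.faceSimplex (θ.monotone.functor ⋙ c : ComposableArrows _ m) y =
      BarSimplex.pull θ (D.faceSimplex c y) := by
  refine Eq.trans ?_ (D.pull_ofChain θ _ _).symm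
  refine congrArg (BarSimplex.ofChain (F := D.pushforward)
    (θ.monotone.functor ⋙ c ⋙ faces (D.baseChain y) : ComposableArrows _ m)) (Subtype.ext ?_)
  refine Eq.trans ?_ (BarSimplex.pull_comp _ _ y)
  exact congrArg (fun f => BarSimplex.pull (SimplexCategory.Hom.toOrderHom f) y)
    (c.map (homOfLE (Fin.zero_le (θ 0)))).2.symm

theorem faceSimplex_push {k l : SimplexCategory} {n : ℕ} (α : k ⟶ l)
    (c : ComposableArrows (FaceCat.{u} k) n) (y : (bar.obj D.toCatWithModule).obj (op l)) :
    D.faceSimplex (c ⋙ FaceCat.push α : ComposableArrows _ n) y =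
      D.faceSimplex c ((bar.obj D.toCatWithModule).map α.op y) :=
  D.ofChain_congr
    (congrArg (fun T => (c ⋙ T : ComposableArrows _ n)) (push_comp_faces α (D.baseChain y)))
    (heq_of_eq (BarSimplex.pull_comp _ _ y))

theorem faceSimplex_toFaceChain {n : ℕ} (c : ComposableArrows (SimplexOver D.C) n)
    (y : D.Fibre (c.obj 0)) :
    D.faceSimplex (toFaceChain c) y.1 = BarSimplex.ofChain (F := D.pushforward) c y := by
  have baseChain_eq : D.baseChain (k := (c.obj 0).1.unop) y.1 = (c.obj 0).2 := y.2
  have map_eq_id : ((toFaceChain c).obj 0).map = 𝟙 _ := congrArg face (c.map_id 0)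
  refine D.ofChain_congr ((congrArg (fun σ => toFaceChain c ⋙ faces σ) baseChain_eq).trans
    (toFaceChain_comp_faces c)) (heq_of_eq ?_)
  exact (congrArg (fun f => BarSimplex.pull (SimplexCategory.Hom.toOrderHom f) y.1) map_eq_id).trans
    (BarSimplex.pull_id y.1)

/-- The natural family on chains of faces given by a map out of the realization. -/
noncomputable def baseFamily (Φ : C(realization.obj (bar.obj (simplexModule.obj D)), Z))
    (k : SimplexCategory) :
    (Coll.marking.{u} k).base.toSSet ⟶ (sing (bar.obj D.toCatWithModule) Z).obj k :=
  ssetHomMk (fun d m => Sing.mk (Φ.comp ((incl (bar.obj (simplexModule.obj D)) d.unop).comp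
    (ContinuousMap.prodMap ⟨D.faceSimplex (Coll.lower m.1.1 m.2), D.continuous_faceSimplex _⟩
      (.id _))))) (by
    intro d d' θ m
    refine Sing.ext fun y t => congrArg Φ ?_
    refine Eq.trans ?_ (incl_map (bar.obj (simplexModule.obj D)) θ.unop
      (D.faceSimplex (Coll.lower m.1.1 m.2) y) t)
    exact congrArg (fun z => incl (bar.obj (simplexModule.obj D)) d'.unop (z, t))
      (D.faceSimplex_comp θ.unop.toOrderHom (Coll.lower m.1.1 m.2) y))

theorem baseFamily_push (Φ : C(realization.obj (bar.obj (simplexModule.obj D)), Z))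
    {k l : SimplexCategory} (α : k ⟶ l) (d : SimplexCategoryᵒᵖ)
    (m : (Coll.cylinder.{u}.functor.obj k).obj d) (hm : m ∈ (Coll.marking k).base.obj d) :
    (D.baseFamily Φ l).app d ⟨_, Coll.push_mem_base α d m hm⟩ =
      ((sing (bar.obj D.toCatWithModule) Z).map α).app d ((D.baseFamily Φ k).app d ⟨m, hm⟩) := by
  refine Sing.ext fun y t => congrArg Φ ?_
  refine congrArg (fun z => incl (bar.obj (simplexModule.obj D)) d.unop (z, t)) ?_
  refine Eq.trans ?_ (D.faceSimplex_push α (Coll.lower m.1 hm) y)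
  exact congrArg (fun c => D.faceSimplex c y) (Coll.lower_push α m.1 hm _)

theorem val_incChain_pull_ofChain
    (G : Coll.cylinder.functor ⟶ sing (bar.obj D.toCatWithModule) Z) {m n : SimplexCategory}
    (θ : m ⟶ n) (c : ComposableArrows (SimplexOver D.C) n.len) (y : D.Fibre (c.obj 0)) (t) :
    let z := BarSimplex.pull θ.toOrderHom (BarSimplex.ofChain (F := D.pushforward) c y)
    Sing.val ((G.app _).app _ (Coll.incChain (toFaceChain z.chain))) ((D.fibrePt z).1, t) =
      Sing.val ((G.app _).app (op n) (Coll.incChain (toFaceChain c))) (y.1, affineMap θ t) := by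
  let c' : ComposableArrows (SimplexOver D.C) m.len := θ.toOrderHom.monotone.functor ⋙ c
  let α := face (c.map (homOfLE (Fin.zero_le (θ.toOrderHom 0))))
  have naturality := congrArg
    (fun q => Sing.val (q.app (op m) (Coll.incChain (toFaceChain c'))) (y.1, t)) (G.naturality α)
  have push_eq : (Coll.cylinder.functor.map α).app (op m) (Coll.incChain (toFaceChain c')) =
      (Coll.cylinder.functor.obj _).map θ.op (Coll.incChain (toFaceChain c)) := push_incChain θ c
  refine (congrArg (fun w : BarSimplex (simplexModule.obj D) m.len =>
    Sing.val ((G.app _).app _ (Coll.incChain (toFaceChain w.chain))) ((D.fibrePt w).1, t))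
    (D.pull_ofChain θ.toOrderHom c y)).trans (naturality.symm.trans ?_)
  refine (congrArg (fun w => Sing.val ((G.app _).app (op m) w) (y.1, t)) push_eq).trans ?_
  exact Sing.val_app_map (G.app _) θ.op (Coll.incChain (toFaceChain c)) y.1 t

/-- The map out of the realization given by the restriction of a natural family to faces. -/
noncomputable def descBase (G : Coll.cylinder.functor ⟶ sing (bar.obj D.toCatWithModule) Z) :
    C(realization.obj (bar.obj (simplexModule.obj D)), Z) :=
  desc (bar.obj (simplexModule.obj D))
    (fun n => ⟨fun p =>
        Sing.val ((G.app _).app _ (Coll.incChain (toFaceChain (BarSimplex.chain p.1))))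
          ((D.fibrePt p.1).1, p.2),
      BarSimplex.continuous_of_ofChain (F := D.pushforward) fun c =>
        (Sing.val ((G.app _).app _ (Coll.incChain (toFaceChain c)))).continuous.comp
          (Continuous.prodMap (f := fun y : D.Fibre (c.obj 0) => y.1)
            continuous_subtype_val continuous_id)⟩) (by
    intro m n θ z t
    obtain ⟨c, y, rfl⟩ := BarSimplex.exists_ofChain (F := D.pushforward) z
    exact D.val_incChain_pull_ofChain G θ c y t)

theorem descBase_incl (G : Coll.cylinder.functor ⟶ sing (bar.obj D.toCatWithModule) Z)
    {n : SimplexCategory} (c : ComposableArrows (SimplexOver D.C) n.len) (y : D.Fibre (c.obj 0))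
    (t) : D.descBase G (incl (bar.obj (simplexModule.obj D)) n
        (BarSimplex.ofChain (F := D.pushforward) c y, t)) =
      Sing.val ((G.app _).app (op n) (Coll.incChain (toFaceChain c))) (y.1, t) := rfl

theorem exists_incl_ofChain (x : realization.obj (bar.obj (simplexModule.obj D))) :
    ∃ (n : SimplexCategory) (c : ComposableArrows (SimplexOver D.C) n.len)
      (y : D.Fibre (c.obj 0)) (t : stdSimplex ℝ (Fin (n.len + 1))),
      x = incl (bar.obj (simplexModule.obj D)) n
        (BarSimplex.ofChain (F := D.pushforward) c y, t) := by
  obtain ⟨n, ⟨z, t⟩, rfl⟩ := exists_incl _ x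
  obtain ⟨c, y, rfl⟩ := BarSimplex.exists_ofChain (F := D.pushforward) z
  exact ⟨n, c, y, t, rfl⟩

theorem descBase_eq_of_base {Φ : C(realization.obj (bar.obj (simplexModule.obj D)), Z)}
    {G : Coll.cylinder.functor ⟶ sing (bar.obj D.toCatWithModule) Z}
    (h : ∀ k d m (hm : m ∈ (Coll.marking.{u} k).base.obj d),
      (G.app k).app d m = (D.baseFamily Φ k).app d ⟨m, hm⟩) : D.descBase G = Φ := by
  ext x
  obtain ⟨n, c, y, t, rfl⟩ := D.exists_incl_ofChain x
  rw [descBase_incl, h _ _ _ (Coll.incChain_mem _)]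
  exact congrArg (fun z => Φ (incl _ n (z, t))) (D.faceSimplex_toFaceChain c y)

/-- The comparison map `hocolim_{Δ ↓ C} ρ_* X → hocolim_A X`. -/
noncomputable def compareMap : C(realization.obj (bar.obj (simplexModule.obj D)),
    realization.obj (bar.obj D.toCatWithModule)) :=
  (realization.map (compare.app D)).hom

theorem compareMap_incl {n : SimplexCategory} (z : BarSimplex (simplexModule.obj D) n.len) (t) :
    D.compareMap (incl (bar.obj (simplexModule.obj D)) n (z, t)) =
      incl (bar.obj D.toCatWithModule) n (D.compareApp z, t) := rfl

theorem compareMap_faceSimplex {k n : SimplexCategory} (c : ComposableArrows (FaceCat.{u} k) n.len)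
    (y : (bar.obj D.toCatWithModule).obj (op k)) (t) (a : n ⟶ k)
    (ha : ∀ i, a.toOrderHom i = (c.obj i).first) :
    D.compareMap (incl (bar.obj (simplexModule.obj D)) n (D.faceSimplex c y, t)) =
      incl (bar.obj D.toCatWithModule) k (y, affineMap a t) := by
  rw [compareMap_incl]
  refine Eq.trans ?_ (incl_map (bar.obj D.toCatWithModule) a y t)
  refine congrArg (fun z => incl (bar.obj D.toCatWithModule) n (z, t)) ?_
  refine (BarSimplex.pull_comp _ _ y).symm.trans
    (congrArg (fun θ => BarSimplex.pull θ y) (OrderHom.ext _ _ (funext fun i => ?_)))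
  refine Eq.trans ?_ (ha i).symm
  exact congrArg (fun θ => θ.toOrderHom 0) (c.map (homOfLE (Fin.zero_le i))).2

theorem descBase_familyOfMap (g : C(realization.obj (bar.obj D.toCatWithModule), Z)) :
    D.descBase (Coll.familyOfMap g) = g.comp D.compareMap := by
  ext x
  obtain ⟨n, c, y, t, rfl⟩ := D.exists_incl_ofChain x
  rw [descBase_incl, ContinuousMap.comp_apply, ← D.faceSimplex_toFaceChain c y]
  exact congrArg g (D.compareMap_faceSimplex _ _ _ _ fun _ => rfl).symm

theorem compareMap_baseFamily {k : SimplexCategory} {d : SimplexCategoryᵒᵖ}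
    (m : (Coll.cylinder.{u}.functor.obj k).obj d) (hm : m ∈ (Coll.marking k).base.obj d) (y) (t) :
    D.compareMap (Sing.val ((D.baseFamily (.id _) k).app d ⟨m, hm⟩) (y, t)) =
      incl (bar.obj D.toCatWithModule) k (y, affineMap (Coll.indexHom m) t) :=
  D.compareMap_faceSimplex _ _ _ _ fun i => Coll.index_eq_first _ (hm i)

end ModuleOverDiscrete

/-! ### The homotopy equivalence -/

section

open unitInterval

/-- The two ends of the cylinder `X × I`. -/
def cylinderEnds (X : Type*) : Set (X × I) :=
  {p | p.2 ∈ ({0, 1} : Set I)}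

theorem isClosed_cylinderEnds (X : Type*) [TopologicalSpace X] : IsClosed (cylinderEnds X) :=
  (Set.toFinite ({0, 1} : Set I)).isClosed.preimage continuous_snd

theorem exists_continuousMap_cylinderEnds {X T Z : Type*} [TopologicalSpace X]
    [TopologicalSpace T] [TopologicalSpace Z] (f₀ f₁ : C(X × T, Z)) :
    ∃ c : C(cylinderEnds X × T, Z),
      (∀ x h t, c (⟨(x, 0), h⟩, t) = f₀ (x, t)) ∧ ∀ x h t, c (⟨(x, 1), h⟩, t) = f₁ (x, t) := by
  let height : C(cylinderEnds X × T, I) := ⟨fun q => q.1.1.2, by fun_prop⟩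
  obtain ⟨c, hc⟩ := exists_continuousMap_of_isClosed_cover (Z := Z)
    (fun b : Bool => {q | height q = cond b 1 0})
    (fun b => isClosed_eq height.continuous continuous_const)
    (by
      rintro ⟨⟨p, hp | hp⟩, t⟩
      · exact ⟨false, hp⟩
      · exact ⟨true, hp⟩)
    (fun b => (cond b f₁ f₀).comp ⟨fun q => (q.1.1.1.1, q.1.2), by fun_prop⟩)
    (by
      rintro (_ | _) (_ | _) p hi hj
      · rfl
      · exact absurd (hi.symm.trans hj) zero_ne_one
      · exact absurd (hj.symm.trans hi) zero_ne_one
      · rfl)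
  exact ⟨c, fun x h t => hc false _ rfl, fun x h t => hc true _ rfl⟩

theorem Sing.exists_hom_cylinderEnds {X Z : Type u} [TopologicalSpace X] [TopologicalSpace Z]
    {K : SSet.{u}} (f₀ f₁ : K ⟶ Sing X Z) :
    ∃ c : K ⟶ Sing (cylinderEnds X) Z, ∀ d m x t,
      (∀ h, Sing.val (c.app d m) (⟨(x, 0), h⟩, t) = Sing.val (f₀.app d m) (x, t)) ∧
      ∀ h, Sing.val (c.app d m) (⟨(x, 1), h⟩, t) = Sing.val (f₁.app d m) (x, t) := by
  choose c hc₀ hc₁ using fun (d : SimplexCategoryᵒᵖ) (m : K.obj d) =>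
    exists_continuousMap_cylinderEnds (Sing.val (f₀.app d m)) (Sing.val (f₁.app d m))
  refine ⟨ssetHomMk (fun d m => Sing.mk (c d m)) fun {d d'} θ m => Sing.ext ?_,
    fun d m x t => ⟨fun h => hc₀ d m x h t, fun h => hc₁ d m x h t⟩⟩
  rintro ⟨⟨x, r⟩, hr⟩ t
  obtain rfl | rfl : r = 0 ∨ r = 1 := hr
  · exact (hc₀ _ _ _ _ _).trans ((Sing.val_app_map f₀ θ m x t).trans (hc₀ _ _ _ _ _).symm)
  · exact (hc₁ _ _ _ _ _).trans ((Sing.val_app_map f₁ θ m x t).trans (hc₁ _ _ _ _ _).symm)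

theorem homotopic_of_paths {X Z : Type*} [TopologicalSpace X] [TopologicalSpace Z]
    {f₀ f₁ : C(X, Z)} (L : C(X, C(I, Z))) (h₀ : ∀ x, L x 0 = f₀ x) (h₁ : ∀ x, L x 1 = f₁ x) :
    f₀.Homotopic f₁ :=
  ⟨⟨L.uncurry.comp ContinuousMap.prodSwap, h₀, h₁⟩⟩

end

namespace SimplicialSpace

open unitInterval

variable {Y : SimplicialObject TopCat.{u}} {Z : Type u} [TopologicalSpace Z]

/-- Postcomposition with a map, on families of singular simplices. -/
noncomputable def singMap (Y : SimplicialObject TopCat.{u}) {Z Z' : Type u} [TopologicalSpace Z]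
    [TopologicalSpace Z'] (g : C(Z, Z')) : sing Y Z ⟶ sing Y Z' where
  app k := Sing.postcomp (Y.obj (op k)) g
  naturality _ _ _ := rfl

/-- The passage from maps `Y_k × I × Δ^n → Z` to maps `Y_k × Δ^n → Z^I`. -/
noncomputable def singCurry (Y : SimplicialObject TopCat.{u}) (Z : Type u) [TopologicalSpace Z] :
    sing (prodConst Y I) Z ⟶ sing Y C(I, Z) where
  app k := ssetHomMk (fun d s => Sing.mk (ContinuousMap.curry
    ⟨fun p : (Y.obj (op k) × stdSimplex ℝ (Fin (d.unop.len + 1))) × I =>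
      Sing.val s ((p.1.1, p.2), p.1.2), (Sing.val s).continuous.comp
        (((continuous_fst.comp continuous_fst).prodMk continuous_snd).prodMk
          (continuous_snd.comp continuous_fst))⟩)) fun _ _ => rfl
  naturality _ _ _ := rfl

theorem exists_ndr_cylinderEnds {k : SimplexCategory} (N : NDR (Y.obj (op k)) (degenerate Y k)) :
    Nonempty (NDR ((prodConst Y I).obj (op k))
      (cylinderEnds (Y.obj (op k)) ∪ degenerate (prodConst Y I) k)) := by
  have union_eq : cylinderEnds (Y.obj (op k)) ∪ degenerate (prodConst Y I) k =
      {p : Y.obj (op k) × I | p.2 ∈ ({0, 1} : Set I) ∨ p.1 ∈ degenerate Y k} :=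
    Set.ext fun p => or_congr Iff.rfl (mem_degenerate_prodConst I p)
  exact (congrArg (fun S => Nonempty (NDR (Y.obj (op k) × I) S)) union_eq).mpr
    (N.exists_prod NDR.endpoints)

theorem exists_homotopy {Q : SupportedCosimplicial.{u}} {P : ∀ k, (Q.functor.obj k).Subcomplex}
    (push_mem : ∀ {k l : SimplexCategory} (α : k ⟶ l) d (m : (Q.functor.obj k).obj d),
      m ∈ (P k).obj d → (Q.functor.map α).app d m ∈ (P l).obj d)
    (hP : ∀ k, SSet.anodyneExtensions (P k ⊔ Q.bd k).ι) (hY : ClosedDegeneracies Y)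
    (N : ∀ k, Nonempty (NDR (Y.obj (op k)) (degenerate Y k))) (G₀ G₁ : Q.functor ⟶ sing Y Z)
    (h : ∀ k d m, m ∈ (P k).obj d → (G₀.app k).app d m = (G₁.app k).app d m) :
    ∃ K : Q.functor ⟶ sing Y C(I, Z), ∀ k d m y t,
      Sing.val ((K.app k).app d m) (y, t) 0 = Sing.val ((G₀.app k).app d m) (y, t) ∧
      Sing.val ((K.app k).app d m) (y, t) 1 = Sing.val ((G₁.app k).app d m) (y, t) := by
  choose c hc using fun k => Sing.exists_hom_cylinderEnds (G₀.app k) (G₁.app k)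
  have push (G : Q.functor ⟶ sing Y Z) {k l : SimplexCategory} (α : k ⟶ l) d
      (m : (Q.functor.obj k).obj d) y t : Sing.val ((G.app l).app d ((Q.functor.map α).app d m))
        (y, t) = Sing.val ((G.app k).app d m) (Y.map α.op y, t) :=
    congrArg (fun q => Sing.val (q.app d m) (y, t)) (G.naturality α)
  let D : PartialFamily Q (prodConst Y I) Z :=
    { P := P
      push_mem := push_mem
      A k := cylinderEnds (Y.obj (op k))
      map_mem _ _ hy := hy
      fP k := (P k).ι ≫ G₀.app k ≫ Sing.restr Z
        (⟨Prod.fst, continuous_fst⟩ : C(Y.obj (op k) × I, Y.obj (op k)))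
      fA := c
      fP_push α d m _ := Sing.ext fun p t => push G₀ α d m p.1 t
      fA_push := by
        rintro k l α d m ⟨y, r⟩ hr t
        obtain rfl | rfl : r = 0 ∨ r = 1 := hr
        · exact ((hc l d _ y t).1 _).trans ((push G₀ α d m y t).trans ((hc k d m _ t).1 _).symm)
        · exact ((hc l d _ y t).2 _).trans ((push G₁ α d m y t).trans ((hc k d m _ t).2 _).symm)
      fP_eq_fA := by
        rintro k d m hm ⟨y, r⟩ hr t
        obtain rfl | rfl : r = 0 ∨ r = 1 := hr
        · exact ((hc k d m y t).1 _).symm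
        · exact (congrArg (fun s => Sing.val s (y, t)) (h k d m hm)).trans
            ((hc k d m y t).2 _).symm }
  obtain ⟨F, hF⟩ := D.exists_extension hP (hY.prodConst I)
    (fun k => (exists_ndr_cylinderEnds (N k).some).some) fun k => isClosed_cylinderEnds _
  exact ⟨F ≫ singCurry Y Z, fun k d m y t =>
    ⟨((hF k).eq_fA d m (y, 0) (Or.inl rfl) t).trans ((hc k d m y t).1 _),
      ((hF k).eq_fA d m (y, 1) (Or.inr rfl) t).trans ((hc k d m y t).2 _)⟩⟩

theorem exists_extension_of_anodyne {Q : SupportedCosimplicial.{u}}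
    {P : ∀ k, (Q.functor.obj k).Subcomplex}
    (push_mem : ∀ {k l : SimplexCategory} (α : k ⟶ l) d (m : (Q.functor.obj k).obj d),
      m ∈ (P k).obj d → (Q.functor.map α).app d m ∈ (P l).obj d)
    (hP : ∀ k, SSet.anodyneExtensions (P k ⊔ Q.bd k).ι) (hY : ClosedDegeneracies Y)
    (N : ∀ k, Nonempty (NDR (Y.obj (op k)) (degenerate Y k)))
    (f : ∀ k, (P k).toSSet ⟶ (sing Y Z).obj k)
    (f_push : ∀ {k l : SimplexCategory} (α : k ⟶ l) d (m : (Q.functor.obj k).obj d)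
      (hm : m ∈ (P k).obj d),
      (f l).app d ⟨_, push_mem α d m hm⟩ = ((sing Y Z).map α).app d ((f k).app d ⟨m, hm⟩)) :
    ∃ F : Q.functor ⟶ sing Y Z, ∀ k d m (hm : m ∈ (P k).obj d),
      (F.app k).app d m = (f k).app d ⟨m, hm⟩ := by
  let D : PartialFamily Q Y Z :=
    { P := P
      push_mem := push_mem
      A _ := ∅
      map_mem _ _ hy := hy
      fP := f
      fA _ := ssetHomMk (fun _ _ => Sing.mk ⟨fun p => p.1.2.elim,
        continuous_iff_continuousAt.2 fun p => p.1.2.elim⟩) fun _ _ => Sing.ext fun y => y.2.elim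
      fP_push := f_push
      fA_push _ _ _ _ hy := hy.elim
      fP_eq_fA _ _ _ _ _ hy := hy.elim }
  obtain ⟨F, hF⟩ := D.exists_extension hP hY
    (fun k => (Set.empty_union (degenerate Y k)).symm ▸ (N k).some) fun _ => isClosed_empty
  exact ⟨F, fun k => (hF k).eq_fP⟩

end SimplicialSpace

namespace Coll

open SimplicialSpace

variable {Y : SimplicialObject TopCat.{u}} {Z : Type u} [TopologicalSpace Z]

theorem descPts_familyOfMap (g : C(realization.obj Y, Z)) : descPts (familyOfMap g) = g := by
  ext x
  obtain ⟨k, ⟨y, t⟩, rfl⟩ := exists_incl _ x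
  change g (incl Y k (y, affineMap (𝟙 k) t)) = _
  rw [affineMap_id]
  rfl

theorem descPts_comp_singMap {Z' : Type u} [TopologicalSpace Z']
    (G : cylinder.functor ⟶ sing Y Z) (g : C(Z, Z')) :
    descPts (G ≫ singMap Y g) = g.comp (descPts G) := by
  ext x
  obtain ⟨k, p, rfl⟩ := exists_incl _ x
  rfl

theorem homotopic_descPts (hY : ClosedDegeneracies Y)
    (N : ∀ k, Nonempty (NDR (Y.obj (op k)) (degenerate Y k))) {G₀ G₁ : cylinder.functor ⟶ sing Y Z}
    (h : ∀ k d m, m ∈ (marking k).base.obj d → (G₀.app k).app d m = (G₁.app k).app d m) :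
    (descPts G₀).Homotopic (descPts G₁) := by
  obtain ⟨K, hK⟩ := exists_homotopy push_mem_base anodyneExtensions_base_sup_bd hY N G₀ G₁ h
  refine homotopic_of_paths (descPts K) (fun x => ?_) fun x => ?_
  all_goals obtain ⟨k, ⟨y, t⟩, rfl⟩ := exists_incl _ x
  · exact (hK _ _ _ _ _).1
  · exact (hK _ _ _ _ _).2

end Coll

namespace ModuleOverDiscrete

open CatWithModule SimplicialSpace

variable (D : ModuleOverDiscrete.{u})

theorem homotopic_descBase {Z : Type u} [TopologicalSpace Z] (hD : D.A.IdentityIsCofibration)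
    {G₀ G₁ : Coll.cylinder.functor ⟶ sing (bar.obj D.toCatWithModule) Z}
    (h : ∀ k d m, m ∈ (Coll.marking k).pts.obj d → (G₀.app k).app d m = (G₁.app k).app d m) :
    (D.descBase G₀).Homotopic (D.descBase G₁) := by
  obtain ⟨K, hK⟩ := exists_homotopy Coll.push_mem_pts Coll.anodyneExtensions_pts_sup_bd
    (closedDegeneracies_bar hD) (exists_ndr_bar hD) G₀ G₁ h
  refine homotopic_of_paths (D.descBase K) (fun x => ?_) fun x => ?_
  all_goals obtain ⟨n, c, y, t, rfl⟩ := D.exists_incl_ofChain x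
  · exact (hK _ _ _ _ _).1
  · exact (hK _ _ _ _ _).2

theorem exists_extension_baseFamily {Z : Type u} [TopologicalSpace Z]
    (hD : D.A.IdentityIsCofibration) (g : C(realization.obj (bar.obj (simplexModule.obj D)), Z)) :
    ∃ Φ : Coll.cylinder.functor ⟶ sing (bar.obj D.toCatWithModule) Z,
      ∀ k d m (hm : m ∈ (Coll.marking.{u} k).base.obj d),
        (Φ.app k).app d m = (D.baseFamily g k).app d ⟨m, hm⟩ :=
  exists_extension_of_anodyne Coll.push_mem_base Coll.anodyneExtensions_base_sup_bd
    (closedDegeneracies_bar hD) (exists_ndr_bar hD) _ (D.baseFamily_push g)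

theorem exists_homotopyEquiv (hD : D.A.IdentityIsCofibration) :
    ∃ e : ContinuousMap.HomotopyEquiv (realization.obj (bar.obj (simplexModule.obj D)))
      (realization.obj (bar.obj D.toCatWithModule)), e.toFun = D.compareMap := by
  obtain ⟨Φ, hΦ⟩ := D.exists_extension_baseFamily hD (.id _)
  let g := Coll.descPts Φ
  refine ⟨⟨D.compareMap, g, ?_, ?_⟩, rfl⟩
  · have pts_eq : ∀ k d m, m ∈ (Coll.marking k).pts.obj d →
        ((Coll.familyOfMap g).app k).app d m = (Φ.app k).app d m :=
      fun k d m hm => Sing.ext fun y t => (Coll.val_of_mem_pts Φ m hm y t).symm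
    have homotopic := D.homotopic_descBase hD pts_eq
    rwa [descBase_familyOfMap, D.descBase_eq_of_base hΦ] at homotopic
  · have base_eq : ∀ k d m, m ∈ (Coll.marking k).base.obj d →
        ((Φ ≫ singMap _ D.compareMap).app k).app d m =
          ((Coll.familyOfMap (.id _)).app k).app d m :=
      fun k d m hm => Sing.ext fun y t =>
        (congrArg (fun s => D.compareMap (Sing.val s (y, t))) (hΦ k d m hm)).trans
          (D.compareMap_baseFamily m hm y t)
    have homotopic := Coll.homotopic_descPts (closedDegeneracies_bar hD) (exists_ndr_bar hD) base_eq
    rwa [Coll.descPts_comp_singMap, Coll.descPts_familyOfMap] at homotopic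

end ModuleOverDiscrete

theorem theorem3p2 :
    ∃ η : ModuleOverDiscrete.simplexModule.{u} ⋙ hocolim.{0, u} ⟶
        ModuleOverDiscrete.forget.{u} ⋙ hocolim.{u, u},
      ∀ D : ModuleOverDiscrete.{u}, D.A.IdentityIsCofibration →
        ∃ e : ContinuousMap.HomotopyEquiv
            (hocolim.obj (ModuleOverDiscrete.simplexModule.obj D))
            (hocolim.obj D.toCatWithModule),
          e.toFun = (η.app D).hom := by
  exact ⟨Functor.whiskerRight ModuleOverDiscrete.compare.{u} SimplicialSpace.realization.{u},
    fun D hD => D.exists_homotopyEquiv hD⟩
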